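/- **Setting.** Let $Q=[0,1]\times[0,\infty)$ and $\alpha\in\mathbb R$. Let $K_1,K_2\in C([0,1])$ satisfy $K_1<0<K_2$ on $[0,1]$, and suppose that the distributional second derivatives $K_1'',K_2''$ on $(0,1)$ belong to $L^2([0,1])$ (so $K_i\in C^1([0,1])$). Condition (F1) on $f,\sigma:[0,1]\times\mathbb R\to\mathbb R$: both are bounded, measurable in the first variable, and there is $C>0$ with $|f(x,y)-f(x,\hat y)|+|\sigma(x,y)-\sigma(x,\hat y)|\le C|y-\hat y|$ for all $x\in[0,1]$, $y,\hat y\in\mathbb R$. Let $u_0\in C([0,1])$ with $K_1\le u_0\le K_2$. A control is a function $h(x,t)=\int_0^t\int_0^x\dot h(y,s)\,dy\,ds$ with $\int_0^T\int_0^1\dot h^2\,dx\,dt<\infty$ for every $T>0$. A solution of the skeleton reflected PDE $$\partial_t u-\partial_x^2u+\alpha u=f(x,u)+\sigma(x,u)\dot h+\eta-\xi,\qquad K_1\le u\le K_2,$$ $$u(\cdot,0)=u_0,\qquad \partial_xu(0,t)=\partial_xu(1,t)=0,$$ is a triple $(u,\eta,\xi)$ where $u\in C(Q)$ satisfies $K_1(x)\le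 u(x,t)\le K_2(x)$ and $u(\cdot,0)=u_0$; $\eta,\xi$ are (positive) measures on $Q$, finite on $[0,1]\times[0,T]$ for every $T>0$; for all $t\ge0$ and all $\varphi\in C^\infty([0,1])$ with $\varphi'(0)=\varphi'(1)=0$, $$\int_0^1u(x,t)\varphi\,dx-\int_0^t\!\!\int_0^1u\varphi''\,dx\,ds+\alpha\int_0^t\!\!\int_0^1u\varphi\,dx\,ds=\int_0^1u_0\varphi\,dx+\int_0^t\!\!\int_0^1\big(f(x,u)+\sigma(x,u)\dot h\big)\varphi\,dx\,ds+\int_{[0,1]\times[0,t]}\varphi\,d\eta-\int_{[0,1]\times[0,t]}\varphi\,d\xi;$$ and $\int_{[0,1]\times[0,T]}(u-K_1)\,d\eta=\int_{[0,1]\times[0,T]}(K_2-u)\,d\xi=0$ for every $T>0$. **Theorem 4.1.** Assume (F1). 1. For every $u_0$ and every control $h$ as above there is a unique solution $(u^h,\eta^h,\xi^h)$. 2. The restrictions of $\eta^h$ and $\xi^h$ to $(0,1)\times[0,\infty)$ are absolutely continuous with respect to $dx\,dt$. If $K_1'(0)\ge0\ge K_1'(1)$ (for instance if $K_1'(0)=K_1'(1)=0$),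 then $\eta^h$ itself is absolutely continuous on $Q$; if $K_2'(0)\le0\le K_2'(1)$, then $\xi^h$ itself is absolutely continuous on $Q$. Let $\dot\eta^h,\dot\xi^h$ be the densities (Radon–Nikodym derivatives with respect to $dx\,dt$). 3. For every $T>0$, $$\int_0^T\!\!\int_0^1|\dot\eta^h|^2\,dx\,dt\le C,\qquad \int_0^T\!\!\int_0^1|\dot\xi^h|^2\,dx\,dt\le C,$$ where $C$ depends only on $\alpha,K_1,K_2,T$, a common bound $M$ of $|f|$ and $|\sigma|$, and an upper bound $R$ of $\int_0^T\int_0^1\dot h^2\,dx\,dt$. 4. If $\alpha>0$, there is a constant $C$ depending only on $\alpha,K_1,K_2$ and a common bound $M$ of $|f|$ and $|\sigma|$ (in particular independent of $T$, $h$ and $u_0$) such that, whenever $\|h\|_2^\infty:=\int_0^\infty\int_0^1\dot h^2\,dx\,dt<\infty$, for every $T>0$ $$\int_0^Te^{-\alpha(T-t)}\!\int_0^1|\dot\eta^h|^2\,dx\,dt\le C(1+\|h\|_2^\infty),\qquad \int_0^Te^{-\alpha(T-t)}\!\int_0^1|\dot\xi^h|^2\,dx\,dt\le C(1+\|h\|_2^\infty).$$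 -/

import Mathlib

open MeasureTheory Set
open scoped ContDiff

namespace ReflectedSkeleton

/-- The space-time domain `[0,1] × [0,∞)`; a point is written `z = (x, t)`. -/
def Q : Set (ℝ × ℝ) := Icc (0 : ℝ) 1 ×ˢ Ici (0 : ℝ)

/-- The strip `[0,1] × [0,T]`. -/
def strip (T : ℝ) : Set (ℝ × ℝ) := Icc (0 : ℝ) 1 ×ˢ Icc (0 : ℝ) T

/-- The part `(0,1) × [0,∞)` of the domain away from the two lateral boundary lines. -/
def openStrip : Set (ℝ × ℝ) := Ioo (0 : ℝ) 1 ×ˢ Ici (0 : ℝ)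

/-- The distributional second derivative of `K` on `(0,1)` is represented by a function in
`L²([0,1])`. -/
def HasL2SecondDeriv (K : ℝ → ℝ) : Prop :=
  ∃ k : ℝ → ℝ, MemLp k 2 (volume.restrict (Icc (0 : ℝ) 1)) ∧
    ∀ φ : ℝ → ℝ, ContDiff ℝ ∞ φ → HasCompactSupport φ → tsupport φ ⊆ Ioo (0 : ℝ) 1 →
      ∫ x in Icc (0 : ℝ) 1, K x * iteratedDeriv 2 φ x = ∫ x in Icc (0 : ℝ) 1, k x * φ x

/-- The standing assumptions on the two reflecting walls: they are continuous on `[0,1]`,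
`K₁ < 0 < K₂` there, and their distributional second derivatives are in `L²([0,1])`. -/
structure IsWallPair (K₁ K₂ : ℝ → ℝ) : Prop where
  continuousOn_lower : ContinuousOn K₁ (Icc 0 1)
  continuousOn_upper : ContinuousOn K₂ (Icc 0 1)
  lower_neg : ∀ x ∈ Icc (0 : ℝ) 1, K₁ x < 0
  upper_pos : ∀ x ∈ Icc (0 : ℝ) 1, 0 < K₂ x
  lower_deriv2 : HasL2SecondDeriv K₁
  upper_deriv2 : HasL2SecondDeriv K₂

/-- Condition on the coefficients `f, σ : [0,1] × ℝ → ℝ`: they are bounded and Lipschitz in the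
second variable uniformly in the first one (and measurable in the first one). -/
structure CoeffCondition (f σ : ℝ → ℝ → ℝ) : Prop where
  aemeasurable_f : ∀ y, AEMeasurable (fun x => f x y) (volume.restrict (Icc (0 : ℝ) 1))
  aemeasurable_σ : ∀ y, AEMeasurable (fun x => σ x y) (volume.restrict (Icc (0 : ℝ) 1))
  bounded : ∃ M : ℝ, ∀ x ∈ Icc (0 : ℝ) 1, ∀ y : ℝ, |f x y| ≤ M ∧ |σ x y| ≤ M
  lipschitz : ∃ C : ℝ, 0 < C ∧ ∀ x ∈ Icc (0 : ℝ) 1, ∀ y y' : ℝ,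
    |f x y - f x y'| + |σ x y - σ x y'| ≤ C * |y - y'|

/-- An admissible initial value: continuous on `[0,1]` and between the walls. -/
structure IsInitialValue (K₁ K₂ u₀ : ℝ → ℝ) : Prop where
  continuousOn : ContinuousOn u₀ (Icc 0 1)
  lower_le : ∀ x ∈ Icc (0 : ℝ) 1, K₁ x ≤ u₀ x
  le_upper : ∀ x ∈ Icc (0 : ℝ) 1, u₀ x ≤ K₂ x

/-- `h` belongs to the Cameron-Martin space of the Brownian sheet on `[0,1] × [0,∞)`, with density
`hdot`: the density is square integrable on every strip `[0,1] × [0,T]` and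
`h (x,t) = ∫₀ᵗ ∫₀ˣ hdot (y,s) dy ds`. -/
structure IsCameronMartin (h hdot : ℝ × ℝ → ℝ) : Prop where
  memLp : ∀ T : ℝ, 0 < T → MemLp hdot 2 (volume.restrict (strip T))
  eq_integral : ∀ x ∈ Icc (0 : ℝ) 1, ∀ t : ℝ, 0 ≤ t →
    h (x, t) = ∫ z in Icc (0 : ℝ) x ×ˢ Icc (0 : ℝ) t, hdot z

/-- `(u, η, ξ)` solves the skeleton equation with two reflecting walls
`∂ₜu - ∂ₓ²u + α u = f(x,u) + σ(x,u) hdot + η - ξ`, `K₁ ≤ u ≤ K₂`, `u(·,0) = u₀`, with Neumann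
boundary conditions, in the weak sense. The measures `η, ξ` on `[0,1] × [0,∞)` are
represented by measures on the plane that do not charge the complement. -/
structure IsSolution (α : ℝ) (K₁ K₂ : ℝ → ℝ) (f σ : ℝ → ℝ → ℝ) (u₀ : ℝ → ℝ)
    (hdot : ℝ × ℝ → ℝ) (u : ℝ × ℝ → ℝ) (η ξ : Measure (ℝ × ℝ)) : Prop where
  continuousOn : ContinuousOn u Q
  lower_le : ∀ z ∈ Q, K₁ z.1 ≤ u z
  le_upper : ∀ z ∈ Q, u z ≤ K₂ z.1
  initial : ∀ x ∈ Icc (0 : ℝ) 1, u (x, 0) = u₀ x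
  supp_η : η Qᶜ = 0
  supp_ξ : ξ Qᶜ = 0
  finite_η : ∀ T : ℝ, 0 < T → η (strip T) < ⊤
  finite_ξ : ∀ T : ℝ, 0 < T → ξ (strip T) < ⊤
  weak : ∀ t : ℝ, 0 ≤ t → ∀ φ : ℝ → ℝ, ContDiff ℝ ∞ φ → deriv φ 0 = 0 → deriv φ 1 = 0 →
    (∫ x in Icc (0 : ℝ) 1, u (x, t) * φ x)
        - (∫ z in strip t, u z * iteratedDeriv 2 φ z.1)
        + α * (∫ z in strip t, u z * φ z.1)
      = (∫ x in Icc (0 : ℝ) 1, u₀ x * φ x)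
        + (∫ z in strip t, f z.1 (u z) * φ z.1)
        + (∫ z in strip t, σ z.1 (u z) * hdot z * φ z.1)
        + (∫ z in strip t, φ z.1 ∂η) - (∫ z in strip t, φ z.1 ∂ξ)
  reflect_η : ∀ T : ℝ, 0 < T → ∫ z in strip T, (u z - K₁ z.1) ∂η = 0
  reflect_ξ : ∀ T : ℝ, 0 < T → ∫ z in strip T, (K₂ z.1 - u z) ∂ξ = 0

end ReflectedSkeleton

/-! The engine is a Lewy–Stampacchia bound obtained from a penalization of finite strength. Tested
against Neumann test functions, the second derivative of a wall K is a measure κ: an L² function on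
(0,1) together with the masses K'(0) at 0 and −K'(1) at 1. Thus a wall is a stationary solution of
the Neumann heat equation with source −κ. Let m dominate the reaction f + σ·hdot − αu, its linear
part being truncated at the walls. Where the profile lies below the lower wall, an upward push of
size max(0, −κ₁) + m already makes the total source at least −κ₁, so the maximum principle applied
to K₁ − u forbids crossing; the upper wall is symmetric. No penalty tending to infinity is needed,
and the reflection densities lie between 0 and `load`. Absolute continuity and both L² estimates are
read off from this pointwise bound: on the lateral boundary m vanishes, and what remains of the load
vanishes under the sign conditions on the slopes of the walls (`exists_reflected`,
`IsSolution.exists_density`, `lintegral_weight_rnDeriv_sq_le`).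

The penalized equation has a discontinuous right-hand side. It is solved with the penalty and the
reaction evaluated at a profile delayed by δ, which is an explicit stepping scheme
(`exists_delayed`). As δ tends to 0 the switching functions converge weak-* in L^∞ along a
subsequence, and the heat solution operator turns this into pointwise convergence of the profiles
(`tendsto_heatSol`, `exists_penalized_limit`). The limiting switches are 0 or 1 away from the
contact sets; on the contact sets they take some value in [0,1], and switch times load is the
reflection density.

Two tools carry the linear theory. The forced Neumann heat equation is solved by a cosine series,
whose absolute convergence follows from an L² duality estimate uniform over bounded families of
forcings (`IsForcing.sum_coef_le`). The maximum principle is proved in weak form by mollifying with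
a kernel built by the method of images, which is itself a Neumann test function
(`le_of_subsolution`).

For uniqueness, subtract from u − u' the heat solution driven by the difference of the reactions.
Where the remainder is large, u > u', and the reflection measures can only push it down
(`IsSolution.sub_le`). The Lipschitz condition makes this a contraction on short time intervals, so
the profiles agree. The weak forms then give η + ξ' = η' + ξ, and the disjoint contact sets separate
the two parts (`IsSolution.measures_eq`). Consequently the bounds of the constructed solution hold
for every solution. -/

namespace ReflectedSkeleton

open Filter Topology

/-! ### Neumann test functions and mollification by the method of images -/

/-- Smooth test functions with vanishing derivative at the two end points of `[0,1]`. -/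
structure IsTest (φ : ℝ → ℝ) : Prop where
  contDiff : ContDiff ℝ ∞ φ
  left : deriv φ 0 = 0
  right : deriv φ 1 = 0

theorem IsTest.continuous {φ : ℝ → ℝ} (h : IsTest φ) : Continuous φ := h.contDiff.continuous

theorem IsTest.continuous_deriv2 {φ : ℝ → ℝ} (h : IsTest φ) : Continuous (iteratedDeriv 2 φ) :=
  h.contDiff.continuous_iteratedDeriv 2 (WithTop.coe_le_coe.2 le_top)

/-- A smooth even probability density supported in `(-δ, δ)`. -/
structure IsMollifier (δ : ℝ) (ρ : ℝ → ℝ) : Prop where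
  contDiff : ContDiff ℝ ∞ ρ
  even : ∀ x, ρ (-x) = ρ x
  nonneg : ∀ x, 0 ≤ ρ x
  zero : ∀ x, δ ≤ |x| → ρ x = 0
  integral : ∫ x, ρ x = 1

theorem exists_isMollifier {δ : ℝ} (hδ : 0 < δ) : ∃ ρ, IsMollifier δ ρ := by
  let b : ContDiffBump (0 : ℝ) := ⟨δ / 2, δ, by positivity, by linarith⟩
  refine ⟨b.normed volume, b.contDiff_normed, fun x => b.normed_neg x,
    fun x => b.nonneg_normed x, fun x hx => ?_, b.integral_normed⟩
  have : x ∉ Function.support (b.normed volume) := by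
    rw [b.support_normed_eq]
    simpa [Metric.mem_ball, Real.dist_eq] using hx
  simpa using this

/-- The mollifier reflected at the two end points of `[0,1]`. -/
def neumannKernel (ρ : ℝ → ℝ) (x y : ℝ) : ℝ := ρ (x - y) + ρ (x + y) + ρ (2 - x - y)

theorem hasDerivAt_integral_sub {ψ ψ' g : ℝ → ℝ} {C : ℝ} (hψ : ∀ x, HasDerivAt ψ (ψ' x) x)
    (hψ' : Continuous ψ') (hC : ∀ x, |ψ' x| ≤ C) (hg : ContinuousOn g (Icc 0 1)) (x : ℝ) :
    HasDerivAt (fun x => ∫ y in Icc (0 : ℝ) 1, ψ (x - y) * g y)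
      (∫ y in Icc (0 : ℝ) 1, ψ' (x - y) * g y) x := by
  have hψc : Continuous ψ := continuous_iff_continuousAt.2 fun x => (hψ x).continuousAt
  have hmeas : ∀ {χ : ℝ → ℝ}, Continuous χ → ∀ x : ℝ,
      IntegrableOn (fun y => χ (x - y) * g y) (Icc 0 1) := fun hχ x =>
    ContinuousOn.integrableOn_Icc
      ((hχ.comp (continuous_const.sub continuous_id)).continuousOn.mul hg)
  refine (hasDerivAt_integral_of_dominated_loc_of_deriv_le (bound := fun y => C * |g y|)
    (F := fun x y => ψ (x - y) * g y) (F' := fun x y => ψ' (x - y) * g y) (s := univ)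
    univ_mem ?_ ?_ ?_ ?_ ?_ ?_).2
  · exact Eventually.of_forall fun x => (hmeas hψc x).aestronglyMeasurable
  · exact hmeas hψc x
  · exact (hmeas hψ' x).aestronglyMeasurable
  · refine Eventually.of_forall fun y x _ => ?_
    rw [norm_mul, Real.norm_eq_abs, Real.norm_eq_abs]
    exact mul_le_mul_of_nonneg_right (hC _) (abs_nonneg _)
  · exact (hg.abs.integrableOn_Icc).const_mul C
  · refine Eventually.of_forall fun y x _ => ?_
    have := ((hψ (x - y)).comp x ((hasDerivAt_id x).sub_const y)).mul_const (g y)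
    simpa using this

section Mollifier
variable {δ : ℝ} {ρ : ℝ → ℝ}

theorem IsMollifier.contDiff_iteratedDeriv (h : IsMollifier δ ρ) (n : ℕ) :
    ContDiff ℝ ∞ (iteratedDeriv n ρ) :=
  by
  rw [iteratedDeriv_eq_iterate]
  exact ContDiff.iterate_deriv n h.contDiff

theorem IsMollifier.hasDerivAt (h : IsMollifier δ ρ) (n : ℕ) (x : ℝ) :
    HasDerivAt (iteratedDeriv n ρ) (iteratedDeriv (n + 1) ρ x) x := by
  rw [iteratedDeriv_succ]
  exact ((h.contDiff_iteratedDeriv n).differentiable (by simp) x).hasDerivAt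

theorem IsMollifier.hasCompactSupport (h : IsMollifier δ ρ) : HasCompactSupport ρ := by
  refine HasCompactSupport.intro (K := Icc (-δ) δ) isCompact_Icc fun x hx => h.zero x ?_
  by_contra! hlt
  exact hx ⟨(abs_lt.1 hlt).1.le, (abs_lt.1 hlt).2.le⟩

theorem IsMollifier.exists_bound (h : IsMollifier δ ρ) (n : ℕ) :
    ∃ C, ∀ x, |iteratedDeriv n ρ x| ≤ C := by
  have hc : HasCompactSupport (iteratedDeriv n ρ) := by
    induction n with
    | zero => simpa using h.hasCompactSupport
    | succ n ih => rw [iteratedDeriv_succ]; exact ih.deriv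
  obtain ⟨C, hC⟩ := hc.exists_bound_of_continuous (h.contDiff_iteratedDeriv n).continuous
  exact ⟨C, fun x => by simpa using hC x⟩

theorem IsMollifier.deriv_neg (h : IsMollifier δ ρ) (x : ℝ) : deriv ρ (-x) = - deriv ρ x := by
  have h1 : (fun x => ρ (-x)) = ρ := funext h.even
  have h2 := deriv_comp_neg ρ x
  rw [h1] at h2
  linarith

theorem IsMollifier.deriv2_neg (h : IsMollifier δ ρ) (x : ℝ) :
    iteratedDeriv 2 ρ (-x) = iteratedDeriv 2 ρ x := by
  have h1 : (fun x => ρ (-x)) = ρ := funext h.even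
  have h2 := iteratedDeriv_comp_neg 2 ρ x
  rw [h1] at h2
  simpa using h2.symm

theorem IsMollifier.deriv_eq_zero (h : IsMollifier δ ρ) {x : ℝ} (hx : δ < |x|) :
    deriv ρ x = 0 := by
  have : ρ =ᶠ[𝓝 x] fun _ => 0 := by
    filter_upwards [continuous_abs.continuousAt.eventually (lt_mem_nhds hx)] with y hy
    exact h.zero y hy.le
  rw [this.deriv_eq]; simp

theorem hasDerivAt_neumannKernel {ψ ψ' : ℝ → ℝ} (hψ : ∀ x, HasDerivAt ψ (ψ' x) x) (x y : ℝ)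
    (a : ℝ) : HasDerivAt (fun y => a * ψ (x - y) + ψ (x + y) + a * ψ (2 - x - y))
      (- a * ψ' (x - y) + ψ' (x + y) - a * ψ' (2 - x - y)) y := by
  have h1 := ((hψ (x - y)).comp y ((hasDerivAt_id y).const_sub x)).const_mul a
  have h2 := (hψ (x + y)).comp y ((hasDerivAt_id y).const_add x)
  have h3 := ((hψ (2 - x - y)).comp y ((hasDerivAt_id y).const_sub (2 - x))).const_mul a
  exact ((h1.add h2).add h3).congr_deriv (by ring)

theorem IsMollifier.deriv_neumannKernel (h : IsMollifier δ ρ) (x : ℝ) :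
    deriv (neumannKernel ρ x) = fun y => (-1) * deriv ρ (x - y) + deriv ρ (x + y)
      + (-1) * deriv ρ (2 - x - y) := by
  funext y
  have h0 : ∀ x, HasDerivAt ρ (deriv ρ x) x := fun x => by
    simpa [iteratedDeriv_one] using h.hasDerivAt 0 x
  have := (hasDerivAt_neumannKernel h0 x y 1).deriv
  simp only [one_mul] at this
  rw [show neumannKernel ρ x = fun y => ρ (x - y) + ρ (x + y) + ρ (2 - x - y) from rfl, this]
  ring

theorem IsMollifier.deriv2_neumannKernel (h : IsMollifier δ ρ) (x y : ℝ) :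
    iteratedDeriv 2 (neumannKernel ρ x) y =
      iteratedDeriv 2 ρ (x - y) + iteratedDeriv 2 ρ (x + y) + iteratedDeriv 2 ρ (2 - x - y) := by
  have h1 : ∀ x, HasDerivAt (deriv ρ) (iteratedDeriv 2 ρ x) x := fun x => by
    simpa [iteratedDeriv_one] using h.hasDerivAt 1 x
  rw [iteratedDeriv_succ, iteratedDeriv_one, h.deriv_neumannKernel,
    (hasDerivAt_neumannKernel h1 x y (-1)).deriv]
  ring

/-- At each end point the source and its nearest image contribute opposite slopes, while the
remaining image is out of reach because δ < 1/2. One reflection at each end is therefore enough. -/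
theorem IsMollifier.isTest (h : IsMollifier δ ρ) (hδ : δ < 1 / 2) {x : ℝ} (hx : x ∈ Icc (0 : ℝ) 1) :
    IsTest (neumannKernel ρ x) := by
  refine ⟨?_, ?_, ?_⟩
  · have := h.contDiff
    unfold neumannKernel
    fun_prop
  · rw [h.deriv_neumannKernel]
    have : deriv ρ (2 - x - 0) = 0 := h.deriv_eq_zero (by
      rw [abs_of_nonneg] <;> linarith [hx.1, hx.2])
    simp only [sub_zero, add_zero] at this ⊢
    rw [this]; ring
  · rw [h.deriv_neumannKernel]
    have h1 : deriv ρ (x + 1) = 0 := h.deriv_eq_zero (by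
      rw [abs_of_nonneg] <;> linarith [hx.1, hx.2])
    have h2 := h.deriv_neg (x - 1)
    rw [show -(x - 1) = 2 - x - 1 by ring] at h2
    simp only [h1, h2]; ring

theorem IsMollifier.neumannKernel_nonneg (h : IsMollifier δ ρ) (x y : ℝ) :
    0 ≤ neumannKernel ρ x y :=
  add_nonneg (add_nonneg (h.nonneg _) (h.nonneg _)) (h.nonneg _)

/-- The images of a point of [0,1] are at least as far away as the point itself. -/
theorem IsMollifier.neumannKernel_eq_zero (h : IsMollifier δ ρ) {x y : ℝ}
    (hx : x ∈ Icc (0 : ℝ) 1) (hy : y ∈ Icc (0 : ℝ) 1) (hxy : δ ≤ |x - y|) :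
    neumannKernel ρ x y = 0 := by
  have h1 : |x - y| ≤ |x + y| := by
    rw [abs_of_nonneg (add_nonneg hx.1 hy.1), abs_le]
    constructor <;> linarith [hx.1, hy.1]
  have h2 : |x - y| ≤ |2 - x - y| := by
    rw [abs_of_nonneg (by linarith [hx.2, hy.2] : 0 ≤ 2 - x - y), abs_le]
    constructor <;> linarith [hx.2, hy.2]
  simp [neumannKernel, h.zero _ hxy, h.zero _ (hxy.trans h1), h.zero _ (hxy.trans h2)]

/-- By evenness the three images unfold to the integral of ρ over the single interval [x − 2, x +
1], which contains its support. -/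
theorem IsMollifier.integral_neumannKernel (h : IsMollifier δ ρ) (hδ : δ < 1 / 2) {x : ℝ}
    (hx : x ∈ Icc (0 : ℝ) 1) : ∫ y in Icc (0 : ℝ) 1, neumannKernel ρ x y = 1 := by
  have hc : Continuous ρ := h.contDiff.continuous
  have hi : ∀ a b : ℝ, IntervalIntegrable ρ volume a b := fun a b => hc.intervalIntegrable a b
  rw [integral_Icc_eq_integral_Ioc, ← intervalIntegral.integral_of_le zero_le_one]
  unfold neumannKernel
  rw [intervalIntegral.integral_add, intervalIntegral.integral_add,
    intervalIntegral.integral_comp_sub_left, intervalIntegral.integral_comp_add_left,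
    intervalIntegral.integral_comp_sub_left]
  rotate_left
  any_goals exact (by fun_prop : Continuous _).intervalIntegrable _ _
  have e3 : ∫ z in (2 - x - 1)..(2 - x - 0), ρ z = ∫ z in (x - 2)..(x - 1), ρ z := by
    have := intervalIntegral.integral_comp_neg (f := ρ) (a := x - 2) (b := x - 1)
    simp only [h.even] at this
    rw [this]; congr 1 <;> ring
  rw [e3, add_comm, ← add_assoc, intervalIntegral.integral_add_adjacent_intervals (hi _ _) (by
    simpa using hi _ _), sub_zero, add_zero, intervalIntegral.integral_add_adjacent_intervals
    (hi _ _) (hi _ _), intervalIntegral.integral_eq_integral_of_support_subset, h.integral]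
  intro z hz
  by_contra hcon
  refine hz (h.zero z ?_)
  rw [mem_Ioc, not_and_or] at hcon
  rcases hcon with hcon | hcon
  · rw [abs_of_nonpos] <;> linarith [hx.1, hx.2]
  · rw [abs_of_nonneg] <;> linarith [hx.1, hx.2]

/-- At a maximum over `[0,1]` of the mollified function, its second derivative is nonpositive. -/
theorem IsMollifier.integral_deriv2_nonpos (h : IsMollifier δ ρ) (hδ : δ < 1 / 2) {g : ℝ → ℝ}
    (hg : ContinuousOn g (Icc 0 1)) {x₀ : ℝ} (hx₀ : x₀ ∈ Icc (0 : ℝ) 1)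
    (hmax : ∀ x ∈ Icc (0 : ℝ) 1, ∫ y in Icc (0 : ℝ) 1, g y * neumannKernel ρ x y ≤
      ∫ y in Icc (0 : ℝ) 1, g y * neumannKernel ρ x₀ y) :
    ∫ y in Icc (0 : ℝ) 1, g y * iteratedDeriv 2 (neumannKernel ρ x₀) y ≤ 0 := by
  -- `R n` is convolution with the n-th derivative of ρ. The mollified function is G(x) = R₀(x) +
  -- R₀(−x) + R₀(2 − x), smooth on the whole line, so two-sided calculus applies even at the end
  -- points.
  set R : ℕ → ℝ → ℝ := fun n x => ∫ y in Icc (0 : ℝ) 1, iteratedDeriv n ρ (x - y) * g y with hR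
  have hRd : ∀ n x, HasDerivAt (R n) (R (n + 1) x) x := fun n x => by
    obtain ⟨C, hC⟩ := h.exists_bound (n + 1)
    exact hasDerivAt_integral_sub (h.hasDerivAt n) (h.contDiff_iteratedDeriv (n + 1)).continuous
      hC hg x
  set G : ℝ → ℝ := fun x => R 0 x + R 0 (-x) + R 0 (2 - x) with hG
  set G1 : ℝ → ℝ := fun x => R 1 x - R 1 (-x) - R 1 (2 - x) with hG1
  have hGd : ∀ x, HasDerivAt G (G1 x) x := fun x => by
    have h2 := (hRd 0 (-x)).comp x (hasDerivAt_neg x)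
    have h3 := (hRd 0 (2 - x)).comp x ((hasDerivAt_id x).const_sub 2)
    exact (((hRd 0 x).add h2).add h3).congr_deriv (by simp only [hG1, zero_add]; ring)
  have hG1d : ∀ x, HasDerivAt G1 (R 2 x + R 2 (-x) + R 2 (2 - x)) x := fun x => by
    have h2 := (hRd 1 (-x)).comp x (hasDerivAt_neg x)
    have h3 := (hRd 1 (2 - x)).comp x ((hasDerivAt_id x).const_sub 2)
    exact (((hRd 1 x).sub h2).sub h3).congr_deriv (by norm_num)
  have hint : ∀ n (a : ℝ), IntegrableOn (fun y => iteratedDeriv n ρ (a - y) * g y) (Icc 0 1) :=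
    fun n a => ContinuousOn.integrableOn_Icc ((((h.contDiff_iteratedDeriv n).continuous.comp
      (continuous_const.sub continuous_id)).continuousOn).mul hg)
  have e0 : ∀ x, ∫ y in Icc (0 : ℝ) 1, g y * neumannKernel ρ x y = G x := fun x => by
    simp only [hG, hR]
    rw [← integral_add (hint 0 _) (hint 0 _), ← integral_add (by exact (hint 0 _).add (hint 0 _)) (hint 0 _)]
    congr 1; funext y
    have := h.even (x + y)
    simp only [iteratedDeriv_zero, neumannKernel]
    rw [show -x - y = -(x + y) by ring, this]; ring
  have e2 : ∀ x, ∫ y in Icc (0 : ℝ) 1, g y * iteratedDeriv 2 (neumannKernel ρ x) y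
      = R 2 x + R 2 (-x) + R 2 (2 - x) := fun x => by
    simp only [hR]
    rw [← integral_add (hint 2 _) (hint 2 _), ← integral_add (by exact (hint 2 _).add (hint 2 _)) (hint 2 _)]
    congr 1; funext y
    have := h.deriv2_neg (x + y)
    simp only [h.deriv2_neumannKernel]
    rw [show -x - y = -(x + y) by ring, this]; ring
  have hR0 : ∀ x, (x ≤ -(1 / 2) ∨ 3 / 2 ≤ x) → R 0 x = 0 := fun x hx => by
    simp only [hR, iteratedDeriv_zero]
    rw [setIntegral_congr_fun (g := fun _ => (0 : ℝ)) measurableSet_Icc, integral_zero]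
    intro y hy
    simp only
    rw [h.zero, zero_mul]
    rcases hx with hx | hx
    · rw [abs_of_nonpos] <;> linarith [hy.1, hy.2]
    · rw [abs_of_nonneg] <;> linarith [hy.1, hy.2]
  -- Near an end point the far image vanishes and G is symmetric about that end point, so a maximum
  -- over [0,1] is a two-sided local maximum.
  have hloc : IsLocalMax G x₀ := by
    have hM : ∀ x ∈ Icc (0 : ℝ) 1, G x ≤ G x₀ := fun x hx => by
      simpa only [e0] using hmax x hx
    rcases eq_or_lt_of_le hx₀.1 with h0 | h0
    · have : Ioo (-(1/2) : ℝ) (1/2) ∈ 𝓝 x₀ := Ioo_mem_nhds (by linarith) (by linarith)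
      filter_upwards [this] with x hx
      rcases le_total 0 x with hx0 | hx0
      · exact hM x ⟨hx0, by linarith [hx.2]⟩
      · have := hM (-x) ⟨by linarith, by linarith [hx.1]⟩
        have a1 := hR0 (2 - x) (Or.inr (by linarith [hx.2]))
        have a2 := hR0 (2 + x) (Or.inr (by linarith [hx.1]))
        simp only [hG, a1, neg_neg, sub_neg_eq_add, a2] at this ⊢
        linarith
    rcases eq_or_lt_of_le hx₀.2 with h1 | h1
    · have : Ioo (1/2 : ℝ) (3/2) ∈ 𝓝 x₀ := Ioo_mem_nhds (by linarith) (by linarith)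
      filter_upwards [this] with x hx
      rcases le_total x 1 with hx0 | hx0
      · exact hM x ⟨by linarith [hx.1], hx0⟩
      · have := hM (2 - x) ⟨by linarith [hx.2], by linarith⟩
        have a1 := hR0 (-x) (Or.inl (by linarith [hx.1]))
        have a2 := hR0 (x - 2) (Or.inl (by linarith [hx.2]))
        simp only [hG, a1, neg_sub, sub_sub_cancel, a2] at this ⊢
        linarith
    · filter_upwards [Ioo_mem_nhds h0 h1] with x hx
      exact hM x ⟨hx.1.le, hx.2.le⟩
  rw [e2]
  by_contra! hpos
  have hd : deriv G = G1 := funext fun x => (hGd x).deriv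
  -- A positive second derivative at this critical point would make it a local minimum as well, so G
  -- would be locally constant and its second derivative zero.
  have hmin : IsLocalMin G x₀ := isLocalMin_of_deriv_deriv_pos
    (by rw [hd, (hG1d x₀).deriv]; exact hpos) hloc.deriv_eq_zero (hGd x₀).continuousAt
  have hconst : G =ᶠ[𝓝 x₀] fun _ => G x₀ := by
    filter_upwards [hloc, hmin] with x h1 h2 using le_antisymm h1 h2
  have h3 : deriv (deriv G) x₀ = 0 := by
    rw [hconst.deriv.deriv_eq]; simp
  rw [hd, (hG1d x₀).deriv] at h3
  linarith

end Mollifier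


/-! ### Weak maximum principle -/

theorem isCompact_strip (T : ℝ) : IsCompact (strip T) := isCompact_Icc.prod isCompact_Icc

theorem measurableSet_strip (T : ℝ) : MeasurableSet (strip T) :=
  measurableSet_Icc.prod measurableSet_Icc

theorem integral_prod_Icc_Ioc {g : ℝ × ℝ → ℝ} (hg : Continuous g) (s t : ℝ) :
    ∫ z in Icc (0 : ℝ) 1 ×ˢ Ioc s t, g z =
      ∫ r in Ioc s t, ∫ y in Icc (0 : ℝ) 1, g (y, r) := by
  rw [Measure.volume_eq_prod, ← Measure.prod_restrict, integral_prod_symm]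
  rw [Measure.prod_restrict]
  exact (hg.continuousOn.integrableOn_compact (μ := volume.prod volume)
    (isCompact_Icc.prod (isCompact_Icc (a := s) (b := t)))).mono_set
      (prod_mono_right Ioc_subset_Icc_self)

/-- The kernel is a probability density on [0,1] carried by the δ-neighbourhood of x, so the average
inherits the oscillation bound. -/
theorem IsMollifier.abs_integral_sub_le {δ : ℝ} {ρ : ℝ → ℝ} (h : IsMollifier δ ρ) (hδ : δ < 1 / 2)
    {g : ℝ → ℝ} (hg : Continuous g) {ε x : ℝ} (hx : x ∈ Icc (0 : ℝ) 1)
    (hosc : ∀ y ∈ Icc (0 : ℝ) 1, |x - y| < δ → |g y - g x| ≤ ε) :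
    |(∫ y in Icc (0 : ℝ) 1, g y * neumannKernel ρ x y) - g x| ≤ ε := by
  have hk : Continuous (neumannKernel ρ x) := (h.isTest hδ hx).continuous
  have h1 := h.integral_neumannKernel hδ hx
  have hi : ∀ {f : ℝ → ℝ}, Continuous f → IntegrableOn f (Icc 0 1) :=
    fun hf => hf.continuousOn.integrableOn_Icc
  have hc : ∀ c : ℝ, ∫ y in Icc (0 : ℝ) 1, c * neumannKernel ρ x y = c := fun c => by
    rw [integral_const_mul, h1, mul_one]
  have key : ∀ y ∈ Icc (0 : ℝ) 1, (g x - ε) * neumannKernel ρ x y ≤ g y * neumannKernel ρ x y ∧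
      g y * neumannKernel ρ x y ≤ (g x + ε) * neumannKernel ρ x y := fun y hy => by
    by_cases hxy : |x - y| < δ
    · have := abs_le.1 (hosc y hy hxy)
      exact ⟨mul_le_mul_of_nonneg_right (by linarith) (h.neumannKernel_nonneg _ _),
        mul_le_mul_of_nonneg_right (by linarith) (h.neumannKernel_nonneg _ _)⟩
    · simp [h.neumannKernel_eq_zero hx hy (not_lt.1 hxy)]
  have l1 := setIntegral_mono_on (hi (continuous_const.mul hk)) (hi (hg.mul hk)) measurableSet_Icc
    fun y hy => (key y hy).1
  have l2 := setIntegral_mono_on (hi (hg.mul hk)) (hi (continuous_const.mul hk)) measurableSet_Icc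
    fun y hy => (key y hy).2
  simp only [Pi.mul_apply, hc] at l1 l2
  rw [abs_le]
  constructor <;> linarith

/-- The classical argument is run on the mollification W: at a positive-time maximum of W − εt the
spatial second derivative is nonpositive, which is incompatible with W growing at rate at least ε
just before. The inequality `H` is available only for test functions supported where w exceeds c;
this is why the mollification scale is tied to the modulus of continuity of w. -/
theorem le_of_subsolution_of_continuous {T c : ℝ} {w : ℝ × ℝ → ℝ}
    (hw : Continuous w) (h0 : ∀ x ∈ Icc (0 : ℝ) 1, w (x, 0) ≤ c)
    (H : ∀ φ, IsTest φ → (∀ y, 0 ≤ φ y) → ∀ s t, 0 ≤ s → s < t → t ≤ T →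
      (∀ y ∈ Icc (0 : ℝ) 1, ∀ r ∈ Icc s t, φ y ≠ 0 → c < w (y, r)) →
      (∫ y in Icc (0 : ℝ) 1, w (y, t) * φ y) - (∫ y in Icc (0 : ℝ) 1, w (y, s) * φ y) ≤
        ∫ z in Icc (0 : ℝ) 1 ×ˢ Ioc s t, w z * iteratedDeriv 2 φ z.1) :
    ∀ z ∈ strip T, w z ≤ c := by
  intro z₁ hz₁
  by_contra! hlt
  have hT : 0 ≤ T := hz₁.2.1.trans hz₁.2.2
  -- The excess is cut in five: one part for mollifying at `z₁`, one for mollifying at the maximum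
  -- point and one for the tilt in time leave 2ε₀ at the maximum point. One more pays for the
  -- oscillation of w over the support of the kernel.
  obtain ⟨ε₀, hε₀, hz₁c⟩ : ∃ ε₀ > 0, w z₁ = c + 5 * ε₀ :=
    ⟨(w z₁ - c) / 5, by linarith, by ring⟩
  have hunif := (isCompact_strip T).uniformContinuousOn_of_continuous hw.continuousOn
  rw [Metric.uniformContinuousOn_iff] at hunif
  obtain ⟨δ₁, hδ₁, hosc⟩ := hunif ε₀ hε₀
  obtain ⟨δ, hδ, hδδ₁, hδ2⟩ : ∃ δ > 0, δ < δ₁ ∧ δ < 1 / 2 :=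
    ⟨min (δ₁ / 2) (1 / 4), by positivity, (min_le_left _ _).trans_lt (by linarith),
      (min_le_right _ _).trans_lt (by norm_num)⟩
  obtain ⟨ρ, hρ⟩ := exists_isMollifier hδ
  set W : ℝ × ℝ → ℝ := fun z => ∫ y in Icc (0 : ℝ) 1, w (y, z.2) * neumannKernel ρ z.1 y with hW
  have hρc := hρ.contDiff.continuous
  have hWc : Continuous W := by
    refine continuous_parametric_integral_of_continuous
      (f := fun (z : ℝ × ℝ) y => w (y, z.2) * neumannKernel ρ z.1 y) ?_ isCompact_Icc
    unfold neumannKernel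
    simp only [Function.uncurry_def]
    fun_prop
  have hWw : ∀ z ∈ strip T, |W z - w z| ≤ ε₀ := fun z hz => by
    refine hρ.abs_integral_sub_le hδ2 (g := fun y => w (y, z.2)) (by fun_prop) hz.1 ?_
    intro y hy hxy
    have := hosc (y, z.2) ⟨hy, hz.2⟩ z hz (by
      rw [Prod.dist_eq, dist_self, max_eq_left dist_nonneg, dist_comm, Real.dist_eq]
      exact hxy.trans hδδ₁)
    rw [Real.dist_eq] at this
    exact this.le
  -- The total tilt over [0,T] stays below ε₀; the `+ 1` covers T = 0.
  set ε : ℝ := ε₀ / (T + 1) with hε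
  have hεpos : 0 < ε := by positivity
  have hεT : ε * T ≤ ε₀ := by
    rw [hε, div_mul_eq_mul_div, div_le_iff₀ (by positivity)]
    nlinarith
  obtain ⟨⟨x₀, t₀⟩, hz₀, hmax⟩ := (isCompact_strip T).exists_isMaxOn ⟨z₁, hz₁⟩
    (f := fun z => W z - ε * z.2) (by fun_prop)
  have hx₀ : x₀ ∈ Icc (0 : ℝ) 1 := hz₀.1
  have ht₀ : t₀ ∈ Icc (0 : ℝ) T := hz₀.2
  have hmax' : ∀ z ∈ strip T, W z - ε * z.2 ≤ W (x₀, t₀) - ε * t₀ := fun z hz => hmax hz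
  have hw₀ : c + 2 * ε₀ ≤ w (x₀, t₀) := by
    have h1 := hmax' z₁ hz₁
    have h2 := abs_le.1 (hWw z₁ hz₁)
    have h3 := abs_le.1 (hWw _ hz₀)
    have h4 : ε * z₁.2 ≤ ε * T := mul_le_mul_of_nonneg_left hz₁.2.2 hεpos.le
    have h5 : 0 ≤ ε * t₀ := mul_nonneg hεpos.le ht₀.1
    linarith
  have ht₀pos : 0 < t₀ := by
    rcases eq_or_lt_of_le ht₀.1 with h | h
    · rw [← h] at hw₀
      linarith [h0 x₀ hx₀]
    · exact h
  set φ := neumannKernel ρ x₀ with hφ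
  have hφt : IsTest φ := hρ.isTest hδ2 hx₀
  have hφ'' : Continuous (iteratedDeriv 2 φ) := hφt.continuous_deriv2
  set D : ℝ → ℝ := fun r => ∫ y in Icc (0 : ℝ) 1, w (y, r) * iteratedDeriv 2 φ y with hD
  have hDc : Continuous D := by
    refine continuous_parametric_integral_of_continuous
      (f := fun r y => w (y, r) * iteratedDeriv 2 φ y) ?_ isCompact_Icc
    simp only [Function.uncurry_def]
    fun_prop
  have hD0 : D t₀ ≤ 0 := by
    refine hρ.integral_deriv2_nonpos hδ2 (g := fun y => w (y, t₀)) (by fun_prop) hx₀ ?_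
    intro x hx
    have := hmax' (x, t₀) ⟨hx, ht₀⟩
    simp only [hW] at this
    linarith
  obtain ⟨s, hs0, hst, hsδ, hsD⟩ : ∃ s, 0 ≤ s ∧ s < t₀ ∧ t₀ - δ < s ∧
      ∀ r ∈ Icc s t₀, D r < ε / 2 := by
    have hev : ∀ᶠ r in 𝓝 t₀, D r < ε / 2 :=
      hDc.continuousAt.eventually (gt_mem_nhds (by linarith))
    obtain ⟨η, hη, hball⟩ := Metric.eventually_nhds_iff.1 hev
    refine ⟨max 0 (max (t₀ - δ / 2) (t₀ - η / 2)), le_max_left _ _, ?_, ?_, ?_⟩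
    · exact max_lt ht₀pos (max_lt (by linarith) (by linarith))
    · exact lt_of_lt_of_le (by linarith) ((le_max_left _ _).trans (le_max_right _ _))
    · intro r hr
      apply hball
      have := ((le_max_right _ _).trans (le_max_right _ _)).trans hr.1
      rw [Real.dist_eq, abs_lt]
      constructor <;> linarith [hr.2]
  have hH := H φ hφt (fun y => hρ.neumannKernel_nonneg _ _) s t₀ hs0 hst ht₀.2 (by
    intro y hy r hr hne
    have hxy : |x₀ - y| < δ := by
      by_contra hcon
      exact hne (hρ.neumannKernel_eq_zero hx₀ hy (not_lt.1 hcon))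
    have := hosc (y, r) ⟨hy, hs0.trans hr.1, hr.2.trans ht₀.2⟩ (x₀, t₀) hz₀ (by
      rw [Prod.dist_eq, max_lt_iff]
      refine ⟨?_, ?_⟩
      · rw [dist_comm, Real.dist_eq]; exact hxy.trans hδδ₁
      · rw [Real.dist_eq, abs_lt]
        constructor <;> linarith [hr.1, hr.2])
    rw [Real.dist_eq, abs_lt] at this
    linarith)
  rw [integral_prod_Icc_Ioc (g := fun z => w z * iteratedDeriv 2 φ z.1) (by fun_prop)] at hH
  have h1 : ∫ r in Ioc s t₀, D r ≤ ∫ r in Ioc s t₀, ε / 2 :=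
    setIntegral_mono_on (hDc.continuousOn.integrableOn_Icc.mono_set Ioc_subset_Icc_self)
      (by simp) measurableSet_Ioc fun r hr => (hsD r ⟨hr.1.le, hr.2⟩).le
  rw [setIntegral_const, measureReal_def, Real.volume_Ioc, ENNReal.toReal_ofReal (by linarith),
    smul_eq_mul] at h1
  -- Maximality forces W to increase by at least ε(t₀ − s) at x₀ between s and t₀, whereas the weak
  -- inequality allows at most half of that.
  have h2 := hmax' (x₀, s) ⟨hx₀, hs0, hst.le.trans ht₀.2⟩
  simp only [hW] at h2
  have h3 : 0 < ε * (t₀ - s) := mul_pos hεpos (by linarith)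
  have h4 : (∫ y in Icc (0 : ℝ) 1, w (y, t₀) * φ y) - (∫ y in Icc (0 : ℝ) 1, w (y, s) * φ y) ≤
    (t₀ - s) * (ε / 2) := hH.trans h1
  linarith

/-- Clamping of the time-space variables to `strip T`. -/
def clampStrip (T : ℝ) (z : ℝ × ℝ) : ℝ × ℝ := (max 0 (min z.1 1), max 0 (min z.2 T))

theorem continuous_clampStrip (T : ℝ) : Continuous (clampStrip T) := by
  unfold clampStrip; fun_prop

theorem clampStrip_mem {T : ℝ} (hT : 0 ≤ T) (z : ℝ × ℝ) : clampStrip T z ∈ strip T :=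
  ⟨⟨le_max_left _ _, max_le zero_le_one (min_le_right _ _)⟩,
    ⟨le_max_left _ _, max_le hT (min_le_right _ _)⟩⟩

theorem clampStrip_eq {T : ℝ} {z : ℝ × ℝ} (hz : z ∈ strip T) : clampStrip T z = z := by
  simp [clampStrip, hz.1.1, hz.1.2, hz.2.1, hz.2.2]

/-- **Maximum principle** in weak form: a function whose heat operator is nonpositive where it
exceeds `c` stays below `c` if it does so initially. -/
theorem le_of_subsolution {T c : ℝ} {w : ℝ × ℝ → ℝ}
    (hw : ContinuousOn w (strip T)) (h0 : ∀ x ∈ Icc (0 : ℝ) 1, w (x, 0) ≤ c)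
    (H : ∀ φ, IsTest φ → (∀ y, 0 ≤ φ y) → ∀ s t, 0 ≤ s → s < t → t ≤ T →
      (∀ y ∈ Icc (0 : ℝ) 1, ∀ r ∈ Icc s t, φ y ≠ 0 → c < w (y, r)) →
      (∫ y in Icc (0 : ℝ) 1, w (y, t) * φ y) - (∫ y in Icc (0 : ℝ) 1, w (y, s) * φ y) ≤
        ∫ z in Icc (0 : ℝ) 1 ×ˢ Ioc s t, w z * iteratedDeriv 2 φ z.1) :
    ∀ z ∈ strip T, w z ≤ c := by
  intro z hz
  have hT : 0 ≤ T := hz.2.1.trans hz.2.2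
  set v : ℝ × ℝ → ℝ := fun z => w (clampStrip T z) with hv
  have hvw : ∀ z ∈ strip T, v z = w z := fun z hz => by simp only [hv, clampStrip_eq hz]
  have hvc : Continuous v :=
    hw.comp_continuous (continuous_clampStrip T) (clampStrip_mem hT)
  rw [← hvw z hz]
  refine le_of_subsolution_of_continuous (T := T) hvc ?_ ?_ z hz
  · intro x hx
    rw [hvw _ ⟨hx, le_refl _, hT⟩]
    exact h0 x hx
  · intro φ hφ hφ0 s t hs hst ht hsupp
    have h := H φ hφ hφ0 s t hs hst ht fun y hy r hr hne => by
      rw [← hvw (y, r) ⟨hy, hs.trans hr.1, hr.2.trans ht⟩]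
      exact hsupp y hy r hr hne
    convert h using 1
    · congr 1
      · exact setIntegral_congr_fun measurableSet_Icc fun y hy => by
          rw [hvw (y, t) ⟨hy, hs.trans hst.le, ht⟩]
      · exact setIntegral_congr_fun measurableSet_Icc fun y hy => by
          rw [hvw (y, s) ⟨hy, hs, hst.le.trans ht⟩]
    · exact setIntegral_congr_fun (measurableSet_Icc.prod measurableSet_Ioc) fun z hz => by
        rw [hvw z ⟨hz.1, hs.trans hz.2.1.le, hz.2.2.trans ht⟩]


/-! ### Cosine basis and density of cosine polynomials -/

/-- The Neumann eigenfunctions `cos (k π x)` on `[0,1]`. -/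
noncomputable def cosk (k : ℕ) (x : ℝ) : ℝ := Real.cos (k * Real.pi * x)

/-- The eigenvalue of `cosk k`. -/
noncomputable def eig (k : ℕ) : ℝ := (k * Real.pi) ^ 2

theorem eig_nonneg (k : ℕ) : 0 ≤ eig k := sq_nonneg _

theorem eig_pos {k : ℕ} (hk : k ≠ 0) : 0 < eig k := by
  have : 0 < (k : ℝ) := by positivity
  unfold eig; positivity

theorem contDiff_cosk (k : ℕ) : ContDiff ℝ ∞ (cosk k) := by
  unfold cosk; fun_prop

theorem continuous_cosk (k : ℕ) : Continuous (cosk k) := (contDiff_cosk k).continuous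

theorem abs_cosk_le (k : ℕ) (x : ℝ) : |cosk k x| ≤ 1 := Real.abs_cos_le_one _

@[simp] theorem cosk_zero (x : ℝ) : cosk 0 x = 1 := by simp [cosk]

theorem hasDerivAt_cosk (k : ℕ) (x : ℝ) :
    HasDerivAt (cosk k) (-(k * Real.pi) * Real.sin (k * Real.pi * x)) x := by
  have := (Real.hasDerivAt_cos (k * Real.pi * x)).comp x
    ((hasDerivAt_id x).const_mul (k * Real.pi))
  exact this.congr_deriv (by simp; ring)

theorem hasDerivAt_sink (k : ℕ) (x : ℝ) :
    HasDerivAt (fun x => Real.sin (k * Real.pi * x)) (k * Real.pi * cosk k x) x := by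
  have := (Real.hasDerivAt_sin (k * Real.pi * x)).comp x
    ((hasDerivAt_id x).const_mul (k * Real.pi))
  exact this.congr_deriv (by simp [cosk]; ring)

theorem deriv_cosk (k : ℕ) :
    deriv (cosk k) = fun x => -(k * Real.pi) * Real.sin (k * Real.pi * x) :=
  funext fun x => (hasDerivAt_cosk k x).deriv

theorem iteratedDeriv_two_cosk (k : ℕ) (x : ℝ) : iteratedDeriv 2 (cosk k) x = - eig k * cosk k x := by
  rw [iteratedDeriv_succ, iteratedDeriv_one, deriv_cosk,
    ((hasDerivAt_sink k x).const_mul _).deriv, eig]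
  ring

theorem sin_nat_mul_pi_mul_one (k : ℕ) : Real.sin (k * Real.pi * 1) = 0 := by
  rw [mul_one]; exact Real.sin_nat_mul_pi k

theorem isTest_cosk (k : ℕ) : IsTest (cosk k) := by
  refine ⟨contDiff_cosk k, ?_, ?_⟩
  · simp [deriv_cosk]
  · rw [deriv_cosk]; simp only [sin_nat_mul_pi_mul_one, mul_zero]

theorem cosk_mul_cosk (j k : ℕ) (x : ℝ) :
    cosk j x * cosk k x = (cosk (j + k) x + cosk (max j k - min j k) x) / 2 := by
  wlog h : j ≤ k generalizing j k
  · rw [mul_comm, this k j (by omega), add_comm k j, max_comm, min_comm]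
  rw [max_eq_right h, min_eq_left h]
  unfold cosk
  rw [Nat.cast_add, Nat.cast_sub h,
    show ((j : ℝ) + k) * Real.pi * x = j * Real.pi * x + k * Real.pi * x by ring,
    show ((k : ℝ) - j) * Real.pi * x = k * Real.pi * x - j * Real.pi * x by ring,
    Real.cos_add, Real.cos_sub]
  ring

theorem integral_cosk (k : ℕ) : ∫ x in Icc (0 : ℝ) 1, cosk k x = if k = 0 then 1 else 0 := by
  split_ifs with h
  · subst h; simp
  · rw [integral_Icc_eq_integral_Ioc, ← intervalIntegral.integral_of_le zero_le_one,
      intervalIntegral.integral_eq_sub_of_hasDerivAt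
        (f := fun x => (k * Real.pi)⁻¹ * Real.sin (k * Real.pi * x))]
    · simp [Real.sin_nat_mul_pi]
    · intro x _
      refine ((hasDerivAt_sink k x).const_mul _).congr_deriv ?_
      have : (k : ℝ) * Real.pi ≠ 0 := mul_ne_zero (by exact_mod_cast h) Real.pi_ne_zero
      field_simp
    · exact (continuous_cosk k).intervalIntegrable _ _

/-- The normalisation constants of the cosine basis. -/
def nrm (k : ℕ) : ℝ := if k = 0 then 1 else 2

theorem nrm_pos (k : ℕ) : 0 < nrm k := by unfold nrm; split_ifs <;> norm_num

theorem nrm_le (k : ℕ) : nrm k ≤ 2 := by unfold nrm; split_ifs <;> norm_num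

theorem integral_cosk_mul_cosk (j k : ℕ) :
    ∫ x in Icc (0 : ℝ) 1, cosk j x * cosk k x = if j = k then (nrm k)⁻¹ else 0 := by
  have hi : ∀ k, IntegrableOn (cosk k) (Icc 0 1) :=
    fun k => (continuous_cosk k).continuousOn.integrableOn_Icc
  simp only [cosk_mul_cosk]
  rw [integral_div, integral_add (hi _) (hi _), integral_cosk, integral_cosk]
  have e : max j k - min j k = 0 ↔ j = k := by omega
  simp only [e, nrm]
  by_cases h : j = k
  · subst h
    by_cases h0 : j = 0
    · simp [h0]
    · simp [h0]
  · have : j + k ≠ 0 := by omega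
    rw [if_neg this]
    simp [h]

/-- Integration by parts twice; the boundary terms vanish because both factors have zero slope at 0
and 1. -/
theorem IsTest.integral_mul_cosk {φ : ℝ → ℝ} (hφ : IsTest φ) (k : ℕ) :
    ∫ x in Icc (0 : ℝ) 1, cosk k x * iteratedDeriv 2 φ x =
      - eig k * ∫ x in Icc (0 : ℝ) 1, cosk k x * φ x := by
  have hd : ∀ x, HasDerivAt φ (deriv φ x) x := fun x =>
    (hφ.contDiff.differentiable (by simp) x).hasDerivAt
  have hd2 : ∀ x, HasDerivAt (deriv φ) (iteratedDeriv 2 φ x) x := fun x => by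
    rw [iteratedDeriv_succ, iteratedDeriv_one]
    have : ContDiff ℝ ∞ (deriv φ) := (contDiff_infty_iff_deriv.1 hφ.contDiff).2
    exact (this.differentiable (by simp) x).hasDerivAt
  have hc1 : Continuous (deriv φ) := continuous_iff_continuousAt.2 fun x => (hd2 x).continuousAt
  have hs : Continuous fun x => Real.sin (k * Real.pi * x) := by fun_prop
  rw [integral_Icc_eq_integral_Ioc, ← intervalIntegral.integral_of_le zero_le_one,
    integral_Icc_eq_integral_Ioc, ← intervalIntegral.integral_of_le zero_le_one,
    ← sub_eq_zero, ← intervalIntegral.integral_const_mul, ← intervalIntegral.integral_sub,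
    intervalIntegral.integral_eq_sub_of_hasDerivAt
      (f := fun x => cosk k x * deriv φ x + k * Real.pi * Real.sin (k * Real.pi * x) * φ x)]
  · simp [hφ.left, hφ.right, Real.sin_nat_mul_pi]
  · intro x _
    refine (((hasDerivAt_cosk k x).mul (hd2 x)).add
      (((hasDerivAt_sink k x).const_mul (k * Real.pi)).mul (hd x))).congr_deriv ?_
    simp only [eig]; ring
  · have := hφ.continuous_deriv2
    have := continuous_cosk k
    have := hφ.continuous
    exact (by fun_prop : Continuous _).intervalIntegrable _ _
  · have := hφ.continuous_deriv2
    have := continuous_cosk k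
    exact (by fun_prop : Continuous _).intervalIntegrable _ _
  · have := continuous_cosk k
    have := hφ.continuous
    exact (by fun_prop : Continuous _).intervalIntegrable _ _

/-- Cosine polynomials are uniformly dense in the continuous functions on `[0,1]`. -/
theorem exists_cos_approx {f : ℝ → ℝ} (hf : ContinuousOn f (Icc 0 1)) {ε : ℝ} (hε : 0 < ε) :
    ∃ (s : Finset ℕ) (a : ℕ → ℝ), ∀ x ∈ Icc (0 : ℝ) 1, |f x - ∑ k ∈ s, a k * cosk k x| ≤ ε := by
  let v : ℕ → C(Icc (0 : ℝ) 1, ℝ) := fun k =>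
    ⟨fun x => cosk k x, (continuous_cosk k).comp continuous_subtype_val⟩
  let S : Submodule ℝ C(Icc (0 : ℝ) 1, ℝ) := Submodule.span ℝ (range v)
  -- The product formula makes the span of the cosines closed under multiplication, so it contains
  -- the algebra generated by cos(πx). That single function separates points of [0,1], and
  -- Stone–Weierstrass applies.
  have hmul : ∀ f g, f ∈ S → g ∈ S → f * g ∈ S := by
    intro f g hf hg
    have h1 := Submodule.mul_mem_mul hf hg
    rw [Submodule.span_mul_span] at h1
    refine (Submodule.span_le.2 ?_) h1
    rintro _ ⟨_, ⟨j, rfl⟩, _, ⟨k, rfl⟩, rfl⟩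
    have : v j * v k = (1 / 2 : ℝ) • (v (j + k) + v (max j k - min j k)) := by
      ext x
      have := cosk_mul_cosk j k x
      simp only [v, ContinuousMap.mul_apply, ContinuousMap.coe_mk, ContinuousMap.smul_apply,
        ContinuousMap.add_apply, smul_eq_mul, this]
      ring
    simp only [this]
    exact S.smul_mem _ (S.add_mem (Submodule.subset_span ⟨_, rfl⟩) (Submodule.subset_span ⟨_, rfl⟩))
  have hA : ∀ f ∈ Algebra.adjoin ℝ {v 1}, f ∈ S := by
    intro f hf
    induction hf using Algebra.adjoin_induction with
    | mem x hx => rw [mem_singleton_iff.1 hx]; exact Submodule.subset_span ⟨_, rfl⟩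
    | algebraMap r =>
      have : algebraMap ℝ C(Icc (0 : ℝ) 1, ℝ) r = r • v 0 := by
        ext x; simp [v]
      rw [this]
      exact S.smul_mem _ (Submodule.subset_span ⟨_, rfl⟩)
    | add x y _ _ hx hy => exact S.add_mem hx hy
    | mul x y _ _ hx hy => exact hmul x y hx hy
  obtain ⟨g, hg⟩ := ContinuousMap.exists_mem_subalgebra_near_continuous_of_separatesPoints
    (Algebra.adjoin ℝ {v 1}) (by
      intro x y hxy
      refine ⟨v 1, ⟨v 1, Algebra.subset_adjoin rfl, rfl⟩, fun h => hxy (Subtype.ext ?_)⟩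
      have h' : Real.cos (Real.pi * x) = Real.cos (Real.pi * y) := by
        simpa [v, cosk] using h
      have hm : ∀ x : Icc (0 : ℝ) 1, Real.pi * x ∈ Icc 0 Real.pi := fun x =>
        ⟨mul_nonneg Real.pi_pos.le x.2.1, mul_le_of_le_one_right Real.pi_pos.le x.2.2⟩
      exact mul_left_cancel₀ Real.pi_ne_zero (Real.injOn_cos (hm x) (hm y) h'))
    (fun x => f x) (continuousOn_iff_continuous_domRestrict.1 hf) ε hε
  obtain ⟨c, hc⟩ := (Finsupp.mem_span_range_iff_exists_finsupp).1 (hA g g.2)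
  refine ⟨c.support, c, fun x hx => ?_⟩
  have h1 := hg ⟨x, hx⟩
  have h2 : (g : C(Icc (0 : ℝ) 1, ℝ)) ⟨x, hx⟩ = ∑ k ∈ c.support, c k * cosk k x := by
    rw [← hc, Finsupp.sum]
    simp [v]
  rw [h2, Real.norm_eq_abs, abs_sub_comm] at h1
  exact h1.le

theorem iteratedDeriv_two_cos_sum (s : Finset ℕ) (a : ℕ → ℝ) (x : ℝ) :
    iteratedDeriv 2 (fun x => ∑ k ∈ s, a k * cosk k x) x = ∑ k ∈ s, a k * (- eig k * cosk k x) := by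
  have h : ∀ k ∈ s, ContDiffAt ℝ 2 (fun x => a k * cosk k x) x := fun k _ =>
    (contDiff_const.mul ((contDiff_cosk k).of_le (WithTop.coe_le_coe.2 le_top))).contDiffAt
  rw [iteratedDeriv_fun_sum h]
  refine Finset.sum_congr rfl fun k _ => ?_
  rw [iteratedDeriv_const_mul_field, iteratedDeriv_two_cosk]

theorem isTest_cos_sum (s : Finset ℕ) (a : ℕ → ℝ) : IsTest fun x => ∑ k ∈ s, a k * cosk k x := by
  have hd : ∀ x, HasDerivAt (fun x => ∑ k ∈ s, a k * cosk k x)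
      (∑ k ∈ s, a k * deriv (cosk k) x) x := fun x => by
    refine HasDerivAt.fun_sum fun k _ => ?_
    rw [deriv_cosk]
    exact (hasDerivAt_cosk k x).const_mul _
  refine ⟨ContDiff.sum fun k _ => contDiff_const.mul (contDiff_cosk k), ?_, ?_⟩
  · rw [(hd 0).deriv]
    exact Finset.sum_eq_zero fun k _ => by rw [(isTest_cosk k).left, mul_zero]
  · rw [(hd 1).deriv]
    exact Finset.sum_eq_zero fun k _ => by rw [(isTest_cosk k).right, mul_zero]

theorem abs_le_of_abs_deriv2_le {D D' D'' : ℝ → ℝ} {ε : ℝ} (h1 : ∀ x, HasDerivAt D (D' x) x)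
    (h2 : ∀ x, HasDerivAt D' (D'' x) x) (h0 : D 0 = 0) (h0' : D' 0 = 0)
    (hb : ∀ x ∈ Icc (0 : ℝ) 1, |D'' x| ≤ ε) : ∀ x ∈ Icc (0 : ℝ) 1, |D x| ≤ ε := by
  have hε : 0 ≤ ε := (abs_nonneg _).trans (hb 0 ⟨le_rfl, zero_le_one⟩)
  have step : ∀ {g g' : ℝ → ℝ}, (∀ x, HasDerivAt g (g' x) x) → g 0 = 0 →
      (∀ x ∈ Icc (0 : ℝ) 1, |g' x| ≤ ε) → ∀ x ∈ Icc (0 : ℝ) 1, |g x| ≤ ε := by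
    intro g g' hg hg0 hgb x hx
    have := (convex_Icc (0 : ℝ) 1).norm_image_sub_le_of_norm_hasDerivWithin_le
      (fun y _ => (hg y).hasDerivWithinAt) (C := ε) hgb ⟨le_rfl, zero_le_one⟩ hx
    rw [hg0, sub_zero, sub_zero, Real.norm_eq_abs, Real.norm_eq_abs, abs_of_nonneg hx.1] at this
    exact this.trans (mul_le_of_le_one_right hε hx.2)
  exact step h1 h0 (step h2 h0' hb)

/-- Cosine polynomials approximate test functions together with their second derivatives. -/
theorem IsTest.exists_cos_approx {φ : ℝ → ℝ} (hφ : IsTest φ) {ε : ℝ} (hε : 0 < ε) :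
    ∃ (s : Finset ℕ) (a : ℕ → ℝ), ∀ x ∈ Icc (0 : ℝ) 1,
      |φ x - ∑ k ∈ s, a k * cosk k x| ≤ ε ∧
      |iteratedDeriv 2 φ x - iteratedDeriv 2 (fun x => ∑ k ∈ s, a k * cosk k x) x| ≤ ε := by
  obtain ⟨s₀, b₀, hb₀⟩ := ReflectedSkeleton.exists_cos_approx hφ.continuous_deriv2.continuousOn
    (half_pos hε)
  set s := insert 0 s₀ with hs
  set b : ℕ → ℝ := fun k => if k ∈ s₀ then b₀ k else 0 with hb
  have hb' : ∀ x ∈ Icc (0 : ℝ) 1, |iteratedDeriv 2 φ x - ∑ k ∈ s, b k * cosk k x| ≤ ε / 2 := by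
    intro x hx
    convert hb₀ x hx using 3
    rw [← Finset.sum_subset (Finset.subset_insert 0 s₀)]
    · exact Finset.sum_congr rfl fun k hk => by simp [hb, hk]
    · intro k _ hk; simp [hb, hk]
  have hcφ := hφ.continuous_deriv2
  -- φ'' has mean zero by the Neumann condition, so the constant mode of its approximant is small.
  -- It can be dropped at cost ε/2, which is necessary because it cannot be integrated twice within
  -- the cosines.
  have h0 : |b 0| ≤ ε / 2 := by
    have e1 : ∫ x in Icc (0 : ℝ) 1, iteratedDeriv 2 φ x = 0 := by
      have := hφ.integral_mul_cosk 0
      simpa [eig] using this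
    have e2 : ∫ x in Icc (0 : ℝ) 1, ∑ k ∈ s, b k * cosk k x = b 0 := by
      rw [integral_finsetSum]
      · simp [integral_const_mul, integral_cosk, hs]
      · exact fun k _ => ((continuous_cosk k).continuousOn.integrableOn_Icc).const_mul _
    have hcs : Continuous fun x => ∑ k ∈ s, b k * cosk k x :=
      (isTest_cos_sum s b).continuous
    have e3 : ∫ x in Icc (0 : ℝ) 1, (iteratedDeriv 2 φ x - ∑ k ∈ s, b k * cosk k x) = - b 0 := by
      rw [integral_sub hcφ.continuousOn.integrableOn_Icc hcs.continuousOn.integrableOn_Icc, e1, e2,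
        zero_sub]
    have e4 := norm_setIntegral_le_of_norm_le_const (μ := volume) (s := Icc (0 : ℝ) 1)
      (f := fun x => iteratedDeriv 2 φ x - ∑ k ∈ s, b k * cosk k x) (C := ε / 2)
      (by simp) (fun x hx => hb' x hx)
    rw [e3] at e4
    simpa using e4
  -- The other modes are integrated twice by dividing by −`eig k`; the constant d makes the result
  -- agree with φ at 0. The difference then vanishes at 0 with its slope, so a bound on its second
  -- derivative bounds it too.
  set d : ℝ := φ 0 - ∑ k ∈ s₀.erase 0, -(b k / eig k) with hd
  set a : ℕ → ℝ := fun k => if k = 0 then d else -(b k / eig k) with ha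
  have hs' : s = insert 0 (s₀.erase 0) := by
    ext k; by_cases hk : k = 0 <;> simp [hs, hk]
  have h2 : ∀ x ∈ Icc (0 : ℝ) 1,
      |iteratedDeriv 2 φ x - iteratedDeriv 2 (fun x => ∑ k ∈ s, a k * cosk k x) x| ≤ ε := by
    intro x hx
    have e : iteratedDeriv 2 (fun x => ∑ k ∈ s, a k * cosk k x) x =
        ∑ k ∈ s, b k * cosk k x - b 0 := by
      rw [iteratedDeriv_two_cos_sum, hs', Finset.sum_insert (by simp), Finset.sum_insert (by simp)]
      simp only [cosk_zero, eig]
      rw [Finset.sum_congr rfl (g := fun k => b k * cosk k x)]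
      · simp
      · intro k hk
        have hk0 := Finset.ne_of_mem_erase hk
        have := eig_pos hk0
        simp only [eig] at this
        simp only [ha, eig, if_neg hk0]
        field_simp
    rw [e]
    have e1 := abs_le.1 (hb' x hx)
    have e2 := abs_le.1 h0
    rw [abs_le]; constructor <;> linarith
  refine ⟨s, a, fun x hx => ⟨?_, h2 x hx⟩⟩
  have hp := isTest_cos_sum s a
  have hD : ∀ {ψ : ℝ → ℝ}, IsTest ψ → ∀ x, HasDerivAt ψ (deriv ψ x) x := fun hψ x =>
    (hψ.contDiff.differentiable (by simp) x).hasDerivAt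
  have hD2 : ∀ {ψ : ℝ → ℝ}, IsTest ψ → ∀ x, HasDerivAt (deriv ψ) (iteratedDeriv 2 ψ x) x := by
    intro ψ hψ x
    rw [iteratedDeriv_succ, iteratedDeriv_one]
    exact ((contDiff_infty_iff_deriv.1 hψ.contDiff).2.differentiable (by simp) x).hasDerivAt
  refine abs_le_of_abs_deriv2_le (D := fun x => φ x - ∑ k ∈ s, a k * cosk k x)
    (fun x => (hD hφ x).sub (hD hp x)) (fun x => (hD2 hφ x).sub (hD2 hp x)) ?_ ?_ h2 x hx
  · rw [hs', Finset.sum_insert (by simp)]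
    have : ∑ k ∈ s₀.erase 0, a k * cosk k 0 = ∑ k ∈ s₀.erase 0, -(b k / eig k) :=
      Finset.sum_congr rfl fun k hk => by simp [ha, Finset.ne_of_mem_erase hk, cosk]
    rw [this]
    simp [ha, hd]
  · rw [hφ.left, hp.left, sub_zero]


/-! ### Homogeneous Neumann heat flow -/

/-- A continuous weak solution of the homogeneous Neumann heat equation for `t ≥ 0`. -/
structure IsHeatFlow (w : ℝ × ℝ → ℝ) : Prop where
  continuous : Continuous w
  weak : ∀ φ, IsTest φ → ∀ s t, 0 ≤ s → s < t →
    (∫ y in Icc (0 : ℝ) 1, w (y, t) * φ y) - (∫ y in Icc (0 : ℝ) 1, w (y, s) * φ y) =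
      ∫ z in Icc (0 : ℝ) 1 ×ˢ Ioc s t, w z * iteratedDeriv 2 φ z.1

theorem integrableOn_Icc_of_continuous {g : ℝ → ℝ} (hg : Continuous g) (a b : ℝ) :
    IntegrableOn g (Icc a b) := hg.continuousOn.integrableOn_Icc

theorem integrableOn_slab_of_continuous {g : ℝ × ℝ → ℝ} (hg : Continuous g) (s t : ℝ) :
    IntegrableOn g (Icc (0 : ℝ) 1 ×ˢ Ioc s t) :=
  (hg.continuousOn.integrableOn_compact (isCompact_Icc.prod (isCompact_Icc (a := s) (b := t)))).mono_set
      (prod_mono_right Ioc_subset_Icc_self)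

theorem IsHeatFlow.sub {v w : ℝ × ℝ → ℝ} (hv : IsHeatFlow v) (hw : IsHeatFlow w) :
    IsHeatFlow fun z => v z - w z := by
  have cv := hv.continuous
  have cw := hw.continuous
  refine ⟨cv.sub cw, fun φ hφ s t hs hst => ?_⟩
  have c1 := hφ.continuous
  have c2 := hφ.continuous_deriv2
  simp only [sub_mul]
  rw [integral_sub (integrableOn_Icc_of_continuous (by fun_prop) _ _)
      (integrableOn_Icc_of_continuous (by fun_prop) _ _),
    integral_sub (integrableOn_Icc_of_continuous (by fun_prop) _ _)
      (integrableOn_Icc_of_continuous (by fun_prop) _ _),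
    integral_sub (integrableOn_slab_of_continuous (by fun_prop) _ _)
      (integrableOn_slab_of_continuous (by fun_prop) _ _), ← hv.weak φ hφ s t hs hst,
    ← hw.weak φ hφ s t hs hst]
  ring

theorem IsHeatFlow.le {w : ℝ × ℝ → ℝ} (hw : IsHeatFlow w) {c : ℝ}
    (h0 : ∀ x ∈ Icc (0 : ℝ) 1, w (x, 0) ≤ c) {z : ℝ × ℝ} (hz : z ∈ Q) : w z ≤ c :=
  le_of_subsolution (T := z.2) hw.continuous.continuousOn h0
    (fun φ hφ _ s t hs hst _ _ => (hw.weak φ hφ s t hs hst).le) z ⟨hz.1, hz.2, le_rfl⟩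

theorem isHeatFlow_cos_sum (σ : Finset ℕ) (a : ℕ → ℝ) :
    IsHeatFlow fun z => ∑ k ∈ σ, a k * Real.exp (-eig k * z.2) * cosk k z.1 := by
  have hcont : Continuous fun z : ℝ × ℝ =>
      ∑ k ∈ σ, a k * Real.exp (-eig k * z.2) * cosk k z.1 := by
    have := continuous_cosk
    fun_prop
  refine ⟨hcont, fun φ hφ s t hs hst => ?_⟩
  have c1 := hφ.continuous
  have c2 := hφ.continuous_deriv2
  set m : ℕ → ℝ := fun k => ∫ y in Icc (0 : ℝ) 1, cosk k y * φ y
  have key : ∀ (ψ : ℝ → ℝ) (_ : Continuous ψ) (r : ℝ),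
      ∫ y in Icc (0 : ℝ) 1, (∑ k ∈ σ, a k * Real.exp (-eig k * r) * cosk k y) * ψ y =
      ∑ k ∈ σ, a k * Real.exp (-eig k * r) * ∫ y in Icc (0 : ℝ) 1, cosk k y * ψ y := by
    intro ψ hψ r
    simp only [Finset.sum_mul, mul_assoc]
    rw [integral_finsetSum]
    · simp only [integral_const_mul]
    · intro k _
      have := continuous_cosk k
      exact integrableOn_Icc_of_continuous (by fun_prop) _ _
  rw [integral_prod_Icc_Ioc (g := fun z => (∑ k ∈ σ, a k * Real.exp (-eig k * z.2) * cosk k z.1) *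
    iteratedDeriv 2 φ z.1) (by fun_prop)]
  simp only [key φ c1, key _ c2, hφ.integral_mul_cosk]
  rw [← intervalIntegral.integral_of_le hst.le]
  symm
  refine intervalIntegral.integral_eq_sub_of_hasDerivAt
    (f := fun r => ∑ k ∈ σ, a k * Real.exp (-eig k * r) * m k) ?_ ?_
  · intro r _
    refine HasDerivAt.fun_sum fun k _ => ?_
    have := ((((hasDerivAt_id r).const_mul (-eig k)).exp).const_mul (a k)).mul_const (m k)
    exact this.congr_deriv (by simp only [m, id]; ring)
  · exact (by fun_prop : Continuous _).intervalIntegrable _ _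

/-- Clamping of the time-space variables to `Q`. -/
def clampQ (z : ℝ × ℝ) : ℝ × ℝ := (max 0 (min z.1 1), max 0 z.2)

theorem continuous_clampQ : Continuous clampQ := by
  unfold clampQ; fun_prop

theorem clampQ_mem (z : ℝ × ℝ) : clampQ z ∈ Q :=
  ⟨⟨le_max_left _ _, max_le zero_le_one (min_le_right _ _)⟩, mem_Ici.2 (le_max_left _ _)⟩

theorem clampQ_eq {z : ℝ × ℝ} (hz : z ∈ Q) : clampQ z = z := by
  have h3 : 0 ≤ z.2 := hz.2
  simp [clampQ, hz.1.1, hz.1.2, h3]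

theorem mk_mem_Q {x t : ℝ} (hx : x ∈ Icc (0 : ℝ) 1) (ht : 0 ≤ t) : (x, t) ∈ Q := ⟨hx, ht⟩

theorem slab_subset_Q {s t : ℝ} (hs : 0 ≤ s) : Icc (0 : ℝ) 1 ×ˢ Ioc s t ⊆ Q :=
  fun _ hz => ⟨hz.1, hs.trans hz.2.1.le⟩

theorem measurableSet_slab (s t : ℝ) : MeasurableSet (Icc (0 : ℝ) 1 ×ˢ Ioc s t) :=
  measurableSet_Icc.prod measurableSet_Ioc

/-- The Neumann heat flow started from a continuous function. -/
theorem exists_isHeatFlow {u₀ : ℝ → ℝ} (hu : ContinuousOn u₀ (Icc 0 1)) :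
    ∃ V, IsHeatFlow V ∧ ∀ x ∈ Icc (0 : ℝ) 1, V (x, 0) = u₀ x := by
  have happ : ∀ n : ℕ, ∃ w, IsHeatFlow w ∧
      ∀ x ∈ Icc (0 : ℝ) 1, |u₀ x - w (x, 0)| ≤ 1 / ((n : ℝ) + 1) := by
    intro n
    obtain ⟨σ, a, h⟩ := exists_cos_approx hu (ε := 1 / ((n : ℝ) + 1)) (by positivity)
    refine ⟨_, isHeatFlow_cos_sum σ a, fun x hx => ?_⟩
    simpa using h x hx
  choose w hw hw0 using happ
  -- The maximum principle makes the flow a sup-norm contraction, so the flows of approximating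
  -- cosine polynomials are uniformly Cauchy on all of Q.
  have hdiff : ∀ n m, ∀ z ∈ Q, w n z - w m z ≤ 1 / ((n : ℝ) + 1) + 1 / ((m : ℝ) + 1) := by
    intro n m z hz
    refine ((hw n).sub (hw m)).le (fun x hx => ?_) hz
    have h1 := abs_le.1 (hw0 n x hx)
    have h2 := abs_le.1 (hw0 m x hx)
    linarith
  have hlim : Tendsto (fun N : ℕ => 2 * (1 / ((N : ℝ) + 1))) atTop (𝓝 0) := by
    simpa using tendsto_one_div_add_atTop_nhds_zero_nat.const_mul (2 : ℝ)
  have hmono : ∀ {N n : ℕ}, N ≤ n → 1 / ((n : ℝ) + 1) ≤ 1 / ((N : ℝ) + 1) := fun h =>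
    one_div_le_one_div_of_le (by positivity) (by exact_mod_cast Nat.succ_le_succ h)
  have hcau : ∀ z ∈ Q, CauchySeq fun n => w n z := fun z hz => by
    refine cauchySeq_of_le_tendsto_0 _ (fun n m N hn hm => ?_) hlim
    rw [Real.dist_eq, abs_le]
    have h1 := hdiff n m z hz
    have h2 := hdiff m n z hz
    have h3 := hmono hn
    have h4 := hmono hm
    constructor <;> linarith
  have hex : ∀ z : ℝ × ℝ, ∃ l, Tendsto (fun n => w n (clampQ z)) atTop (𝓝 l) := fun z =>
    cauchySeq_tendsto_of_complete (hcau _ (clampQ_mem z))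
  choose V hV using hex
  have hunif : ∀ n z, |w n (clampQ z) - V z| ≤ 1 / ((n : ℝ) + 1) := fun n z => by
    have ht : Tendsto (fun m => w n (clampQ z) - w m (clampQ z)) atTop
      (𝓝 (w n (clampQ z) - V z)) := (hV z).const_sub _
    have hz : Tendsto (fun m : ℕ => 1 / ((n : ℝ) + 1) + 1 / ((m : ℝ) + 1)) atTop
      (𝓝 (1 / ((n : ℝ) + 1))) := by
      simpa using tendsto_one_div_add_atTop_nhds_zero_nat.const_add (1 / ((n : ℝ) + 1))
    refine le_of_tendsto_of_tendsto' ht.abs hz fun m => ?_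
    rw [abs_le]
    have h1 := hdiff n m _ (clampQ_mem z)
    have h2 := hdiff m n _ (clampQ_mem z)
    constructor <;> linarith
  have hVc : Continuous V := by
    have : TendstoUniformly (fun n z => w n (clampQ z)) V atTop := by
      rw [Metric.tendstoUniformly_iff]
      intro ε hε
      filter_upwards [tendsto_one_div_add_atTop_nhds_zero_nat.eventually (gt_mem_nhds hε)]
        with n hn z
      rw [dist_comm, Real.dist_eq]
      exact (hunif n z).trans_lt hn
    exact this.continuous (Eventually.of_forall fun n =>
      (hw n).continuous.comp continuous_clampQ).frequently
  have hVt : ∀ z ∈ Q, Tendsto (fun n => w n z) atTop (𝓝 (V z)) := fun z hz => by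
    have := hV z; rwa [clampQ_eq hz] at this
  have hVb : ∀ n, ∀ z ∈ Q, |w n z| ≤ |V z| + 1 := fun n z hz => by
    have h1 := hunif n z
    rw [clampQ_eq hz] at h1
    have h2 : 1 / ((n : ℝ) + 1) ≤ 1 := by simpa using hmono (Nat.zero_le n)
    have := abs_sub_abs_le_abs_sub (w n z) (V z)
    linarith
  refine ⟨V, ⟨hVc, fun φ hφ s t hs hst => ?_⟩, fun x hx => ?_⟩
  · have c1 := hφ.continuous
    have c2 := hφ.continuous_deriv2
    have hslice : ∀ r, 0 ≤ r → Tendsto (fun n => ∫ y in Icc (0 : ℝ) 1, w n (y, r) * φ y) atTop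
        (𝓝 (∫ y in Icc (0 : ℝ) 1, V (y, r) * φ y)) := by
      intro r hr
      refine tendsto_integral_of_dominated_convergence (fun y => (|V (y, r)| + 1) * |φ y|) ?_ ?_ ?_ ?_
      · intro n
        have := (hw n).continuous
        exact (by fun_prop : Continuous _).aestronglyMeasurable
      · exact integrableOn_Icc_of_continuous (by fun_prop) _ _
      · intro n
        filter_upwards [ae_restrict_mem measurableSet_Icc] with y hy
        rw [norm_mul, Real.norm_eq_abs, Real.norm_eq_abs]
        exact mul_le_mul_of_nonneg_right (hVb n _ (mk_mem_Q hy hr)) (abs_nonneg _)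
      · filter_upwards [ae_restrict_mem measurableSet_Icc] with y hy
        exact (hVt _ (mk_mem_Q hy hr)).mul_const _
    have hslab : Tendsto (fun n => ∫ z in Icc (0 : ℝ) 1 ×ˢ Ioc s t, w n z * iteratedDeriv 2 φ z.1)
        atTop (𝓝 (∫ z in Icc (0 : ℝ) 1 ×ˢ Ioc s t, V z * iteratedDeriv 2 φ z.1)) := by
      refine tendsto_integral_of_dominated_convergence
        (fun z => (|V z| + 1) * |iteratedDeriv 2 φ z.1|) ?_ ?_ ?_ ?_
      · intro n
        have := (hw n).continuous
        exact (by fun_prop : Continuous _).aestronglyMeasurable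
      · exact integrableOn_slab_of_continuous (by fun_prop) _ _
      · intro n
        filter_upwards [ae_restrict_mem (measurableSet_slab s t)] with z hz
        rw [norm_mul, Real.norm_eq_abs, Real.norm_eq_abs]
        exact mul_le_mul_of_nonneg_right (hVb n _ (slab_subset_Q hs hz)) (abs_nonneg _)
      · filter_upwards [ae_restrict_mem (measurableSet_slab s t)] with z hz
        exact (hVt _ (slab_subset_Q hs hz)).mul_const _
    refine tendsto_nhds_unique ((hslice t (hs.trans hst.le)).sub (hslice s hs)) ?_
    simp only [fun n => (hw n).weak φ hφ s t hs hst]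
    exact hslab
  · refine tendsto_nhds_unique (hVt _ (mk_mem_Q hx le_rfl)) ?_
    rw [tendsto_iff_dist_tendsto_zero]
    refine squeeze_zero (fun _ => dist_nonneg) (fun n => ?_) tendsto_one_div_add_atTop_nhds_zero_nat
    rw [dist_comm, Real.dist_eq]
    exact hw0 n x hx


/-! ### Forcing terms, with sources allowed on the lateral boundary -/

/-- Lebesgue measure on `[0,1]` together with unit masses at the two end points. -/
noncomputable def rho : Measure ℝ :=
  volume.restrict (Icc (0 : ℝ) 1) + Measure.dirac 0 + Measure.dirac 1

/-- The reference measure on `[0,1] × [0,∞)`: it charges the interior and the lateral boundary. -/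
noncomputable def Lam : Measure (ℝ × ℝ) := rho.prod (volume.restrict (Ici (0 : ℝ)))

instance : IsFiniteMeasure rho := by unfold rho; infer_instance

instance : SigmaFinite Lam := by unfold Lam; infer_instance

/-- The boundary lines are kept as atoms in space so that the boundary slopes of the walls, and
reflection at x = 0 or x = 1, can be handled as ordinary sources. -/
theorem rho_prod (ν : Measure ℝ) [SFinite ν] :
    rho.prod ν = (volume.restrict (Icc (0 : ℝ) 1)).prod ν + ν.map (Prod.mk 0) +
      ν.map (Prod.mk 1) := by
  rw [rho, Measure.add_prod, Measure.add_prod, Measure.dirac_prod, Measure.dirac_prod]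

/-- The space-time slab `ℝ × (s,t]`. -/
def slab (s t : ℝ) : Set (ℝ × ℝ) := univ ×ˢ Ioc s t

theorem measurableSet_univ_slab (s t : ℝ) : MeasurableSet (slab s t) :=
  MeasurableSet.univ.prod measurableSet_Ioc

theorem Lam_restrict_slab {s : ℝ} (hs : 0 ≤ s) (t : ℝ) :
    Lam.restrict (slab s t) = rho.prod (volume.restrict (Ioc s t)) := by
  rw [Lam, slab, ← Measure.prod_restrict, Measure.restrict_univ,
    Measure.restrict_restrict measurableSet_Ioc, inter_eq_left.2]
  exact fun r hr => hs.trans hr.1.le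

theorem prod_restrict_slab (s t : ℝ) :
    (volume.restrict (Icc (0 : ℝ) 1)).prod (volume.restrict (Ioc s t)) =
      (volume : Measure (ℝ × ℝ)).restrict (Icc (0 : ℝ) 1 ×ˢ Ioc s t) := by
  rw [Measure.prod_restrict, Measure.volume_eq_prod]

theorem Lam_restrict_slab_eq {s : ℝ} (hs : 0 ≤ s) (t : ℝ) :
    Lam.restrict (slab s t) = (volume : Measure (ℝ × ℝ)).restrict (Icc (0 : ℝ) 1 ×ˢ Ioc s t) +
      (volume.restrict (Ioc s t)).map (Prod.mk 0) +
      (volume.restrict (Ioc s t)).map (Prod.mk 1) := by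
  rw [Lam_restrict_slab hs, rho_prod, prod_restrict_slab]

theorem measurable_mk (a : ℝ) : Measurable (Prod.mk a : ℝ → ℝ × ℝ) := measurable_prodMk_left

theorem ae_rho_mem : ∀ᵐ x ∂rho, x ∈ Icc (0 : ℝ) 1 := by
  have h : ∀ a ∈ Icc (0 : ℝ) 1, ∀ᵐ x ∂(Measure.dirac a), x ∈ Icc (0 : ℝ) 1 := fun a ha =>
    (ae_dirac_iff (p := fun x => x ∈ Icc (0 : ℝ) 1) measurableSet_Icc).2 ha
  rw [rho, ae_add_measure_iff, ae_add_measure_iff]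
  exact ⟨⟨ae_restrict_mem measurableSet_Icc, h 0 (by simp)⟩, h 1 (by simp)⟩

theorem ae_Lam_fst_mem : ∀ᵐ z ∂Lam, z.1 ∈ Icc (0 : ℝ) 1 :=
  Measure.quasiMeasurePreserving_fst.ae ae_rho_mem

/-- Forcing terms: locally square integrable inside, bounded on the lateral boundary. -/
structure IsForcing (F : ℝ × ℝ → ℝ) : Prop where
  aesm : AEStronglyMeasurable F Lam
  sq : ∀ T, MemLp F 2 (volume.restrict (strip T))
  bdd : ∃ B, ∀ z : ℝ × ℝ, z.1 = 0 ∨ z.1 = 1 → |F z| ≤ B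

theorem slab_subset_strip {s t : ℝ} (hs : 0 ≤ s) : Icc (0 : ℝ) 1 ×ˢ Ioc s t ⊆ strip t :=
  fun _ hz => ⟨hz.1, hs.trans hz.2.1.le, hz.2.2⟩

section Forcing
variable {F : ℝ × ℝ → ℝ}

theorem IsForcing.integrableOn_vol (hF : IsForcing F) {s : ℝ} (hs : 0 ≤ s) (t : ℝ) :
    IntegrableOn F (Icc (0 : ℝ) 1 ×ˢ Ioc s t) := by
  have : IsFiniteMeasure ((volume : Measure (ℝ × ℝ)).restrict (strip t)) :=
    ⟨by simpa using (isCompact_strip t).measure_lt_top⟩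
  exact ((hF.sq t).integrable (by norm_num)).mono_measure
    (Measure.restrict_mono (slab_subset_strip hs) le_rfl)

theorem IsForcing.integrableOn_sq (hF : IsForcing F) {s : ℝ} (hs : 0 ≤ s) (t : ℝ) :
    IntegrableOn (fun z => F z ^ 2) (Icc (0 : ℝ) 1 ×ˢ Ioc s t) :=
  ((hF.sq t).mono_measure (Measure.restrict_mono (slab_subset_strip hs) le_rfl)).integrable_sq

theorem IsForcing.integrable_bdry (hF : IsForcing F) {a : ℝ} (ha : a = 0 ∨ a = 1) {s : ℝ}
    (hs : 0 ≤ s) (t : ℝ) : IntegrableOn (fun r => F (a, r)) (Ioc s t) := by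
  obtain ⟨B, hB⟩ := hF.bdd
  have hm : AEStronglyMeasurable F ((volume.restrict (Ioc s t)).map (Prod.mk a)) := by
    refine (hF.aesm.restrict (s := slab s t)).mono_measure ?_
    rw [Lam_restrict_slab_eq hs]
    rcases ha with rfl | rfl
    · exact Measure.le_add_right (Measure.le_add_left le_rfl)
    · exact Measure.le_add_left le_rfl
  have hm' : AEStronglyMeasurable (fun r => F (a, r)) (volume.restrict (Ioc s t)) :=
    hm.comp_measurable (measurable_mk a)
  exact Integrable.of_bound hm' B (Eventually.of_forall fun r => hB (a, r) ha)

theorem IsForcing.integrableOn (hF : IsForcing F) {s : ℝ} (hs : 0 ≤ s) (t : ℝ) :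
    IntegrableOn F (slab s t) Lam := by
  have hm := hF.aesm.restrict (s := slab s t)
  have h0 := hF.integrable_bdry (Or.inl rfl) hs t
  have h1 := hF.integrable_bdry (Or.inr rfl) hs t
  rw [IntegrableOn]
  rw [Lam_restrict_slab_eq hs] at hm ⊢
  have hv : Integrable F ((volume : Measure (ℝ × ℝ)).restrict (Icc (0 : ℝ) 1 ×ˢ Ioc s t)) :=
    hF.integrableOn_vol hs t
  refine (hv.add_measure ?_).add_measure ?_
  · exact (integrable_map_measure (hm.mono_measure
      (Measure.le_add_right (Measure.le_add_left le_rfl))) (measurable_mk 0).aemeasurable).2 h0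
  · exact (integrable_map_measure (hm.mono_measure (Measure.le_add_left le_rfl))
      (measurable_mk 1).aemeasurable).2 h1

theorem integral_slab {g : ℝ × ℝ → ℝ} {s t : ℝ} (hs : 0 ≤ s) (hg : IntegrableOn g (slab s t) Lam) :
    ∫ z in slab s t, g z ∂Lam = (∫ z in Icc (0 : ℝ) 1 ×ˢ Ioc s t, g z) +
      (∫ r in Ioc s t, g (0, r)) + ∫ r in Ioc s t, g (1, r) := by
  rw [IntegrableOn, Lam_restrict_slab_eq hs] at hg
  rw [Lam_restrict_slab_eq hs, integral_add_measure hg.left_of_add_measure hg.right_of_add_measure,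
    integral_add_measure hg.left_of_add_measure.left_of_add_measure
      hg.left_of_add_measure.right_of_add_measure,
    integral_map (measurable_mk 0).aemeasurable
      hg.left_of_add_measure.right_of_add_measure.aestronglyMeasurable,
    integral_map (measurable_mk 1).aemeasurable hg.right_of_add_measure.aestronglyMeasurable]

theorem IsForcing.mul_continuous (hF : IsForcing F) {φ : ℝ → ℝ} (hφ : Continuous φ) {s : ℝ}
    (hs : 0 ≤ s) (t : ℝ) : IntegrableOn (fun z => φ z.1 * F z) (slab s t) Lam := by
  obtain ⟨C, hC⟩ := isCompact_Icc.exists_bound_of_continuousOn (s := Icc (0 : ℝ) 1) hφ.continuousOn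
  refine Integrable.bdd_mul (c := C) (hF.integrableOn hs t)
    (hφ.comp continuous_fst).aestronglyMeasurable ?_
  exact ae_restrict_of_ae (ae_Lam_fst_mem.mono fun z hz => hC _ hz)

/-! ### Duhamel formula for the cosine modes -/

/-- The cosine coefficients of a forcing term. -/
noncomputable def fhat (F : ℝ × ℝ → ℝ) (k : ℕ) : ℝ → ℝ :=
  (Ioi (0 : ℝ)).indicator fun s => ∫ y, cosk k y * F (y, s) ∂rho

/-- The cosine coefficients of the solution of the forced heat equation. -/
noncomputable def coef (F : ℝ × ℝ → ℝ) (k : ℕ) (t : ℝ) : ℝ :=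
  ∫ s in 0..t, Real.exp (-eig k * (t - s)) * fhat F k s

/-- The solution of the forced Neumann heat equation with zero initial value. -/
noncomputable def heatSol (F : ℝ × ℝ → ℝ) (z : ℝ × ℝ) : ℝ :=
  ∑' k, nrm k * coef F k z.2 * cosk k z.1

theorem IsForcing.integrableOn_fhat (hF : IsForcing F) (k : ℕ) (t : ℝ) :
    IntegrableOn (fhat F k) (Ioc 0 t) := by
  have h := hF.mul_continuous (continuous_cosk k) le_rfl t
  rw [IntegrableOn, Lam_restrict_slab le_rfl] at h
  refine h.integral_prod_right.congr ?_
  filter_upwards [ae_restrict_mem measurableSet_Ioc] with s hs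
  rw [fhat, indicator_of_mem (show s ∈ Ioi (0 : ℝ) from hs.1)]

theorem IsForcing.integral_fhat (hF : IsForcing F) (k : ℕ) (t : ℝ) :
    ∫ s in Ioc 0 t, fhat F k s = ∫ z in slab 0 t, cosk k z.1 * F z ∂Lam := by
  have h := hF.mul_continuous (continuous_cosk k) le_rfl t
  rw [IntegrableOn, Lam_restrict_slab le_rfl] at h
  rw [Lam_restrict_slab le_rfl, integral_prod_symm _ h]
  refine setIntegral_congr_fun measurableSet_Ioc fun s hs => ?_
  rw [fhat, indicator_of_mem (show s ∈ Ioi (0 : ℝ) from hs.1)]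

theorem IsForcing.intervalIntegrable_fhat (hF : IsForcing F) (k : ℕ) (a b : ℝ) :
    IntervalIntegrable (fhat F k) volume a b := by
  have h : IntegrableOn (fhat F k) (Ioc (min a b) (max a b)) := by
    have h1 : IntegrableOn (fhat F k) (Ioc 0 (max a b)) := hF.integrableOn_fhat k _
    have h2 : IntegrableOn (fhat F k) (Iic 0) := by
      refine (integrableOn_zero (s := Iic (0 : ℝ))).congr_fun (fun s hs => ?_) measurableSet_Iic
      rw [fhat, indicator_of_notMem (show s ∉ Ioi (0 : ℝ) from fun h => not_lt.2 (mem_Iic.1 hs) h)]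
    refine (h2.union h1).mono_set fun s hs => ?_
    rcases le_or_gt s 0 with h | h
    · exact Or.inl h
    · exact Or.inr ⟨h, hs.2⟩
  rw [intervalIntegrable_iff]
  exact h

/-- After the factor exp(−`eig k`·t) is taken out, a primitive of a locally integrable function
remains. -/
theorem IsForcing.continuous_coef (hF : IsForcing F) (k : ℕ) : Continuous (coef F k) := by
  have e : coef F k = fun t => Real.exp (-eig k * t) *
      ∫ s in 0..t, Real.exp (eig k * s) * fhat F k s := by
    funext t
    rw [coef, ← intervalIntegral.integral_const_mul]
    congr 1; funext s
    rw [← mul_assoc, ← Real.exp_add]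
    congr 2; ring
  rw [e]
  refine (by fun_prop : Continuous fun t => Real.exp (-eig k * t)).mul ?_
  refine intervalIntegral.continuous_primitive (fun a b => ?_) 0
  exact (hF.intervalIntegrable_fhat k a b).continuousOn_mul
    (by fun_prop : Continuous _).continuousOn

/-- The cut-off to positive times in `fhat` switches the forcing off here. -/
theorem coef_of_nonpos (k : ℕ) {t : ℝ} (ht : t ≤ 0) : coef F k t = 0 := by
  rw [coef, intervalIntegral.integral_symm, intervalIntegral.integral_of_le ht,
    setIntegral_congr_fun (g := fun _ => (0 : ℝ)) measurableSet_Ioc]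
  · simp
  · intro s hs
    simp only
    rw [fhat, indicator_of_notMem (show s ∉ Ioi (0 : ℝ) from not_lt.2 hs.2), mul_zero]

theorem mul_integral_exp (lam : ℝ) (s t : ℝ) :
    lam * ∫ r in s..t, Real.exp (-lam * (r - s)) = 1 - Real.exp (-lam * (t - s)) := by
  rw [← intervalIntegral.integral_const_mul, intervalIntegral.integral_eq_sub_of_hasDerivAt
    (f := fun r => - Real.exp (-lam * (r - s)))]
  · simp; ring
  · intro r _
    have := (((hasDerivAt_id r).sub_const s).const_mul (-lam)).exp.neg
    exact this.congr_deriv (by simp; ring)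
  · exact (by fun_prop : Continuous _).intervalIntegrable _ _

/-- Integrated form of the linear ordinary differential equation `c' + lam c = g`. -/
theorem duhamel_integral {g : ℝ → ℝ} {t : ℝ} (ht : 0 ≤ t) (hg : IntegrableOn g (Ioc 0 t)) (lam : ℝ)
    (hl : 0 ≤ lam) :
    (∫ s in 0..t, Real.exp (-lam * (t - s)) * g s) +
      lam * ∫ r in Ioc 0 t, ∫ s in 0..r, Real.exp (-lam * (r - s)) * g s = ∫ s in Ioc 0 t, g s := by
  -- Fubini on the triangle 0 < s ≤ r ≤ t; the integral in r of the exponential is then explicit by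
  -- `mul_integral_exp`.
  set H : ℝ → ℝ → ℝ := fun r s => (Ioc 0 r).indicator (fun s => Real.exp (-lam * (r - s)) * g s) s
    with hH
  have e1 : ∫ r in Ioc 0 t, ∫ s in 0..r, Real.exp (-lam * (r - s)) * g s =
      ∫ r in Ioc 0 t, ∫ s in Ioc 0 t, H r s := by
    refine setIntegral_congr_fun measurableSet_Ioc fun r hr => ?_
    simp only [hH]
    rw [intervalIntegral.integral_of_le hr.1.le, setIntegral_indicator measurableSet_Ioc,
      inter_eq_right.2 (Ioc_subset_Ioc_right hr.2)]
  have hint : Integrable (Function.uncurry H)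
      ((volume.restrict (Ioc 0 t)).prod (volume.restrict (Ioc 0 t))) := by
    have hg' : Integrable (fun p : ℝ × ℝ => g p.2)
        ((volume.restrict (Ioc 0 t)).prod (volume.restrict (Ioc 0 t))) :=
      hg.comp_snd (volume.restrict (Ioc 0 t))
    set χ : ℝ × ℝ → ℝ := {p : ℝ × ℝ | p.2 ∈ Ioc 0 p.1}.indicator
      fun p => Real.exp (-lam * (p.1 - p.2)) with hχ
    have hm : MeasurableSet {p : ℝ × ℝ | p.2 ∈ Ioc 0 p.1} :=
      (measurableSet_lt measurable_const measurable_snd).inter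
        (measurableSet_le measurable_snd measurable_fst)
    have hχm : Measurable χ := (by fun_prop : Measurable _).indicator hm
    have hχb : ∀ p, ‖χ p‖ ≤ 1 := fun p => by
      by_cases hp : p ∈ {p : ℝ × ℝ | p.2 ∈ Ioc 0 p.1}
      · rw [hχ, indicator_of_mem hp, Real.norm_eq_abs, Real.abs_exp]
        refine Real.exp_le_one_iff.2 ?_
        have : 0 ≤ p.1 - p.2 := sub_nonneg.2 hp.2
        nlinarith
      · rw [hχ, indicator_of_notMem hp]; simp
    refine (hg'.bdd_mul (c := 1) hχm.aestronglyMeasurable (Eventually.of_forall hχb)).congr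
      (Eventually.of_forall fun p => ?_)
    simp only [Function.uncurry, hH, hχ, indicator, mem_ofPred_eq]
    split_ifs <;> simp
  have e2 : ∀ s ∈ Ioc 0 t, lam * ∫ r in Ioc 0 t, H r s = (1 - Real.exp (-lam * (t - s))) * g s := by
    intro s hs
    have : ∀ r ∈ Ioc 0 t, H r s =
        (Icc s t).indicator (fun r => Real.exp (-lam * (r - s)) * g s) r := by
      intro r hr
      simp only [hH, indicator]
      by_cases h : s ≤ r
      · rw [if_pos ⟨hs.1, h⟩, if_pos ⟨h, hr.2⟩]
      · rw [if_neg (fun h' => h h'.2), if_neg (fun h' => h h'.1)]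
    rw [setIntegral_congr_fun measurableSet_Ioc this, setIntegral_indicator measurableSet_Icc,
      inter_eq_right.2 (fun r hr => mem_Ioc.2 ⟨hs.1.trans_le hr.1, hr.2⟩), integral_mul_const,
      integral_Icc_eq_integral_Ioc, ← intervalIntegral.integral_of_le hs.2, ← mul_assoc,
      mul_integral_exp]
  rw [e1, integral_integral_swap hint, ← integral_const_mul,
    setIntegral_congr_fun measurableSet_Ioc e2, intervalIntegral.integral_of_le ht]
  have hgi : IntegrableOn (fun s => Real.exp (-lam * (t - s)) * g s) (Ioc 0 t) := by
    refine Integrable.bdd_mul (c := 1) hg (by fun_prop : Continuous _).aestronglyMeasurable ?_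
    filter_upwards [ae_restrict_mem measurableSet_Ioc] with s hs
    rw [Real.norm_eq_abs, Real.abs_exp]
    refine Real.exp_le_one_iff.2 ?_
    have : 0 ≤ t - s := sub_nonneg.2 hs.2
    nlinarith
  simp only [sub_mul, one_mul]
  rw [integral_sub hg hgi]
  ring

/-- This integrated ordinary differential equation is the weak form of the heat equation tested
against `cosk k`. -/
theorem IsForcing.coef_add (hF : IsForcing F) (k : ℕ) {t : ℝ} (ht : 0 ≤ t) :
    coef F k t + eig k * ∫ r in Ioc 0 t, coef F k r = ∫ s in Ioc 0 t, fhat F k s :=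
  duhamel_integral ht (hF.integrableOn_fhat k t) _ (eig_nonneg k)

end Forcing


/-! ### Absolute convergence of the cosine series -/

/-- Summable weights controlling the coefficients of the forced heat equation. -/
noncomputable def wgt (k : ℕ) : ℝ := (1 + eig k)⁻¹

theorem wgt_pos (k : ℕ) : 0 < wgt k := by
  have := eig_nonneg k
  unfold wgt; positivity

theorem summable_wgt : Summable wgt := by
  refine Summable.of_norm_bounded_eventually_nat
    (Real.summable_one_div_nat_pow.2 (by norm_num : 1 < 2)) ?_
  filter_upwards [eventually_ge_atTop 1] with k hk
  rw [Real.norm_eq_abs, abs_of_pos (wgt_pos k), wgt, ← one_div]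
  have hk' : (0 : ℝ) < k := by exact_mod_cast hk
  refine one_div_le_one_div_of_le (by positivity) ?_
  rw [eig, mul_pow]
  have : (1 : ℝ) ≤ Real.pi ^ 2 := by nlinarith [Real.pi_gt_three]
  nlinarith [sq_nonneg (k : ℝ)]

/-- The time profile of the `k`-th mode. -/
noncomputable def kern (t : ℝ) (k : ℕ) (s : ℝ) : ℝ := Real.exp (-eig k * (t - s))

theorem continuous_kern (t : ℝ) (k : ℕ) : Continuous (kern t k) := by unfold kern; fun_prop

theorem kern_pos (t : ℝ) (k : ℕ) (s : ℝ) : 0 < kern t k s := Real.exp_pos _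

theorem kern_le_one {t s : ℝ} (k : ℕ) (h : s ≤ t) : kern t k s ≤ 1 := by
  refine Real.exp_le_one_iff.2 ?_
  have := eig_nonneg k
  nlinarith

/-- The integral is at most t and, multiplied by `eig k`, at most 1; adding the two bounds gives the
summable weight. This smoothing in time is what makes the cosine series converge. -/
theorem integral_kern_le {t T : ℝ} (ht : 0 ≤ t) (htT : t ≤ T) (k : ℕ) :
    ∫ s in Ioc 0 t, kern t k s ≤ (1 + T) * wgt k := by
  have hI : IntegrableOn (kern t k) (Ioc 0 t) :=
    (integrableOn_Icc_of_continuous (continuous_kern t k) 0 t).mono_set Ioc_subset_Icc_self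
  have h1 : ∫ s in Ioc 0 t, kern t k s ≤ t := by
    have := setIntegral_mono_on hI (integrableOn_const (C := (1 : ℝ)) (by simp)) measurableSet_Ioc
      fun s hs => kern_le_one k hs.2
    simpa [ht] using this
  have h2 : eig k * ∫ s in Ioc 0 t, kern t k s ≤ 1 := by
    have e : ∫ s in Ioc 0 t, kern t k s = ∫ u in 0..t, Real.exp (-eig k * (u - 0)) := by
      rw [← intervalIntegral.integral_of_le ht]
      have := intervalIntegral.integral_comp_sub_left (a := 0) (b := t)
        (fun u => Real.exp (-eig k * (u - 0))) t
      simp only [sub_zero, sub_self] at this ⊢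
      exact this
    rw [e, mul_integral_exp]
    linarith [Real.exp_pos (-eig k * (t - 0))]
  have := eig_nonneg k
  rw [wgt, ← div_eq_mul_inv, le_div_iff₀ (by positivity)]
  nlinarith

section Forcing
variable {F : ℝ × ℝ → ℝ}

theorem IsForcing.integrableOn_kern (hF : IsForcing F) (k : ℕ) (t : ℝ) :
    IntegrableOn (fun z => kern t k z.2 * (cosk k z.1 * F z)) (slab 0 t) Lam := by
  refine Integrable.bdd_mul (c := 1) (hF.mul_continuous (continuous_cosk k) le_rfl t)
    ((continuous_kern t k).comp continuous_snd).aestronglyMeasurable ?_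
  filter_upwards [ae_restrict_mem (measurableSet_univ_slab 0 t)] with z hz
  rw [Real.norm_eq_abs, abs_of_pos (kern_pos _ _ _)]
  exact kern_le_one k hz.2.2

theorem IsForcing.coef_eq_integral_slab (hF : IsForcing F) (k : ℕ) {t : ℝ} (ht : 0 ≤ t) :
    coef F k t = ∫ z in slab 0 t, kern t k z.2 * (cosk k z.1 * F z) ∂Lam := by
  have h := hF.integrableOn_kern k t
  rw [IntegrableOn, Lam_restrict_slab le_rfl] at h
  rw [Lam_restrict_slab le_rfl, integral_prod_symm _ h, coef, intervalIntegral.integral_of_le ht]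
  refine setIntegral_congr_fun measurableSet_Ioc fun s hs => ?_
  simp only
  rw [integral_const_mul, fhat, indicator_of_mem (show s ∈ Ioi (0 : ℝ) from hs.1), kern]

/-- Parseval for a finite cosine sum. -/
theorem integral_theta_sq (σ : Finset ℕ) (c : ℕ → ℝ) :
    ∫ y in Icc (0 : ℝ) 1, (∑ k ∈ σ, c k * cosk k y) ^ 2 = ∑ k ∈ σ, c k ^ 2 * (nrm k)⁻¹ := by
  have e : ∀ y, (∑ k ∈ σ, c k * cosk k y) ^ 2 =
      ∑ j ∈ σ, ∑ k ∈ σ, c j * c k * (cosk j y * cosk k y) := fun y => by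
    rw [sq, Finset.sum_mul_sum]
    exact Finset.sum_congr rfl fun j _ => Finset.sum_congr rfl fun k _ => by ring
  have hi : ∀ j k, IntegrableOn (fun y => c j * c k * (cosk j y * cosk k y)) (Icc 0 1) :=
    fun j k => by
      have := continuous_cosk j
      have := continuous_cosk k
      exact integrableOn_Icc_of_continuous (by fun_prop) _ _
  simp only [e]
  rw [integral_finsetSum _ fun j _ => integrable_finsetSum _ fun k _ => hi j k]
  refine Finset.sum_congr rfl fun j hj => ?_
  rw [integral_finsetSum _ fun k _ => hi j k]
  simp only [integral_const_mul, integral_cosk_mul_cosk]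
  rw [Finset.sum_eq_single j]
  · rw [if_pos rfl]; ring
  · intro k _ hk; simp [hk.symm]
  · exact fun h => absurd hj h

/-- The key estimate for the cosine series of the solution of the forced heat equation. -/
theorem IsForcing.sum_coef_le (hF : IsForcing F) {B : ℝ}
    (hB : ∀ z : ℝ × ℝ, z.1 = 0 ∨ z.1 = 1 → |F z| ≤ B) {t T r : ℝ} (ht : 0 ≤ t) (htT : t ≤ T)
    (hr : 0 < r) (σ : Finset ℕ) :
    ∑ k ∈ σ, nrm k * |coef F k t| ≤
      r * (∫ z in strip t, F z ^ 2) + (1 + T) * (1 / r + 4 * B) * ∑ k ∈ σ, wgt k := by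
  have hB0 : 0 ≤ B := (abs_nonneg _).trans (hB (0, 0) (Or.inl rfl))
  -- With these signs the sum of |coef| becomes the pairing of F with the single function Θ, up to
  -- boundary terms. Young's inequality with parameter r splits it into r∫F² and ∫Θ²/(4r), and
  -- orthogonality bounds ∫Θ² by the summable weights.
  set sg : ℕ → ℝ := fun k => SignType.sign (coef F k t) with hsg
  have hsg1 : ∀ k, |sg k| ≤ 1 := fun k => by
    rcases lt_trichotomy (coef F k t) 0 with h | h | h <;> simp [hsg, h]
  set I : Set (ℝ × ℝ) := Icc (0 : ℝ) 1 ×ˢ Ioc 0 t with hI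
  set c : ℕ → ℝ → ℝ := fun k s => nrm k * sg k * kern t k s with hc
  set Θ : ℝ × ℝ → ℝ := fun z => ∑ k ∈ σ, c k z.2 * cosk k z.1 with hΘ
  have hΘc : Continuous Θ := by
    have h1 := continuous_kern t
    have h2 := continuous_cosk
    simp only [hΘ, hc]
    fun_prop
  have hkI : ∀ k, IntegrableOn (fun z => kern t k z.2 * (cosk k z.1 * F z)) I := fun k => by
    have := hF.integrableOn_kern k t
    rw [IntegrableOn, Lam_restrict_slab_eq le_rfl] at this
    exact this.left_of_add_measure.left_of_add_measure
  have hwI : ∀ k, 0 ≤ ∫ s in Ioc 0 t, kern t k s := fun k =>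
    setIntegral_nonneg measurableSet_Ioc fun s _ => (kern_pos t k s).le
  -- boundary contributions
  have hbd : ∀ k (a : ℝ), a = 0 ∨ a = 1 →
      |∫ s in Ioc 0 t, kern t k s * (cosk k a * F (a, s))| ≤ B * ∫ s in Ioc 0 t, kern t k s := by
    intro k a ha
    rw [← integral_const_mul]
    refine abs_integral_le_integral_abs.trans (integral_mono_of_nonneg
      (Eventually.of_forall fun s => abs_nonneg _) ?_ (Eventually.of_forall fun s => ?_))
    · exact ((integrableOn_Icc_of_continuous (continuous_kern t k) 0 t).mono_set
        Ioc_subset_Icc_self).const_mul _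
    · simp only
      rw [abs_mul, abs_mul, abs_of_pos (kern_pos t k s), mul_comm B]
      refine mul_le_mul_of_nonneg_left ?_ (kern_pos t k s).le
      exact (mul_le_mul (abs_cosk_le k a) (hB _ ha) (abs_nonneg _) zero_le_one).trans
        (one_mul B).le
  -- The factor 4 counts the two boundary lines, each entering with normalisation at most 2.
  have hsplit : ∀ k, nrm k * |coef F k t| ≤
      (∫ z in I, c k z.2 * cosk k z.1 * F z) + 4 * B * ((1 + T) * wgt k) := by
    intro k
    have e1 : |coef F k t| = sg k * coef F k t := by
      rw [hsg]; exact (sign_mul_self _).symm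
    have e2 := hF.coef_eq_integral_slab k ht
    rw [integral_slab le_rfl (hF.integrableOn_kern k t)] at e2
    have e3 : ∫ z in I, c k z.2 * cosk k z.1 * F z =
        nrm k * sg k * ∫ z in I, kern t k z.2 * (cosk k z.1 * F z) := by
      rw [← integral_const_mul]
      congr 1; funext z; simp only [hc]; ring
    have h0 := hbd k 0 (Or.inl rfl)
    have h1 := hbd k 1 (Or.inr rfl)
    simp only at e2
    set b0 := ∫ s in Ioc 0 t, kern t k s * (cosk k 0 * F (0, s))
    set b1 := ∫ s in Ioc 0 t, kern t k s * (cosk k 1 * F (1, s))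
    have h2 := mul_le_mul_of_nonneg_left (integral_kern_le ht htT k) hB0
    have h3 : sg k * (b0 + b1) ≤ 2 * (B * ((1 + T) * wgt k)) := by
      refine (le_abs_self _).trans ?_
      rw [abs_mul]
      refine (mul_le_mul (hsg1 k) (abs_add_le _ _) (abs_nonneg _) zero_le_one).trans ?_
      linarith
    have hn0 := (nrm_pos k).le
    have h4 := mul_le_mul_of_nonneg_left h3 hn0
    have hT : 0 ≤ T := ht.trans htT
    have h5 : 0 ≤ 2 * (B * ((1 + T) * wgt k)) := by
      have := (wgt_pos k).le
      positivity
    have h6 := mul_le_mul_of_nonneg_right (nrm_le k) h5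
    rw [e1, e2, e3]
    nlinarith
  have hsum : ∑ k ∈ σ, ∫ z in I, c k z.2 * cosk k z.1 * F z = ∫ z in I, Θ z * F z := by
    rw [← integral_finsetSum]
    · simp only [hΘ, Finset.sum_mul]
    · intro k _
      refine ((hkI k).const_mul (nrm k * sg k)).congr (Eventually.of_forall fun z => ?_)
      simp only [hc]; ring
  have hΘI : IntegrableOn (fun z => Θ z ^ 2) I :=
    integrableOn_slab_of_continuous (by fun_prop) _ _
  have hF2 : IntegrableOn (fun z => F z ^ 2) I := hF.integrableOn_sq le_rfl t
  have hΘF : IntegrableOn (fun z => Θ z * F z) I := by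
    have : IntegrableOn (fun z => ∑ k ∈ σ, c k z.2 * cosk k z.1 * F z) I := by
      refine integrable_finsetSum _ fun k _ => ?_
      refine ((hkI k).const_mul (nrm k * sg k)).congr (Eventually.of_forall fun z => ?_)
      simp only [hc]; ring
    refine this.congr (Eventually.of_forall fun z => ?_)
    simp only [hΘ, Finset.sum_mul]
  have hCS : ∫ z in I, Θ z * F z ≤ r * (∫ z in I, F z ^ 2) + 1 / (4 * r) * ∫ z in I, Θ z ^ 2 := by
    rw [← integral_const_mul, ← integral_const_mul, ← integral_add (hF2.const_mul _)
      (hΘI.const_mul _)]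
    refine integral_mono hΘF ((hF2.const_mul _).add (hΘI.const_mul _)) fun z => ?_
    simp only
    have h := sq_nonneg (2 * r * F z - Θ z)
    rw [div_mul_eq_mul_div, one_mul, ← sub_le_iff_le_add', le_div_iff₀ (by positivity)]
    nlinarith
  have hΘ2 : ∫ z in I, Θ z ^ 2 ≤ 2 * ((1 + T) * ∑ k ∈ σ, wgt k) := by
    rw [hI, integral_prod_Icc_Ioc (by fun_prop)]
    simp only [hΘ, integral_theta_sq]
    rw [integral_finsetSum]
    · rw [Finset.mul_sum, Finset.mul_sum]
      refine Finset.sum_le_sum fun k _ => ?_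
      have hle : ∫ s in Ioc 0 t, c k s ^ 2 * (nrm k)⁻¹ ≤ ∫ s in Ioc 0 t, 2 * kern t k s := by
        refine setIntegral_mono_on ?_ ?_ measurableSet_Ioc fun s hs => ?_
        · have h1 := continuous_kern t k
          exact (integrableOn_Icc_of_continuous (by fun_prop) 0 t).mono_set Ioc_subset_Icc_self
        · have h1 := continuous_kern t k
          exact (integrableOn_Icc_of_continuous (by fun_prop) 0 t).mono_set Ioc_subset_Icc_self
        · have h1 := kern_le_one k hs.2
          have h2 := kern_pos t k s
          have h3 : sg k ^ 2 ≤ 1 := by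
            rw [sq_le_one_iff_abs_le_one]; exact hsg1 k
          have e : c k s ^ 2 * (nrm k)⁻¹ = nrm k * (sg k ^ 2 * kern t k s ^ 2) := by
            have := (nrm_pos k).ne'
            simp only [hc]; field_simp
          rw [e]
          have h4 : sg k ^ 2 * kern t k s ^ 2 ≤ 1 * kern t k s :=
            mul_le_mul h3 (by nlinarith) (sq_nonneg _) zero_le_one
          rw [one_mul] at h4
          exact mul_le_mul (nrm_le k) h4 (by positivity) (by norm_num)
      rw [integral_const_mul] at hle
      exact hle.trans (mul_le_mul_of_nonneg_left (integral_kern_le ht htT k) (by norm_num))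
    · intro k _
      have h1 := continuous_kern t k
      exact (integrableOn_Icc_of_continuous (by fun_prop) 0 t).mono_set Ioc_subset_Icc_self
  have hFle : ∫ z in I, F z ^ 2 ≤ ∫ z in strip t, F z ^ 2 :=
    setIntegral_mono_set (hF.sq t).integrable_sq (Eventually.of_forall fun z => sq_nonneg _)
      (Eventually.of_forall (slab_subset_strip le_rfl))
  have hfin := Finset.sum_le_sum (s := σ) fun k _ => hsplit k
  rw [Finset.sum_add_distrib, hsum, ← Finset.mul_sum, ← Finset.mul_sum] at hfin
  have hw0 : 0 ≤ (1 + T) * ∑ k ∈ σ, wgt k :=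
    mul_nonneg (by linarith) (Finset.sum_nonneg fun k _ => (wgt_pos k).le)
  have h1 : 1 / (4 * r) * ∫ z in I, Θ z ^ 2 ≤ 1 / r * ((1 + T) * ∑ k ∈ σ, wgt k) := by
    have a1 := mul_le_mul_of_nonneg_left hΘ2 (by positivity : 0 ≤ 1 / (4 * r))
    have a2 : 1 / (4 * r) * (2 * ((1 + T) * ∑ k ∈ σ, wgt k)) =
      1 / 2 * (1 / r * ((1 + T) * ∑ k ∈ σ, wgt k)) := by field_simp; norm_num
    have a3 : 0 ≤ 1 / r * ((1 + T) * ∑ k ∈ σ, wgt k) := mul_nonneg (by positivity) hw0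
    linarith
  have h2 := mul_le_mul_of_nonneg_left hFle hr.le
  calc _ ≤ _ := hfin
    _ ≤ r * (∫ z in strip t, F z ^ 2) + 1 / r * ((1 + T) * ∑ k ∈ σ, wgt k)
        + 4 * B * ((1 + T) * ∑ k ∈ σ, wgt k) := by linarith
    _ = _ := by ring

end Forcing


section Forcing
variable {F : ℝ × ℝ → ℝ}

theorem IsForcing.bound_nonneg {B : ℝ} (hB : ∀ z : ℝ × ℝ, z.1 = 0 ∨ z.1 = 1 → |F z| ≤ B) : 0 ≤ B :=
  (abs_nonneg _).trans (hB (0, 0) (Or.inl rfl))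

theorem integral_strip_sq_nonneg (F : ℝ × ℝ → ℝ) (t : ℝ) : 0 ≤ ∫ z in strip t, F z ^ 2 :=
  setIntegral_nonneg (measurableSet_strip t) fun _ _ => sq_nonneg _

theorem IsForcing.integral_strip_mono (hF : IsForcing F) {t T : ℝ} (h : t ≤ T) :
    ∫ z in strip t, F z ^ 2 ≤ ∫ z in strip T, F z ^ 2 :=
  setIntegral_mono_set (hF.sq T).integrable_sq (Eventually.of_forall fun _ => sq_nonneg _)
    (Eventually.of_forall fun _ hz => ⟨hz.1, hz.2.1, hz.2.2.trans h⟩)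

/-- In the tail version the energy term does not become small with N, only the weights do; smallness
of the first term has to come from the free parameter r. -/
theorem IsForcing.sum_coef_add_le (hF : IsForcing F) {B : ℝ}
    (hB : ∀ z : ℝ × ℝ, z.1 = 0 ∨ z.1 = 1 → |F z| ≤ B) {t T r : ℝ} (hT : 0 ≤ T) (htT : t ≤ T)
    (hr : 0 < r) (N : ℕ) (σ : Finset ℕ) :
    ∑ k ∈ σ, nrm (k + N) * |coef F (k + N) t| ≤
      r * (∫ z in strip t, F z ^ 2) + (1 + T) * (1 / r + 4 * B) * ∑' k, wgt (k + N) := by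
  have hB0 := IsForcing.bound_nonneg hB
  have hc : 0 ≤ (1 + T) * (1 / r + 4 * B) := by positivity
  rcases le_or_gt t 0 with h | h
  · simp only [coef_of_nonpos _ h, abs_zero, mul_zero, Finset.sum_const_zero]
    have := integral_strip_sq_nonneg F t
    have : 0 ≤ ∑' k, wgt (k + N) := tsum_nonneg fun k => (wgt_pos _).le
    positivity
  · have h1 := hF.sum_coef_le hB h.le htT hr (σ.map (addRightEmbedding N))
    simp only [Finset.sum_map, addRightEmbedding_apply] at h1
    refine h1.trans ?_
    gcongr
    exact ((summable_nat_add_iff N).2 summable_wgt).sum_le_tsum _ fun k _ => (wgt_pos _).le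

theorem IsForcing.summable_coef (hF : IsForcing F) (t : ℝ) :
    Summable fun k => nrm k * |coef F k t| := by
  obtain ⟨B, hB⟩ := hF.bdd
  exact summable_of_sum_le (fun k => mul_nonneg (nrm_pos k).le (abs_nonneg _)) fun σ => by
    simpa using hF.sum_coef_add_le hB (le_max_left 0 t) (le_max_right 0 t) one_pos 0 σ

theorem abs_term_le (F : ℝ × ℝ → ℝ) (k : ℕ) (z : ℝ × ℝ) :
    ‖nrm k * coef F k z.2 * cosk k z.1‖ ≤ nrm k * |coef F k z.2| := by
  rw [Real.norm_eq_abs, abs_mul, abs_mul, abs_of_pos (nrm_pos k)]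
  exact mul_le_of_le_one_right (mul_nonneg (nrm_pos k).le (abs_nonneg _)) (abs_cosk_le _ _)

theorem IsForcing.summable_term (hF : IsForcing F) (z : ℝ × ℝ) :
    Summable fun k => nrm k * coef F k z.2 * cosk k z.1 :=
  Summable.of_norm_bounded (hF.summable_coef z.2) fun k => abs_term_le F k z

/-- The partial sums of the cosine series of `heatSol`. -/
noncomputable def heatSum (F : ℝ × ℝ → ℝ) (N : ℕ) (z : ℝ × ℝ) : ℝ :=
  ∑ k ∈ Finset.range N, nrm k * coef F k z.2 * cosk k z.1

theorem IsForcing.abs_heatSol_sub_le (hF : IsForcing F) {B : ℝ}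
    (hB : ∀ z : ℝ × ℝ, z.1 = 0 ∨ z.1 = 1 → |F z| ≤ B) {T r : ℝ} (hT : 0 ≤ T)
    (hr : 0 < r) (N : ℕ) {z : ℝ × ℝ} (hz : z.2 ≤ T) :
    |heatSol F z - heatSum F N z| ≤
      r * (∫ z in strip z.2, F z ^ 2) + (1 + T) * (1 / r + 4 * B) * ∑' k, wgt (k + N) := by
  rw [heatSol, heatSum, ← (hF.summable_term z).sum_add_tsum_nat_add N, add_sub_cancel_left]
  have hs : Summable fun k => nrm (k + N) * coef F (k + N) z.2 * cosk (k + N) z.1 :=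
    (summable_nat_add_iff (f := fun k => nrm k * coef F k z.2 * cosk k z.1) N).2 (hF.summable_term z)
  refine (norm_tsum_le_tsum_norm hs.norm).trans ?_
  refine Real.tsum_le_of_sum_le (fun k => norm_nonneg _) fun σ => ?_
  exact (Finset.sum_le_sum fun k _ => abs_term_le F (k + N) z).trans
    (hF.sum_coef_add_le hB hT hz hr N σ)

/-- For a forcing of size D in energy norm, choosing r proportional to 1/D turns this into a bound
linear in D, as the contraction argument for uniqueness requires. -/
theorem IsForcing.abs_heatSol_le (hF : IsForcing F)
    (hB : ∀ z : ℝ × ℝ, z.1 = 0 ∨ z.1 = 1 → F z = 0) {T r : ℝ} (hT : 0 ≤ T)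
    (hr : 0 < r) {z : ℝ × ℝ} (hz : z.2 ≤ T) :
    |heatSol F z| ≤ r * (∫ z in strip z.2, F z ^ 2) + (1 + T) * (1 / r) * ∑' k, wgt k := by
  have := hF.abs_heatSol_sub_le (B := 0) (fun z hz => by rw [hB z hz, abs_zero]) hT hr 0 hz
  simpa [heatSum] using this

/-- The cosine series converges uniformly on strips, uniformly over bounded families of forcing
terms. -/
theorem exists_heatSum_approx (T A B : ℝ) {ε : ℝ} (hε : 0 < ε) :
    ∃ N, ∀ F, IsForcing F → (∀ z : ℝ × ℝ, z.1 = 0 ∨ z.1 = 1 → |F z| ≤ B) →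
      ∫ z in strip T, F z ^ 2 ≤ A → ∀ z : ℝ × ℝ, z.2 ≤ T → |heatSol F z - heatSum F N z| ≤ ε := by
  -- First r is chosen to absorb the energy bound A into ε/2, then N to make the weighted tail
  -- smaller than ε/2. Neither choice depends on the individual F.
  set r : ℝ := ε / (2 * (|A| + 1)) with hr
  have hr0 : 0 < r := by positivity
  set C : ℝ := (1 + |T|) * (1 / r + 4 * B) with hC
  have ht : Tendsto (fun N : ℕ => C * ∑' k, wgt (k + N)) atTop (𝓝 0) := by
    simpa using (tendsto_sum_nat_add wgt).const_mul C
  obtain ⟨N, hN⟩ := (ht.eventually (gt_mem_nhds (half_pos hε))).exists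
  refine ⟨N, fun F hF hB hA z hz => ?_⟩
  have h1 := hF.abs_heatSol_sub_le hB (abs_nonneg T) hr0 N (hz.trans (le_abs_self T))
  have h2 : r * (∫ z in strip z.2, F z ^ 2) ≤ ε / 2 := by
    have h3 := (hF.integral_strip_mono hz).trans (hA.trans (le_abs_self A))
    have h4 := mul_le_mul_of_nonneg_left h3 hr0.le
    refine h4.trans ?_
    rw [hr, div_mul_eq_mul_div, div_le_div_iff₀ (by positivity) (by norm_num)]
    nlinarith [abs_nonneg A]
  linarith

theorem IsForcing.continuous_heatSum (hF : IsForcing F) (N : ℕ) : Continuous (heatSum F N) := by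
  have h1 := hF.continuous_coef
  have h2 := continuous_cosk
  unfold heatSum
  fun_prop

/-- Locally uniform limit of the continuous partial sums. -/
theorem IsForcing.continuous_heatSol (hF : IsForcing F) : Continuous (heatSol F) := by
  obtain ⟨B, hB⟩ := hF.bdd
  refine continuous_iff_continuousAt.2 fun z => ?_
  set T := z.2 + 1
  have hnhds : {y : ℝ × ℝ | y.2 < T} ∈ 𝓝 z :=
    (isOpen_lt continuous_snd continuous_const).mem_nhds (by simp [T])
  refine ContinuousOn.continuousAt ?_ hnhds
  rw [Metric.continuousOn_iff]
  intro y hy ε hε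
  obtain ⟨N, hN⟩ := exists_heatSum_approx T (∫ z in strip T, F z ^ 2) B
    (by positivity : 0 < ε / 4)
  obtain ⟨δ, hδ, h⟩ := Metric.continuousOn_iff.1 (hF.continuous_heatSum N).continuousOn y hy (ε / 4)
    (by positivity)
  refine ⟨δ, hδ, fun x hx hxy => ?_⟩
  have h1 := abs_le.1 (hN F hF hB le_rfl x (le_of_lt hx))
  have h2 := abs_le.1 (hN F hF hB le_rfl y (le_of_lt hy))
  have h3 := h x hx hxy
  rw [Real.dist_eq, abs_lt] at h3 ⊢
  constructor <;> linarith

theorem heatSol_of_nonpos (F : ℝ × ℝ → ℝ) {z : ℝ × ℝ} (hz : z.2 ≤ 0) : heatSol F z = 0 := by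
  simp [heatSol, coef_of_nonpos _ hz]

theorem IsForcing.integral_heatSol_mul_cosk (hF : IsForcing F) (j : ℕ) (t : ℝ) :
    ∫ y in Icc (0 : ℝ) 1, heatSol F (y, t) * cosk j y = coef F j t := by
  have h1 : ∀ y, heatSol F (y, t) * cosk j y =
      ∑' k, nrm k * coef F k t * (cosk k y * cosk j y) := fun y => by
    rw [heatSol, ← tsum_mul_right]
    simp only [mul_assoc]
  simp only [h1]
  rw [← integral_tsum_of_summable_integral_norm]
  · simp only [integral_const_mul, integral_cosk_mul_cosk]
    rw [tsum_eq_single j]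
    · rw [if_pos rfl]
      have := (nrm_pos j).ne'
      field_simp
    · intro k hk; simp [hk]
  · intro k
    have := continuous_cosk
    exact integrableOn_Icc_of_continuous (by fun_prop) _ _
  · refine Summable.of_nonneg_of_le (fun k => integral_nonneg fun y => norm_nonneg _) (fun k => ?_)
      (hF.summable_coef t)
    have h2 : ∀ y, ‖nrm k * coef F k t * (cosk k y * cosk j y)‖ ≤ nrm k * |coef F k t| := fun y => by
      rw [← mul_assoc, norm_mul]
      refine (mul_le_mul (abs_term_le F k (y, t)) (abs_cosk_le j y) (abs_nonneg _) ?_).trans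
        (mul_one _).le
      exact mul_nonneg (nrm_pos k).le (abs_nonneg _)
    have h3 := norm_setIntegral_le_of_norm_le_const (μ := volume) (s := Icc (0 : ℝ) 1)
      (f := fun y => ‖nrm k * coef F k t * (cosk k y * cosk j y)‖) (C := nrm k * |coef F k t|)
      (by simp) (fun y _ => by simpa using h2 y)
    rw [Real.norm_eq_abs] at h3
    refine (le_abs_self _).trans (h3.trans ?_)
    simp

theorem IsForcing.weak_cosk (hF : IsForcing F) (j : ℕ) {t : ℝ} (ht : 0 ≤ t) :
    (∫ y in Icc (0 : ℝ) 1, heatSol F (y, t) * cosk j y) =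
      (∫ z in Icc (0 : ℝ) 1 ×ˢ Ioc 0 t, heatSol F z * iteratedDeriv 2 (cosk j) z.1) +
        ∫ z in slab 0 t, cosk j z.1 * F z ∂Lam := by
  have h1 := hF.continuous_heatSol
  have h2 := continuous_cosk j
  rw [hF.integral_heatSol_mul_cosk]
  simp only [iteratedDeriv_two_cosk]
  rw [integral_prod_Icc_Ioc (g := fun z => heatSol F z * (-eig j * cosk j z.1)) (by fun_prop),
    ← hF.integral_fhat, ← hF.coef_add j ht]
  have e : ∀ r, ∫ y in Icc (0 : ℝ) 1, heatSol F (y, r) * (-eig j * cosk j y) =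
      -eig j * coef F j r := fun r => by
    rw [← hF.integral_heatSol_mul_cosk, ← integral_const_mul]
    congr 1; funext y; ring
  simp only [e, integral_const_mul]
  ring

theorem IsForcing.weak_cos_sum (hF : IsForcing F) (σ : Finset ℕ) (a : ℕ → ℝ) {t : ℝ} (ht : 0 ≤ t) :
    (∫ y in Icc (0 : ℝ) 1, heatSol F (y, t) * ∑ k ∈ σ, a k * cosk k y) =
      (∫ z in Icc (0 : ℝ) 1 ×ˢ Ioc 0 t,
        heatSol F z * iteratedDeriv 2 (fun y => ∑ k ∈ σ, a k * cosk k y) z.1) +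
        ∫ z in slab 0 t, (∑ k ∈ σ, a k * cosk k z.1) * F z ∂Lam := by
  have h1 := hF.continuous_heatSol
  have h2 := continuous_cosk
  simp only [iteratedDeriv_two_cos_sum, Finset.mul_sum, Finset.sum_mul]
  rw [integral_finsetSum, integral_finsetSum, integral_finsetSum, ← Finset.sum_add_distrib]
  · refine Finset.sum_congr rfl fun k _ => ?_
    have h := congrArg (fun x => a k * x) (hF.weak_cosk k ht)
    simp only [mul_add, ← integral_const_mul, iteratedDeriv_two_cosk] at h
    convert h using 1
    · congr 1; funext y; ring
    · congr 1
      · congr 1; funext y; ring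
      · congr 1; funext y; ring
  · intro k _
    refine ((hF.mul_continuous (h2 k) le_rfl t).const_mul (a k)).congr
      (Eventually.of_forall fun z => ?_)
    simp only; ring
  · intro k _
    exact integrableOn_slab_of_continuous (by fun_prop) _ _
  · intro k _
    exact integrableOn_Icc_of_continuous (by fun_prop) _ _

/-- The weak form of the forced heat equation. -/
theorem IsForcing.weak_zero (hF : IsForcing F) {φ : ℝ → ℝ} (hφ : IsTest φ) {t : ℝ} (ht : 0 ≤ t) :
    (∫ y in Icc (0 : ℝ) 1, heatSol F (y, t) * φ y) =
      (∫ z in Icc (0 : ℝ) 1 ×ˢ Ioc 0 t, heatSol F z * iteratedDeriv 2 φ z.1) +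
        ∫ z in slab 0 t, φ z.1 * F z ∂Lam := by
  have hu := hF.continuous_heatSol
  set c1 := ∫ y in Icc (0 : ℝ) 1, |heatSol F (y, t)|
  set c2 := ∫ z in Icc (0 : ℝ) 1 ×ˢ Ioc 0 t, |heatSol F z|
  set c3 := ∫ z in slab 0 t, |F z| ∂Lam
  have hc1 : 0 ≤ c1 := integral_nonneg fun _ => abs_nonneg _
  have hc2 : 0 ≤ c2 := integral_nonneg fun _ => abs_nonneg _
  have hc3 : 0 ≤ c3 := integral_nonneg fun _ => abs_nonneg _
  rw [← sub_eq_zero]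
  refine abs_nonpos_iff.1 (le_of_forall_pos_le_add fun ε hε => ?_)
  -- The identity is known for cosine polynomials. Replacing φ by one that is δ-close together with
  -- its second derivative changes each of the three integrals by at most δ times an L¹ norm.
  set δ := ε / (c1 + c2 + c3 + 1) with hδ
  have hδ0 : 0 < δ := by positivity
  obtain ⟨σ, a, happ⟩ := hφ.exists_cos_approx hδ0
  set p : ℝ → ℝ := fun y => ∑ k ∈ σ, a k * cosk k y with hp
  have hpt : IsTest p := isTest_cos_sum σ a
  have hpw := hF.weak_cos_sum σ a ht
  have hφc := hφ.continuous
  have hφ2 := hφ.continuous_deriv2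
  have hpc := hpt.continuous
  have hp2 := hpt.continuous_deriv2
  have est : ∀ {X : Type} [MeasurableSpace X] (μ : Measure X) (f g h : X → ℝ),
      Integrable (fun x => f x * g x) μ → Integrable (fun x => f x * h x) μ →
      Integrable (fun x => |f x|) μ → (∀ᵐ x ∂μ, |g x - h x| ≤ δ) →
      |(∫ x, f x * g x ∂μ) - ∫ x, f x * h x ∂μ| ≤ (∫ x, |f x| ∂μ) * δ := by
    intro X _ μ f g h i1 i2 i3 hgh
    rw [← integral_sub i1 i2, ← integral_mul_const]
    refine abs_integral_le_integral_abs.trans (integral_mono_ae (i1.sub i2).abs (i3.mul_const δ) ?_)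
    filter_upwards [hgh] with x hx
    rw [← mul_sub, abs_mul]
    exact mul_le_mul_of_nonneg_left hx (abs_nonneg _)
  have e1 := est (volume.restrict (Icc (0 : ℝ) 1)) (fun y => heatSol F (y, t)) φ p
    (integrableOn_Icc_of_continuous (by fun_prop) _ _)
    (integrableOn_Icc_of_continuous (by fun_prop) _ _)
    (integrableOn_Icc_of_continuous (by fun_prop) _ _) (by
      filter_upwards [ae_restrict_mem measurableSet_Icc] with y hy using (happ y hy).1)
  have e2 := est (volume.restrict (Icc (0 : ℝ) 1 ×ˢ Ioc 0 t)) (heatSol F)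
    (fun z => iteratedDeriv 2 φ z.1) (fun z => iteratedDeriv 2 p z.1)
    (integrableOn_slab_of_continuous (by fun_prop) _ _)
    (integrableOn_slab_of_continuous (by fun_prop) _ _)
    (integrableOn_slab_of_continuous (by fun_prop) _ _) (by
      filter_upwards [ae_restrict_mem (measurableSet_slab 0 t)] with z hz using (happ _ hz.1).2)
  have e3 := est (Lam.restrict (slab 0 t)) F (fun z => φ z.1) (fun z => p z.1)
    ((hF.mul_continuous hφc le_rfl t).congr (Eventually.of_forall fun z => mul_comm _ _))
    ((hF.mul_continuous hpc le_rfl t).congr (Eventually.of_forall fun z => mul_comm _ _))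
    (hF.integrableOn le_rfl t).abs (by
      filter_upwards [ae_restrict_of_ae ae_Lam_fst_mem] with z hz using (happ _ hz).1)
  simp only [mul_comm (F _)] at e3
  have hsum : (c1 + c2 + c3) * δ ≤ ε := by
    rw [hδ, ← mul_div_assoc, div_le_iff₀ (by positivity)]
    nlinarith
  rw [abs_le] at e1 e2 e3
  rw [zero_add, abs_le]
  constructor <;> linarith

/-- The weak form of the forced heat equation between two times. -/
theorem IsForcing.weak (hF : IsForcing F) {φ : ℝ → ℝ} (hφ : IsTest φ) {s t : ℝ} (hs : 0 ≤ s)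
    (hst : s ≤ t) :
    (∫ y in Icc (0 : ℝ) 1, heatSol F (y, t) * φ y) -
      (∫ y in Icc (0 : ℝ) 1, heatSol F (y, s) * φ y) =
      (∫ z in Icc (0 : ℝ) 1 ×ˢ Ioc s t, heatSol F z * iteratedDeriv 2 φ z.1) +
        ∫ z in slab s t, φ z.1 * F z ∂Lam := by
  have hu := hF.continuous_heatSol
  have hφ2 := hφ.continuous_deriv2
  rw [hF.weak_zero hφ (hs.trans hst), hF.weak_zero hφ hs]
  have d1 : Icc (0 : ℝ) 1 ×ˢ Ioc 0 t = Icc (0 : ℝ) 1 ×ˢ Ioc 0 s ∪ Icc (0 : ℝ) 1 ×ˢ Ioc s t := by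
    rw [← prod_union, Ioc_union_Ioc_eq_Ioc hs hst]
  have d2 : slab 0 t = slab 0 s ∪ slab s t := by
    rw [slab, slab, slab, ← prod_union, Ioc_union_Ioc_eq_Ioc hs hst]
  have dj : Disjoint (Ioc 0 s) (Ioc s t) := Ioc_disjoint_Ioc_of_le le_rfl
  rw [d1, d2, setIntegral_union (Disjoint.set_prod_right dj _ _) (measurableSet_slab s t)
      (integrableOn_slab_of_continuous (by fun_prop) _ _)
      (integrableOn_slab_of_continuous (by fun_prop) _ _),
    setIntegral_union (s := slab 0 s) (t := slab s t) (Disjoint.set_prod_right dj _ _)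
      (measurableSet_univ_slab s t)
      (hF.mul_continuous hφ.continuous le_rfl s) (hF.mul_continuous hφ.continuous hs t)]
  ring

end Forcing


/-! ### Walls: second derivative and boundary slopes -/

/-- Smooth functions with compact support in `(0,1)`. -/
structure IsBump (φ : ℝ → ℝ) : Prop where
  contDiff : ContDiff ℝ ∞ φ
  supp : ∃ a b : ℝ, 0 < a ∧ a ≤ b ∧ b < 1 ∧ ∀ x, x ∉ Icc a b → φ x = 0

theorem isBump_of_tsupport {φ : ℝ → ℝ} (h1 : ContDiff ℝ ∞ φ) (h2 : HasCompactSupport φ)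
    (h3 : tsupport φ ⊆ Ioo 0 1) : IsBump φ := by
  rcases (tsupport φ).eq_empty_or_nonempty with h | h
  · refine ⟨h1, 1 / 2, 1 / 2, by norm_num, le_rfl, by norm_num, fun x _ => ?_⟩
    exact image_eq_zero_of_notMem_tsupport (by simp [h])
  · have hc : IsCompact (tsupport φ) := h2
    obtain ⟨a, ha, hamin⟩ := hc.exists_isLeast h
    obtain ⟨b, hb, hbmax⟩ := hc.exists_isGreatest h
    refine ⟨h1, a, b, (h3 ha).1, hamin hb, (h3 hb).2, fun x hx => ?_⟩
    exact image_eq_zero_of_notMem_tsupport fun h => hx ⟨hamin h, hbmax h⟩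

theorem IsBump.tsupport_subset {φ : ℝ → ℝ} (h : IsBump φ) :
    HasCompactSupport φ ∧ tsupport φ ⊆ Ioo 0 1 := by
  obtain ⟨a, b, ha, _, hb, hz⟩ := h.supp
  refine ⟨HasCompactSupport.intro isCompact_Icc hz, ?_⟩
  refine (closure_minimal (fun x hx => ?_) isClosed_Icc).trans (Icc_subset_Ioo ha hb)
  by_contra hcon
  exact hx (hz x hcon)

theorem IsBump.continuous {φ : ℝ → ℝ} (h : IsBump φ) : Continuous φ := h.contDiff.continuous

theorem IsBump.sub_const_mul {φ ψ : ℝ → ℝ} (hφ : IsBump φ) (hψ : IsBump ψ) (c : ℝ) :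
    IsBump fun x => φ x - c * ψ x := by
  obtain ⟨a, b, ha, hab, hb, hz⟩ := hφ.supp
  obtain ⟨a', b', ha', hab', hb', hz'⟩ := hψ.supp
  refine ⟨hφ.contDiff.sub (contDiff_const.mul hψ.contDiff), min a a', max b b', lt_min ha ha',
    (min_le_left _ _).trans (hab.trans (le_max_left _ _)), max_lt hb hb', fun x hx => ?_⟩
  rw [hz x fun h => hx ⟨(min_le_left _ _).trans h.1, h.2.trans (le_max_left _ _)⟩,
    hz' x fun h => hx ⟨(min_le_right _ _).trans h.1, h.2.trans (le_max_right _ _)⟩]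
  simp

theorem IsBump.apply_one {φ : ℝ → ℝ} (h : IsBump φ) : φ 1 = 0 := by
  obtain ⟨a, b, _, _, hb, hz⟩ := h.supp
  exact hz 1 fun h => absurd h.2 (not_le.2 hb)

/-- The vanishing mean makes the primitive zero to the right of the support as well as to the left.
-/
theorem IsBump.primitive {φ : ℝ → ℝ} (h : IsBump φ) (h0 : ∫ x in (0 : ℝ)..1, φ x = 0) :
    IsBump (fun x => ∫ y in (0 : ℝ)..x, φ y) ∧
      ∀ x, HasDerivAt (fun x => ∫ y in (0 : ℝ)..x, φ y) (φ x) x := by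
  have hd : ∀ x, HasDerivAt (fun x => ∫ y in (0 : ℝ)..x, φ y) (φ x) x := fun x =>
    intervalIntegral.integral_hasDerivAt_right (h.continuous.intervalIntegrable _ _)
      h.continuous.stronglyMeasurable.stronglyMeasurableAtFilter h.continuous.continuousAt
  refine ⟨⟨?_, ?_⟩, hd⟩
  · rw [contDiff_infty_iff_deriv]
    refine ⟨fun x => (hd x).differentiableAt, ?_⟩
    rw [show deriv (fun x => ∫ y in (0 : ℝ)..x, φ y) = φ from funext fun x => (hd x).deriv]
    exact h.contDiff
  · obtain ⟨a, b, ha, hab, hb, hz⟩ := h.supp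
    refine ⟨a, b, ha, hab, hb, fun x hx => ?_⟩
    have hzero : ∀ c d : ℝ, (∀ y ∈ uIcc c d, y ∉ Ioo a b) → ∫ y in c..d, φ y = 0 := by
      intro c d hcd
      rw [intervalIntegral.integral_congr_ae (g := fun _ => 0)]
      · simp
      · have hab0 : ∀ᵐ y : ℝ, y ≠ a ∧ y ≠ b := by
          filter_upwards [Measure.ae_ne volume a, Measure.ae_ne volume b] with y h1 h2 using ⟨h1, h2⟩
        filter_upwards [hab0] with y hy hy2
        refine hz y fun h => hcd y (uIoc_subset_uIcc hy2) ⟨lt_of_le_of_ne h.1 hy.1.symm,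
          lt_of_le_of_ne h.2 hy.2⟩
    rw [mem_Icc, not_and_or, not_le, not_le] at hx
    rcases hx with hx | hx
    · refine hzero _ _ fun y hy hab' => ?_
      have : y ≤ a := hy.2.trans (max_le ha.le hx.le)
      linarith [hab'.1]
    · have e := intervalIntegral.integral_add_adjacent_intervals
        (h.continuous.intervalIntegrable (μ := volume) 0 x)
        (h.continuous.intervalIntegrable (μ := volume) x 1)
      have e1 : ∫ y in x..1, φ y = 0 := hzero _ _ fun y hy hab' => by
        have : b ≤ y := (le_min hx.le hb.le).trans hy.1
        linarith [hab'.2]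
      linarith

theorem exists_isBump : ∃ ψ, IsBump ψ ∧ ∫ x in (0 : ℝ)..1, ψ x = 1 := by
  obtain ⟨ρ, hρ⟩ := exists_isMollifier (δ := 1 / 4) (by norm_num)
  have hb : IsBump fun x => ρ (x - 1 / 2) := by
    have := hρ.contDiff
    refine ⟨by fun_prop, 1 / 4, 3 / 4, by norm_num, by norm_num, by norm_num, fun x hx => ?_⟩
    apply hρ.zero
    by_contra! h
    rw [abs_lt] at h
    exact hx ⟨by linarith [h.1], by linarith [h.2]⟩
  refine ⟨_, hb, ?_⟩
  rw [intervalIntegral.integral_comp_sub_right,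
    intervalIntegral.integral_eq_integral_of_support_subset, hρ.integral]
  intro x hx
  by_contra hcon
  refine hx (hρ.zero x ?_)
  by_contra! h
  rw [abs_lt] at h
  exact hcon ⟨by linarith [h.1], by linarith [h.2]⟩

/-- A continuous function with vanishing distributional second derivative is affine. -/
theorem affine_of_weak_deriv2_zero {D : ℝ → ℝ} (hD : ContinuousOn D (Icc 0 1))
    (h : ∀ φ, IsBump φ → ∫ x in (0 : ℝ)..1, D x * iteratedDeriv 2 φ x = 0) :
    ∃ a b : ℝ, ∀ x ∈ Icc (0 : ℝ) 1, D x = a + b * x := by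
  obtain ⟨ψ₀, hψ₀, hψ₀1⟩ := exists_isBump
  have hd0 : ∀ x, HasDerivAt ψ₀ (deriv ψ₀ x) x := fun x =>
    (hψ₀.contDiff.differentiable (by simp) x).hasDerivAt
  have hψ₀' : Continuous (deriv ψ₀) := (contDiff_infty_iff_deriv.1 hψ₀.contDiff).2.continuous
  set A := ∫ x in (0 : ℝ)..1, D x * ψ₀ x with hA
  set B := ∫ x in (0 : ℝ)..1, D x * deriv ψ₀ x with hB
  set m := ∫ x in (0 : ℝ)..1, x * ψ₀ x with hm
  have hDu : ContinuousOn D (uIcc 0 1) := by rwa [uIcc_of_le zero_le_one]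
  have hDi : ∀ {g : ℝ → ℝ}, Continuous g →
      IntervalIntegrable (fun x => D x * g x) volume 0 1 := fun hg =>
    (hDu.mul hg.continuousOn).intervalIntegrable
  have key : ∀ ψ, IsBump ψ → ∫ x in (0 : ℝ)..1, ψ x * (D x - (A + m * B - B * x)) = 0 := by
    intro ψ hψ
    -- Du Bois-Reymond, applied twice: subtracting a multiple of ψ₀ removes the mean, so a compactly
    -- supported primitive exists; the same correction is then made to that primitive. The second
    -- primitive is an admissible test function with second derivative ψ − Iψ₀ − c₁ψ₀', and c₁ is a
    -- combination of I and the first moment of ψ.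
    set I := ∫ x in (0 : ℝ)..1, ψ x with hI
    have hb1 := hψ.sub_const_mul hψ₀ I
    have cψ := hψ.continuous
    have cψ₀ := hψ₀.continuous
    obtain ⟨hφ1, hφ1d⟩ := hb1.primitive (by
      rw [intervalIntegral.integral_sub (cψ.intervalIntegrable _ _)
        ((by fun_prop : Continuous _).intervalIntegrable _ _),
        intervalIntegral.integral_const_mul, hψ₀1, ← hI]
      ring)
    set φ1 : ℝ → ℝ := fun x => ∫ y in (0 : ℝ)..x, (ψ y - I * ψ₀ y) with hφ1def
    set c1 := ∫ x in (0 : ℝ)..1, φ1 x with hc1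
    have cφ1 := hφ1.continuous
    obtain ⟨hφ2, hφ2d⟩ := (hφ1.sub_const_mul hψ₀ c1).primitive (by
      rw [intervalIntegral.integral_sub (cφ1.intervalIntegrable _ _)
        ((by fun_prop : Continuous _).intervalIntegrable _ _),
        intervalIntegral.integral_const_mul, hψ₀1, ← hc1]
      ring)
    have hc1v : c1 = m * I - ∫ x in (0 : ℝ)..1, x * ψ x := by
      have := intervalIntegral.integral_mul_deriv_eq_deriv_mul (a := 0) (b := 1) (u := id)
        (u' := fun _ => (1 : ℝ)) (fun x _ => hasDerivAt_id x) (fun x _ => hφ1d x)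
        (by simp) (hb1.continuous.intervalIntegrable _ _)
      simp only [id, one_mul, zero_mul, sub_zero] at this
      rw [← hc1, hφ1.apply_one] at this
      have e : ∫ x in (0 : ℝ)..1, x * (ψ x - I * ψ₀ x) =
          (∫ x in (0 : ℝ)..1, x * ψ x) - I * m := by
        rw [hm, ← intervalIntegral.integral_const_mul, ← intervalIntegral.integral_sub]
        · congr 1; funext x; ring
        · exact (by fun_prop : Continuous _).intervalIntegrable _ _
        · exact (by fun_prop : Continuous _).intervalIntegrable _ _
      rw [e] at this
      linarith
    have h2 := h _ hφ2
    have e2 : ∀ x, iteratedDeriv 2 (fun x => ∫ y in (0 : ℝ)..x, (φ1 y - c1 * ψ₀ y)) x =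
        ψ x - I * ψ₀ x - c1 * deriv ψ₀ x := fun x => by
      rw [iteratedDeriv_succ, iteratedDeriv_one, show deriv (fun x => ∫ y in (0 : ℝ)..x,
        (φ1 y - c1 * ψ₀ y)) = fun x => φ1 x - c1 * ψ₀ x from funext fun x => (hφ2d x).deriv]
      exact ((hφ1d x).sub ((hd0 x).const_mul c1)).deriv
    simp only [e2] at h2
    have e3 : ∫ x in (0 : ℝ)..1, D x * (ψ x - I * ψ₀ x - c1 * deriv ψ₀ x) =
        (∫ x in (0 : ℝ)..1, D x * ψ x) - I * A - c1 * B := by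
      rw [hA, hB, ← intervalIntegral.integral_const_mul, ← intervalIntegral.integral_const_mul,
        ← intervalIntegral.integral_sub (hDi cψ) ((hDi cψ₀).const_mul _),
        ← intervalIntegral.integral_sub ((hDi cψ).sub ((hDi cψ₀).const_mul _))
          ((hDi hψ₀').const_mul _)]
      congr 1; funext x; ring
    have e4 : ∀ c : ℝ, ∫ x in (0 : ℝ)..1, ψ x * (D x - (c - B * x)) =
        (∫ x in (0 : ℝ)..1, D x * ψ x) - c * I + B * ∫ x in (0 : ℝ)..1, x * ψ x := fun c => by
      have i1 : IntervalIntegrable (fun x => B * (x * ψ x)) volume 0 1 :=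
        (by fun_prop : Continuous _).intervalIntegrable _ _
      have i2 : IntervalIntegrable (fun x => c * ψ x) volume 0 1 :=
        (by fun_prop : Continuous _).intervalIntegrable _ _
      have j1 := intervalIntegral.integral_add ((hDi cψ).sub i2) i1
      have j2 := intervalIntegral.integral_sub (hDi cψ) i2
      rw [intervalIntegral.integral_const_mul] at j1 j2
      rw [← hI] at j2
      rw [← j2, ← j1]
      congr 1; funext x; ring
    rw [e3, hc1v] at h2
    rw [e4]
    linarith
  refine ⟨A + m * B, -B, ?_⟩
  have hE : ContinuousOn (fun x => D x - (A + m * B - B * x)) (Icc 0 1) :=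
    hD.sub (by fun_prop)
  have hae := isOpen_Ioo.ae_eq_zero_of_integral_contDiff_smul_eq_zero (μ := volume)
    (U := Ioo (0 : ℝ) 1) (f := fun x => D x - (A + m * B - B * x))
    ((hE.mono Ioo_subset_Icc_self).locallyIntegrableOn measurableSet_Ioo) (by
      intro g hg hgc hgs
      have hgb := isBump_of_tsupport hg hgc hgs
      rw [← key g hgb, intervalIntegral.integral_of_le zero_le_one, ← setIntegral_univ]
      refine (setIntegral_eq_of_subset_of_forall_sdiff_eq_zero MeasurableSet.univ (subset_univ _)
        fun x hx => ?_)
      have : g x = 0 := by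
        apply image_eq_zero_of_notMem_tsupport
        exact fun h => hx.2 (Ioo_subset_Ioc_self (hgs h))
      simp [this])
  have hEq : EqOn (fun x => D x - (A + m * B - B * x)) (fun _ => 0) (Icc 0 1) := by
    refine Measure.eqOn_Icc_of_ae_eq volume zero_ne_one ?_ hE continuousOn_const
    rw [← Measure.restrict_congr_set Ioo_ae_eq_Icc]
    filter_upwards [ae_restrict_of_ae hae, ae_restrict_mem measurableSet_Ioo] with x h1 h2 using h1 h2
  intro x hx
  have := hEq hx
  simp only at this
  linarith

theorem integral_Icc_eq_interval (f : ℝ → ℝ) :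
    ∫ x in Icc (0 : ℝ) 1, f x = ∫ x in (0 : ℝ)..1, f x := by
  rw [integral_Icc_eq_integral_Ioc, intervalIntegral.integral_of_le zero_le_one]

/-- Integration against the second derivative for a twice integrated function. -/
theorem integral_double_primitive {k : ℝ → ℝ} (hk : Integrable k) {φ : ℝ → ℝ}
    (hφ : ContDiff ℝ ∞ φ) :
    ∫ x in (0 : ℝ)..1, (∫ y in (0 : ℝ)..x, ∫ z in (0 : ℝ)..y, k z) * iteratedDeriv 2 φ x =
      (∫ y in (0 : ℝ)..1, ∫ z in (0 : ℝ)..y, k z) * deriv φ 1 - (∫ z in (0 : ℝ)..1, k z) * φ 1 +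
        ∫ x in (0 : ℝ)..1, k x * φ x := by
  set G : ℝ → ℝ := fun y => ∫ z in (0 : ℝ)..y, k z with hG
  have hki : ∀ a b, IntervalIntegrable k volume a b := fun a b => hk.intervalIntegrable
  have hGc : Continuous G := intervalIntegral.continuous_primitive hki 0
  have hJd : ∀ x, HasDerivAt (fun x => ∫ y in (0 : ℝ)..x, G y) (G x) x := fun x =>
    intervalIntegral.integral_hasDerivAt_right (hGc.intervalIntegrable _ _)
      hGc.stronglyMeasurable.stronglyMeasurableAtFilter hGc.continuousAt
  have hφ1 : ContDiff ℝ ∞ (deriv φ) := (contDiff_infty_iff_deriv.1 hφ).2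
  have hφ2d : ∀ x, HasDerivAt (deriv φ) (iteratedDeriv 2 φ x) x := fun x => by
    rw [iteratedDeriv_succ, iteratedDeriv_one]
    exact (hφ1.differentiable (by simp) x).hasDerivAt
  have hφ2c : Continuous (iteratedDeriv 2 φ) :=
    hφ.continuous_iteratedDeriv 2 (WithTop.coe_le_coe.2 le_top)
  have s1 := intervalIntegral.integral_mul_deriv_eq_deriv_mul (a := 0) (b := 1)
    (fun x _ => hJd x) (fun x _ => hφ2d x) (hGc.intervalIntegrable _ _)
    (hφ2c.intervalIntegrable _ _)
  -- As k is merely integrable, G is differentiable only almost everywhere; the second integration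
  -- by parts rests on absolute continuity.
  have hGac : AbsolutelyContinuousOnInterval G 0 1 :=
    (hki 0 1).absolutelyContinuousOnInterval_intervalIntegral (by simp)
  have hφac : AbsolutelyContinuousOnInterval φ 0 1 :=
    (hφ.of_le (by simp)).contDiffOn.absolutelyContinuousOnInterval
  have s2 := hGac.integral_mul_deriv_eq_deriv_mul hφac
  have e : ∫ x in (0 : ℝ)..1, deriv G x * φ x = ∫ x in (0 : ℝ)..1, k x * φ x := by
    refine intervalIntegral.integral_congr_ae ?_
    filter_upwards [(hki 0 1).ae_hasDerivAt_integral] with x hx hx2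
    rw [(hx (uIoc_subset_uIcc hx2) 0 (by simp)).deriv]
  have hG0 : G 0 = 0 := by simp [hG]
  rw [e, hG0, zero_mul, sub_zero] at s2
  rw [s2, intervalIntegral.integral_same, zero_mul, sub_zero] at s1
  rw [s1]
  ring

/-- Structure of the walls: the second derivative of `K` on `[0,1]` with Neumann test functions is a
density on `(0,1)` plus the two boundary derivatives. -/
theorem exists_wall_density {K : ℝ → ℝ} (hK : ContinuousOn K (Icc 0 1)) (h2 : HasL2SecondDeriv K) :
    ∃ κ : ℝ → ℝ, Measurable κ ∧ MemLp κ 2 (volume.restrict (Icc (0 : ℝ) 1)) ∧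
      κ 0 = derivWithin K (Icc 0 1) 0 ∧ κ 1 = - derivWithin K (Icc 0 1) 1 ∧
      ∀ φ, IsTest φ → ∫ x in Icc (0 : ℝ) 1, K x * iteratedDeriv 2 φ x = ∫ x, φ x * κ x ∂rho := by
  obtain ⟨k, hk2, hkw⟩ := h2
  set k₀ : ℝ → ℝ := (Icc (0 : ℝ) 1).indicator (hk2.1.mk k) with hk₀
  have hk₀m : Measurable k₀ :=
    hk2.1.stronglyMeasurable_mk.measurable.indicator measurableSet_Icc
  have hkk₀ : k =ᵐ[volume.restrict (Icc (0 : ℝ) 1)] k₀ := by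
    filter_upwards [hk2.1.ae_eq_mk, ae_restrict_mem measurableSet_Icc] with x h1 h3
    rw [h1, hk₀, indicator_of_mem h3]
  have hk₀2 : MemLp k₀ 2 (volume.restrict (Icc (0 : ℝ) 1)) := hk2.ae_eq hkk₀
  have hk₀i : Integrable k₀ := by
    have : IntegrableOn k₀ (Icc 0 1) := hk₀2.integrable (by norm_num)
    rw [hk₀] at this ⊢
    rw [integrable_indicator_iff measurableSet_Icc]
    refine this.congr_fun (fun x hx => ?_) measurableSet_Icc
    rw [indicator_of_mem hx]
  set G : ℝ → ℝ := fun y => ∫ z in (0 : ℝ)..y, k₀ z with hG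
  set J : ℝ → ℝ := fun x => ∫ y in (0 : ℝ)..x, G y with hJ
  have hGc : Continuous G :=
    intervalIntegral.continuous_primitive (fun a b => hk₀i.intervalIntegrable) 0
  have hJd : ∀ x, HasDerivAt J (G x) x := fun x =>
    intervalIntegral.integral_hasDerivAt_right (hGc.intervalIntegrable _ _)
      hGc.stronglyMeasurable.stronglyMeasurableAtFilter hGc.continuousAt
  have hJc : Continuous J := continuous_iff_continuousAt.2 fun x => (hJd x).continuousAt
  have hKu : ContinuousOn K (uIcc 0 1) := by rwa [uIcc_of_le zero_le_one]
  -- K and the double primitive J have the same distributional second derivative, so they differ by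
  -- an affine function and K' = G + b up to the end points.
  obtain ⟨a, b, hab⟩ := affine_of_weak_deriv2_zero (D := fun x => K x - J x)
    (hK.sub hJc.continuousOn) (by
      intro φ hφ
      have c2 : Continuous (iteratedDeriv 2 φ) :=
        hφ.contDiff.continuous_iteratedDeriv 2 (WithTop.coe_le_coe.2 le_top)
      simp only [sub_mul]
      have i1 : IntervalIntegrable (fun x => K x * iteratedDeriv 2 φ x) volume 0 1 :=
        (hKu.mul c2.continuousOn).intervalIntegrable
      have i2 : IntervalIntegrable (fun x => J x * iteratedDeriv 2 φ x) volume 0 1 :=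
        (hJc.mul c2).intervalIntegrable _ _
      rw [intervalIntegral.integral_sub i1 i2, integral_double_primitive hk₀i hφ.contDiff]
      have h3 := hkw φ hφ.contDiff hφ.tsupport_subset.1 hφ.tsupport_subset.2
      rw [integral_Icc_eq_interval] at h3
      have h4 : ∫ x in Icc (0 : ℝ) 1, k x * φ x = ∫ x in (0 : ℝ)..1, k₀ x * φ x := by
        rw [← integral_Icc_eq_interval]
        exact integral_congr_ae (hkk₀.mul EventuallyEq.rfl)
      have h5 : deriv φ 1 = 0 := by
        obtain ⟨a, b, _, _, hb, hz⟩ := hφ.supp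
        have : φ =ᶠ[𝓝 1] fun _ => 0 := by
          filter_upwards [lt_mem_nhds hb] with x hx
          exact hz x fun h => absurd h.2 (not_le.2 hx)
        rw [this.deriv_eq]; simp
      rw [h3, h4, h5, hφ.apply_one]
      ring)
  have hKeq : ∀ x ∈ Icc (0 : ℝ) 1, K x = J x + (a + b * x) := fun x hx => by
    have := hab x hx
    linarith
  have hKd : ∀ x ∈ Icc (0 : ℝ) 1, derivWithin K (Icc 0 1) x = G x + b := fun x hx => by
    have h3 : HasDerivAt (fun x => J x + (a + b * x)) (G x + b) x := by
      have := (hJd x).add (((hasDerivAt_id x).const_mul b).const_add a)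
      exact this.congr_deriv (by ring)
    rw [derivWithin_congr hKeq (hKeq x hx)]
    exact h3.hasDerivWithinAt.derivWithin (uniqueDiffOn_Icc zero_lt_one x hx)
  -- The values at 0 and 1 are null for Lebesgue measure but not for `rho`. They are set to the
  -- boundary terms left by integrating K φ'' by parts twice with φ' = 0 at the ends.
  set κ : ℝ → ℝ := fun x => if x = 0 then derivWithin K (Icc 0 1) 0 else
    if x = 1 then - derivWithin K (Icc 0 1) 1 else k₀ x with hκ
  have hκm : Measurable κ := Measurable.ite (measurableSet_singleton 0) measurable_const
    (Measurable.ite (measurableSet_singleton 1) measurable_const hk₀m)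
  have hκk : κ =ᵐ[volume] k₀ := by
    filter_upwards [Measure.ae_ne volume 0, Measure.ae_ne volume 1] with x h0 h1
    simp [hκ, h0, h1]
  have hκ2 : MemLp κ 2 (volume.restrict (Icc (0 : ℝ) 1)) :=
    hk₀2.ae_eq (ae_restrict_of_ae hκk.symm)
  refine ⟨κ, hκm, hκ2, by simp [hκ], by simp [hκ], fun φ hφ => ?_⟩
  have c2 := hφ.continuous_deriv2
  have c0 := hφ.continuous
  have hφd : ∀ x, HasDerivAt φ (deriv φ x) x := fun x =>
    (hφ.contDiff.differentiable (by simp) x).hasDerivAt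
  have hφ1 : ContDiff ℝ ∞ (deriv φ) := (contDiff_infty_iff_deriv.1 hφ.contDiff).2
  have hφ2d : ∀ x, HasDerivAt (deriv φ) (iteratedDeriv 2 φ x) x := fun x => by
    rw [iteratedDeriv_succ, iteratedDeriv_one]
    exact (hφ1.differentiable (by simp) x).hasDerivAt
  have haff : ∫ x in (0 : ℝ)..1, (a + b * x) * iteratedDeriv 2 φ x = b * φ 0 - b * φ 1 := by
    rw [intervalIntegral.integral_mul_deriv_eq_deriv_mul (u := fun x => a + b * x)
      (u' := fun _ => b) (fun x _ => by
        exact (((hasDerivAt_id x).const_mul b).const_add a).congr_deriv (by ring))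
      (fun x _ => hφ2d x) (by simp) (c2.intervalIntegrable _ _),
      intervalIntegral.integral_const_mul, intervalIntegral.integral_eq_sub_of_hasDerivAt
      (fun x _ => hφd x) (hφ1.continuous.intervalIntegrable _ _), hφ.left, hφ.right]
    ring
  have hL : ∫ x in Icc (0 : ℝ) 1, K x * iteratedDeriv 2 φ x =
      (∫ x in (0 : ℝ)..1, k₀ x * φ x) - (G 1 + b) * φ 1 + b * φ 0 := by
    rw [setIntegral_congr_fun measurableSet_Icc fun x hx => by rw [hKeq x hx],
      integral_Icc_eq_interval]
    simp only [add_mul (J _)]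
    have i1 : IntervalIntegrable (fun x => (a + b * x) * iteratedDeriv 2 φ x) volume 0 1 :=
      (by fun_prop : Continuous _).intervalIntegrable _ _
    have i2 : IntervalIntegrable (fun x => J x * iteratedDeriv 2 φ x) volume 0 1 :=
      (hJc.mul c2).intervalIntegrable _ _
    rw [intervalIntegral.integral_add i2 i1, haff,
      integral_double_primitive hk₀i hφ.contDiff, hφ.right]
    simp only [hG]
    ring
  have hκi : Integrable (fun x => φ x * κ x) (volume.restrict (Icc 0 1)) := by
    have : IntegrableOn κ (Icc 0 1) := hκ2.integrable (by norm_num)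
    obtain ⟨C, hC⟩ := isCompact_Icc.exists_bound_of_continuousOn (s := Icc (0 : ℝ) 1)
      c0.continuousOn
    refine Integrable.bdd_mul (c := C) this c0.aestronglyMeasurable ?_
    filter_upwards [ae_restrict_mem measurableSet_Icc] with x hx using hC x hx
  have hdi : ∀ x : ℝ, Integrable (fun x => φ x * κ x) (Measure.dirac x) := fun x =>
    (integrable_dirac (by simp [ENNReal.mul_lt_top_iff]))
  rw [hL, rho, integral_add_measure (hκi.add_measure (hdi 0)) (hdi 1),
    integral_add_measure hκi (hdi 0), integral_dirac, integral_dirac]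
  have e1 : ∫ x in Icc (0 : ℝ) 1, φ x * κ x = ∫ x in (0 : ℝ)..1, k₀ x * φ x := by
    rw [← integral_Icc_eq_interval]
    refine integral_congr_ae ?_
    filter_upwards [ae_restrict_of_ae hκk] with x hx
    rw [hx, mul_comm]
  have e0 : κ 0 = b := by
    simp only [hκ, if_true]
    have hG0 : G 0 = 0 := intervalIntegral.integral_same
    rw [hKd 0 (by simp), hG0, zero_add]
  have e2 : κ 1 = -(G 1 + b) := by
    simp only [hκ, one_ne_zero, if_false, if_true]
    rw [hKd 1 (by simp)]
  rw [e1, e0, e2]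
  ring


/-! ### Weak-* compactness of bounded functions -/

/-- Weak convergence of a subsequence of a bounded sequence in a separable Hilbert space. -/
theorem exists_subseq_inner_tendsto {H : Type*} [NormedAddCommGroup H] [InnerProductSpace ℝ H]
    [CompleteSpace H] [TopologicalSpace.SeparableSpace H] (x : ℕ → H) (R : ℝ)
    (hx : ∀ n, ‖x n‖ ≤ R) :
    ∃ (y : H) (ns : ℕ → ℕ), StrictMono ns ∧
      ∀ g : H, Tendsto (fun n => inner ℝ (x (ns n)) g) atTop (𝓝 (inner ℝ y g)) := by
  have hc := WeakDual.isSeqCompact_closedBall (𝕜 := ℝ) (E := H) (0 : StrongDual ℝ H) R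
  obtain ⟨y, -, ns, hns, hlim⟩ := hc (x := fun n => StrongDual.toWeakDual
    (InnerProductSpace.toDual ℝ H (x n))) (fun n => by
      change InnerProductSpace.toDual ℝ H (x n) ∈ Metric.closedBall 0 R
      rw [mem_closedBall_zero_iff, LinearIsometryEquiv.norm_map]
      exact hx n)
  refine ⟨(InnerProductSpace.toDual ℝ H).symm (WeakDual.toStrongDual y), ns, hns, fun g => ?_⟩
  have h1 := (WeakDual.eval_continuous (𝕜 := ℝ) (E := H) g).continuousAt.tendsto.comp hlim
  rw [InnerProductSpace.toDual_symm_apply]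
  exact h1

/-- On a finite measure space the functions are bounded in L², so a subsequence converges weakly
there. Integrals over sets carry the bound 1 to the limit almost everywhere, and clamping makes it
hold everywhere. Truncating G extends the convergence from L² to L¹ test functions. -/
theorem exists_subseq_weak_of_finite {X : Type*} [MeasurableSpace X]
    [MeasurableSpace.CountablyGenerated X] (ν : Measure X) [IsFiniteMeasure ν] (θ : ℕ → X → ℝ)
    (hm : ∀ n, Measurable (θ n)) (hb : ∀ n z, |θ n z| ≤ 1) :
    ∃ (θ' : X → ℝ) (ns : ℕ → ℕ), Measurable θ' ∧ (∀ z, |θ' z| ≤ 1) ∧ StrictMono ns ∧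
      ∀ G : X → ℝ, Integrable G ν →
        Tendsto (fun n => ∫ z, θ (ns n) z * G z ∂ν) atTop (𝓝 (∫ z, θ' z * G z ∂ν)) := by
  have hmem : ∀ n, MemLp (θ n) 2 ν := fun n =>
    MemLp.of_bound (hm n).aestronglyMeasurable 1 (Eventually.of_forall (hb n))
  have : Fact ((2 : ENNReal) ≠ ⊤) := ⟨by simp⟩
  obtain ⟨y, ns, hns, hlim⟩ := exists_subseq_inner_tendsto (H := Lp ℝ 2 ν)
    (fun n => (hmem n).toLp (θ n)) ((measureUnivNNReal ν : ℝ) ^ (2 : ENNReal).toReal⁻¹ * 1) (fun n => by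
      exact Lp.norm_le_of_ae_bound (f := (hmem n).toLp (θ n)) (C := 1) zero_le_one (by
        filter_upwards [(hmem n).coeFn_toLp] with z hz
        rw [hz]; exact hb n z))
  have hlim2 : ∀ g : X → ℝ, MemLp g 2 ν →
      Tendsto (fun n => ∫ z, θ (ns n) z * g z ∂ν) atTop (𝓝 (∫ z, y z * g z ∂ν)) := by
    intro g hg
    have h := hlim (hg.toLp g)
    simp only [L2.inner_def] at h
    refine (h.congr fun n => ?_).trans (le_of_eq ?_)
    · refine integral_congr_ae ?_
      filter_upwards [(hmem (ns n)).coeFn_toLp, hg.coeFn_toLp] with z h1 h2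
      rw [h1, h2]; simp [mul_comm]
    · congr 1
      refine integral_congr_ae ?_
      filter_upwards [hg.coeFn_toLp] with z h2
      rw [h2]; simp [mul_comm]
  have hyI : Integrable (fun z => y z) ν := (Lp.memLp y).integrable (by norm_num)
  have hset : ∀ s, MeasurableSet s → Tendsto (fun n => ∫ z in s, θ (ns n) z ∂ν) atTop
      (𝓝 (∫ z in s, y z ∂ν)) := by
    intro s hs
    have h := hlim2 (s.indicator fun _ => (1 : ℝ)) (memLp_indicator_const 2 hs 1 (by simp))
    have key : ∀ q : X → ℝ, ∫ z, q z * s.indicator (fun _ => (1 : ℝ)) z ∂ν = ∫ z in s, q z ∂ν := by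
      intro q
      rw [← integral_indicator hs]
      congr 1; funext z
      by_cases hz : z ∈ s <;> simp [hz]
    simpa only [key] using h
  have hbd : ∀ n s, |∫ z in s, θ (ns n) z ∂ν| ≤ ν.real s := by
    intro n s
    have := norm_setIntegral_le_of_norm_le_const (μ := ν) (s := s) (f := θ (ns n)) (C := 1)
      (measure_lt_top _ _) (fun z _ => hb _ z)
    simpa using this
  have hu : (fun z => y z) ≤ᵐ[ν] fun _ => (1 : ℝ) := by
    refine ae_le_of_forall_setIntegral_le hyI (integrable_const _) fun s hs _ => ?_
    rw [setIntegral_const, smul_eq_mul, mul_one]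
    exact le_of_tendsto' (hset s hs) fun n => (abs_le.1 (hbd n s)).2
  have hl : (fun _ => (-1 : ℝ)) ≤ᵐ[ν] fun z => y z := by
    refine ae_le_of_forall_setIntegral_le (integrable_const _) hyI fun s hs _ => ?_
    rw [setIntegral_const, smul_eq_mul, mul_neg, mul_one]
    exact ge_of_tendsto' (hset s hs) fun n => (abs_le.1 (hbd n s)).1
  have hsm : StronglyMeasurable (fun z => y z) := Lp.stronglyMeasurable y
  set θ' : X → ℝ := fun z => max (-1) (min 1 (y z)) with hθ'
  have hθb : ∀ z, |θ' z| ≤ 1 := fun z =>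
    abs_le.2 ⟨le_max_left _ _, max_le (by norm_num) (min_le_left _ _)⟩
  have hθm : Measurable θ' := by
    have := hsm.measurable
    exact measurable_const.max (measurable_const.min this)
  have heq : (fun z => y z) =ᵐ[ν] θ' := by
    filter_upwards [hu, hl] with z h1 h2
    simp only [hθ']
    rw [min_eq_right h1, max_eq_right h2]
  refine ⟨θ', ns, hθm, hθb, hns, fun G hG => ?_⟩
  have hI : ∀ (q : X → ℝ), Measurable q → (∀ z, |q z| ≤ 1) → ∀ g : X → ℝ, Integrable g ν →
      Integrable (fun z => q z * g z) ν := fun q hq hq1 g hg =>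
    hg.bdd_mul hq.aestronglyMeasurable (c := 1) (Eventually.of_forall hq1)
  set Gm : ℕ → X → ℝ := fun m z => max (-(m : ℝ)) (min m (G z)) with hGm
  have hGmle : ∀ m z, |Gm m z| ≤ |G z| := by
    intro m z
    have : (0 : ℝ) ≤ m := Nat.cast_nonneg m
    simp only [hGm]
    rcases abs_cases (G z) with ⟨h, _⟩ | ⟨h, _⟩ <;> rw [h, abs_le] <;> constructor <;>
      first
      | (apply max_le <;> [linarith; exact (min_le_right _ _).trans (by linarith)])
      | (refine le_trans ?_ (le_max_right _ _); apply le_min <;> linarith)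
  have hGmm : ∀ m, AEStronglyMeasurable (Gm m) ν := fun m =>
    (aemeasurable_const.max (aemeasurable_const.min hG.aemeasurable)).aestronglyMeasurable
  have hGmI : ∀ m, Integrable (Gm m) ν := fun m =>
    hG.mono (hGmm m) (Eventually.of_forall fun z => hGmle m z)
  have hGm2 : ∀ m, MemLp (Gm m) 2 ν := fun m =>
    MemLp.of_bound (hGmm m) m (Eventually.of_forall fun z => by
      rw [Real.norm_eq_abs, abs_le]
      have : (0 : ℝ) ≤ m := Nat.cast_nonneg m
      exact ⟨le_max_left _ _, max_le (by linarith) (min_le_left _ _)⟩)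
  have hconv : Tendsto (fun m => ∫ z, |G z - Gm m z| ∂ν) atTop (𝓝 0) := by
    have : Tendsto (fun m => ∫ z, |G z - Gm m z| ∂ν) atTop (𝓝 (∫ _, (0 : ℝ) ∂ν)) := by
      refine tendsto_integral_of_dominated_convergence (fun z => 2 * |G z|)
        (fun m => (hG.sub (hGmI m)).abs.aestronglyMeasurable) (hG.abs.const_mul 2) ?_ ?_
      · intro m
        refine Eventually.of_forall fun z => ?_
        rw [Real.norm_eq_abs, abs_abs]
        calc |G z - Gm m z| ≤ |G z| + |Gm m z| := abs_sub _ _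
          _ ≤ 2 * |G z| := by linarith [hGmle m z]
      · refine Eventually.of_forall fun z => ?_
        refine tendsto_const_nhds.congr' ?_
        filter_upwards [eventually_ge_atTop ⌈|G z|⌉₊] with m hm'
        have h := (Nat.le_ceil |G z|).trans (Nat.cast_le.2 hm')
        obtain ⟨h1, h2⟩ := abs_le.1 h
        simp only [hGm]
        rw [min_eq_right h2, max_eq_right h1, sub_self, abs_zero]
    simpa using this
  rw [Metric.tendsto_atTop]
  intro ε hε
  obtain ⟨m, hm'⟩ := (hconv.eventually (gt_mem_nhds (show (0 : ℝ) < ε / 4 by linarith))).exists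
  have hlm := hlim2 (Gm m) (hGm2 m)
  have hyθ : ∫ z, y z * Gm m z ∂ν = ∫ z, θ' z * Gm m z ∂ν := by
    refine integral_congr_ae ?_
    filter_upwards [heq] with z hz
    rw [← hz]
  rw [hyθ, Metric.tendsto_atTop] at hlm
  obtain ⟨N, hN⟩ := hlm (ε / 4) (by linarith)
  refine ⟨N, fun n hn => ?_⟩
  have herr : ∀ q : X → ℝ, Measurable q → (∀ z, |q z| ≤ 1) →
      |∫ z, q z * G z ∂ν - ∫ z, q z * Gm m z ∂ν| ≤ ∫ z, |G z - Gm m z| ∂ν := by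
    intro q hq hq1
    rw [← integral_sub (hI q hq hq1 G hG) (hI q hq hq1 _ (hGmI m))]
    refine (abs_integral_le_integral_abs).trans ?_
    refine integral_mono_of_nonneg (Eventually.of_forall fun z => abs_nonneg _)
      (hG.sub (hGmI m)).abs (Eventually.of_forall fun z => ?_)
    change |q z * G z - q z * Gm m z| ≤ |G z - Gm m z|
    rw [← mul_sub, abs_mul]
    exact mul_le_of_le_one_left (abs_nonneg _) (hq1 z)
  have e1 := abs_le.1 (herr _ (hm (ns n)) (hb (ns n)))
  have e2 := abs_le.1 (herr _ hθm hθb)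
  have e3 := hN n hn
  rw [Real.dist_eq, abs_lt] at e3
  rw [Real.dist_eq, abs_lt]
  constructor <;> linarith [e1.1, e1.2, e2.1, e2.2, e3.1, e3.2]

/-- Sequences bounded by `1` are weak-* sequentially precompact in `L^∞`. -/
theorem exists_subseq_weak {X : Type*} [MeasurableSpace X]
    [MeasurableSpace.CountablyGenerated X] (μ : Measure X) [SigmaFinite μ] (θ : ℕ → X → ℝ)
    (hm : ∀ n, Measurable (θ n)) (hb : ∀ n z, |θ n z| ≤ 1) :
    ∃ (θ' : X → ℝ) (ns : ℕ → ℕ), Measurable θ' ∧ (∀ z, |θ' z| ≤ 1) ∧ StrictMono ns ∧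
      ∀ G : X → ℝ, Integrable G μ →
        Tendsto (fun n => ∫ z, θ (ns n) z * G z ∂μ) atTop (𝓝 (∫ z, θ' z * G z ∂μ)) := by
  -- Passing to a finite measure that dominates μ reduces to the previous case, the density being
  -- absorbed into the test function.
  obtain ⟨ν, hν, hμν, -⟩ := exists_isFiniteMeasure_absolutelyContinuous μ
  obtain ⟨θ', ns, h1, h2, h3, h4⟩ := exists_subseq_weak_of_finite ν θ hm hb
  refine ⟨θ', ns, h1, h2, h3, fun G hG => ?_⟩
  have hG' : Integrable (fun z => (μ.rnDeriv ν z).toReal • G z) ν :=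
    (integrable_rnDeriv_smul_iff hμν).2 hG
  have h := h4 _ hG'
  have key : ∀ q : X → ℝ, ∫ z, q z * ((μ.rnDeriv ν z).toReal • G z) ∂ν = ∫ z, q z * G z ∂μ := by
    intro q
    rw [← integral_rnDeriv_smul hμν]
    congr 1; funext z
    simp only [smul_eq_mul]; ring
  simpa only [key] using h

/-- A weak-* limit agrees with the pointwise limit where the latter exists. -/
theorem ae_eq_of_weak_of_pointwise {X : Type*} [MeasurableSpace X] {μ : Measure X} [SigmaFinite μ]
    {θ : ℕ → X → ℝ} (hm : ∀ n, Measurable (θ n)) (hb : ∀ n z, |θ n z| ≤ 1)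
    {θ' θ'' : X → ℝ} (hm' : Measurable θ') (hb' : ∀ z, |θ' z| ≤ 1)
    (hm'' : Measurable θ'') (hb'' : ∀ z, |θ'' z| ≤ 1)
    (hw : ∀ G : X → ℝ, Integrable G μ →
        Tendsto (fun n => ∫ z, θ n z * G z ∂μ) atTop (𝓝 (∫ z, θ' z * G z ∂μ)))
    {E : Set X} (hE : MeasurableSet E)
    (hp : ∀ᵐ z ∂μ, z ∈ E → Tendsto (fun n => θ n z) atTop (𝓝 (θ'' z))) :
    ∀ᵐ z ∂μ, z ∈ E → θ' z = θ'' z := by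
  refine ae_of_forall_measure_lt_top_ae_restrict _ fun s hs hsf => ?_
  have hEs : MeasurableSet (E ∩ s) := hE.inter hs
  -- Testing with the difference of the two limits turns their equality into the vanishing of an
  -- integral of a square; s is a piece of finite measure, so that G is integrable.
  set G : X → ℝ := (E ∩ s).indicator fun z => θ' z - θ'' z with hG
  have hdb : ∀ z, |θ' z - θ'' z| ≤ 2 := fun z =>
    (abs_sub _ _).trans (by linarith [hb' z, hb'' z])
  have hfin : μ (E ∩ s) < ⊤ := (measure_mono inter_subset_right).trans_lt hsf
  have hGI : Integrable G μ := by
    rw [hG, integrable_indicator_iff hEs]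
    exact Measure.integrableOn_of_bounded hfin.ne (hm'.sub hm'').aestronglyMeasurable
      (M := 2) (Eventually.of_forall fun z => hdb z)
  have h1 := hw G hGI
  have h2 : Tendsto (fun n => ∫ z, θ n z * G z ∂μ) atTop (𝓝 (∫ z, θ'' z * G z ∂μ)) := by
    refine tendsto_integral_of_dominated_convergence (fun z => |G z|)
      (fun n => (hm n).aestronglyMeasurable.mul hGI.aestronglyMeasurable) hGI.abs ?_ ?_
    · intro n
      refine Eventually.of_forall fun z => ?_
      rw [Real.norm_eq_abs, abs_mul]
      exact mul_le_of_le_one_left (abs_nonneg _) (hb n z)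
    · filter_upwards [hp] with z hz
      by_cases h : z ∈ E ∩ s
      · exact (hz h.1).mul_const _
      · simp [hG, h]
  have h3 := tendsto_nhds_unique h1 h2
  have i1 : Integrable (fun z => θ' z * G z) μ :=
    hGI.bdd_mul hm'.aestronglyMeasurable (c := 1) (Eventually.of_forall hb')
  have i2 : Integrable (fun z => θ'' z * G z) μ :=
    hGI.bdd_mul hm''.aestronglyMeasurable (c := 1) (Eventually.of_forall hb'')
  have h4 : ∫ z, (θ' z * G z - θ'' z * G z) ∂μ = 0 := by
    rw [integral_sub i1 i2, h3, sub_self]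
  have h5 : ∀ z, θ' z * G z - θ'' z * G z = (G z) ^ 2 := by
    intro z
    by_cases h : z ∈ E ∩ s
    · simp only [hG, indicator_of_mem h]; ring
    · simp [hG, h]
  have h6 : (fun z => θ' z * G z - θ'' z * G z) =ᵐ[μ] 0 := by
    refine (integral_eq_zero_iff_of_nonneg (fun z => ?_) (i1.sub i2)).1 h4
    change 0 ≤ θ' z * G z - θ'' z * G z
    rw [h5]; positivity
  rw [ae_restrict_iff' hs]
  filter_upwards [h6] with z hz hzs hzE
  have : θ' z * G z - θ'' z * G z = 0 := hz
  rw [h5, sq_eq_zero_iff] at this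
  simp only [hG, indicator_of_mem (show z ∈ E ∩ s from ⟨hzE, hzs⟩)] at this
  linarith


/-! ### Operations on forcings and stability of heat solutions under weak limits -/

section ForcingAlgebra
variable {F G m : ℝ × ℝ → ℝ}

theorem IsForcing.add (hF : IsForcing F) (hG : IsForcing G) : IsForcing fun z => F z + G z where
  aesm := hF.aesm.add hG.aesm
  sq T := (hF.sq T).add (hG.sq T)
  bdd := by
    obtain ⟨B, hB⟩ := hF.bdd
    obtain ⟨C, hC⟩ := hG.bdd
    exact ⟨B + C, fun z hz => (abs_add_le _ _).trans (add_le_add (hB z hz) (hC z hz))⟩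

theorem IsForcing.const_mul (hF : IsForcing F) (c : ℝ) : IsForcing fun z => c * F z where
  aesm := hF.aesm.const_mul c
  sq T := (hF.sq T).const_mul c
  bdd := by
    obtain ⟨B, hB⟩ := hF.bdd
    refine ⟨|c| * B, fun z hz => ?_⟩
    rw [abs_mul]
    exact mul_le_mul_of_nonneg_left (hB z hz) (abs_nonneg _)

theorem isForcing_const (c : ℝ) : IsForcing fun _ => c where
  aesm := aestronglyMeasurable_const
  sq T := by
    have : IsFiniteMeasure ((volume : Measure (ℝ × ℝ)).restrict (strip T)) :=
      ⟨by simpa using (isCompact_strip T).measure_lt_top⟩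
    exact memLp_const c
  bdd := ⟨|c|, fun _ _ => le_rfl⟩

theorem IsForcing.of_abs_le (hm : IsForcing m) (hF : Measurable F) (h : ∀ z, |F z| ≤ m z) :
    IsForcing F where
  aesm := hF.aestronglyMeasurable
  sq T := (hm.sq T).mono hF.aestronglyMeasurable
    (Eventually.of_forall fun z => (h z).trans (le_abs_self _))
  bdd := by
    obtain ⟨B, hB⟩ := hm.bdd
    exact ⟨B, fun z hz => (h z).trans ((le_abs_self _).trans (hB z hz))⟩

theorem isForcing_fst {κ : ℝ → ℝ} (hκ : Measurable κ)
    (h2 : MemLp κ 2 (volume.restrict (Icc (0 : ℝ) 1))) : IsForcing fun z => κ z.1 where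
  aesm := (hκ.comp measurable_fst).aestronglyMeasurable
  sq T := by
    have h := h2.comp_fst (volume.restrict (Icc (0 : ℝ) T))
    rwa [Measure.prod_restrict, ← Measure.volume_eq_prod] at h
  bdd := ⟨max |κ 0| |κ 1|, fun z hz => by
    rcases hz with hz | hz <;> rw [hz]
    · exact le_max_left _ _
    · exact le_max_right _ _⟩

end ForcingAlgebra

theorem ae_Lam_snd_ne (t : ℝ) : ∀ᵐ z ∂Lam, z.2 ≠ t := by
  refine Measure.quasiMeasurePreserving_snd.ae (p := fun r => r ≠ t) (ae_restrict_of_ae ?_)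
  simp [ae_iff]

theorem ae_Lam_snd_pos : ∀ᵐ z ∂Lam, 0 < z.2 := by
  have h : ∀ᵐ z ∂Lam, z.2 ∈ Ici (0 : ℝ) := 
    Measure.quasiMeasurePreserving_snd.ae (ae_restrict_mem measurableSet_Ici)
  filter_upwards [h, ae_Lam_snd_ne 0] with z h1 h2
  exact lt_of_le_of_ne h1 (Ne.symm h2)

theorem coef_congr {F G : ℝ × ℝ → ℝ} (hF : IsForcing F) (hG : IsForcing G) {t : ℝ}
    (h : ∀ z : ℝ × ℝ, 0 < z.2 → z.2 ≤ t → F z = G z) (k : ℕ) : coef F k t = coef G k t := by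
  rcases le_total t 0 with ht | ht
  · rw [coef_of_nonpos k ht, coef_of_nonpos k ht]
  · rw [hF.coef_eq_integral_slab k ht, hG.coef_eq_integral_slab k ht]
    refine setIntegral_congr_fun (measurableSet_univ_slab 0 t) fun z hz => ?_
    rw [h z hz.2.1 hz.2.2]

/-- Causality of the heat operator, which allows the delayed equation to be solved step by step. -/
theorem heatSol_congr {F G : ℝ × ℝ → ℝ} (hF : IsForcing F) (hG : IsForcing G) {z : ℝ × ℝ}
    (h : ∀ w : ℝ × ℝ, 0 < w.2 → w.2 ≤ z.2 → F w = G w) : heatSol F z = heatSol G z := by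
  simp only [heatSol, coef_congr hF hG h]

section WeakLimit
variable {F : ℕ → ℝ × ℝ → ℝ} {F' m : ℝ × ℝ → ℝ}

/-- The forcings share the integrable majorant m, and the time profiles at τₙ and t merge pointwise
off the null set {s = t}; dominated convergence applies although Fₙ varies. -/
theorem tendsto_coef_sub (hm : IsForcing m) (hF : ∀ n, IsForcing (F n))
    (hb : ∀ n z, |F n z| ≤ m z) (k : ℕ) {t : ℝ} {τ : ℕ → ℝ}
    (h0 : ∀ n, 0 ≤ τ n) (h1 : ∀ n, τ n ≤ t) (hτ : Tendsto τ atTop (𝓝 t)) :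
    Tendsto (fun n => coef (F n) k (τ n) - coef (F n) k t) atTop (𝓝 0) := by
  have ht : 0 ≤ t := (h0 0).trans (h1 0)
  set D : ℕ → ℝ × ℝ → ℝ := fun n z =>
    (slab 0 (τ n)).indicator (fun z => kern (τ n) k z.2 * (cosk k z.1 * F n z)) z -
      kern t k z.2 * (cosk k z.1 * F n z) with hD
  have hi : ∀ n, IntegrableOn ((slab 0 (τ n)).indicator
      fun z => kern (τ n) k z.2 * (cosk k z.1 * F n z)) (slab 0 t) Lam := fun n => by
    refine Integrable.integrableOn ?_
    rw [integrable_indicator_iff (measurableSet_univ_slab _ _)]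
    exact (hF n).integrableOn_kern k _
  have e : ∀ n, coef (F n) k (τ n) - coef (F n) k t = ∫ z in slab 0 t, D n z ∂Lam := by
    intro n
    rw [hD, integral_sub (hi n) ((hF n).integrableOn_kern k t),
      setIntegral_indicator (measurableSet_univ_slab _ _),
      (hF n).coef_eq_integral_slab k (h0 n), (hF n).coef_eq_integral_slab k ht]
    congr 3
    ext z
    exact ⟨fun h => ⟨⟨h.1, h.2.1, h.2.2.trans (h1 n)⟩, h⟩, fun h => h.2⟩
  simp only [e]
  have key : Tendsto (fun n => ∫ z in slab 0 t, D n z ∂Lam) atTop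
      (𝓝 (∫ z in slab 0 t, (0 : ℝ) ∂Lam)) := by
    have hFm : ∀ n z, |cosk k z.1 * F n z| ≤ m z := fun n z => by
      rw [abs_mul]
      exact (mul_le_of_le_one_left (abs_nonneg _) (abs_cosk_le k _)).trans (hb n z)
    refine tendsto_integral_of_dominated_convergence (fun z => 2 * m z)
      (fun n => ((hi n).sub ((hF n).integrableOn_kern k t)).aestronglyMeasurable)
      ((hm.integrableOn le_rfl t).const_mul 2) ?_ ?_
    · intro n
      filter_upwards [ae_restrict_mem (measurableSet_univ_slab 0 t)] with z hz
      have a1 : |kern t k z.2 * (cosk k z.1 * F n z)| ≤ m z := by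
        rw [abs_mul, abs_of_pos (kern_pos _ _ _)]
        exact (mul_le_of_le_one_left (abs_nonneg _) (kern_le_one _ hz.2.2)).trans (hFm n z)
      have a2 : |(slab 0 (τ n)).indicator
          (fun z => kern (τ n) k z.2 * (cosk k z.1 * F n z)) z| ≤ m z := by
        by_cases h : z ∈ slab 0 (τ n)
        · rw [indicator_of_mem h, abs_mul, abs_of_pos (kern_pos _ _ _)]
          exact (mul_le_of_le_one_left (abs_nonneg _) (kern_le_one _ h.2.2)).trans (hFm n z)
        · rw [indicator_of_notMem h, abs_zero]
          exact (abs_nonneg _).trans (hb n z)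
      rw [Real.norm_eq_abs]
      refine (abs_sub _ _).trans ?_
      linarith
    · filter_upwards [ae_restrict_mem (measurableSet_univ_slab 0 t),
        ae_restrict_of_ae (ae_Lam_snd_ne t)] with z hz hzt
      have hlt : z.2 < t := lt_of_le_of_ne hz.2.2 hzt
      have hev : ∀ᶠ n in atTop, z.2 < τ n := hτ.eventually (lt_mem_nhds hlt)
      have hk : Tendsto (fun n => |kern (τ n) k z.2 - kern t k z.2| * m z) atTop (𝓝 0) := by
        have c : Continuous fun r => |kern r k z.2 - kern t k z.2| * m z := by
          unfold kern; fun_prop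
        have := (c.tendsto t).comp hτ
        simpa [Function.comp_def] using this
      refine squeeze_zero_norm' ?_ hk
      filter_upwards [hev] with n hn
      simp only [hD]
      rw [indicator_of_mem (show z ∈ slab 0 (τ n) from ⟨hz.1, hz.2.1, hn.le⟩), ← sub_mul,
        norm_mul]
      exact mul_le_mul_of_nonneg_left (hFm n z) (abs_nonneg _)
  simpa using key

/-- Weak convergence of the forcing gives convergence of each cosine mode, and the truncation error
of the series is uniform over forcings dominated by m. The moving evaluation times accommodate the
delay. -/
theorem tendsto_heatSol (hm : IsForcing m) (hF : ∀ n, IsForcing (F n))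
    (hb : ∀ n z, |F n z| ≤ m z) (hF' : IsForcing F') (hb' : ∀ z, |F' z| ≤ m z)
    (hw : ∀ ψ : ℝ × ℝ → ℝ, Continuous ψ → ∀ t, 0 ≤ t →
      IntegrableOn (fun z => ψ z * m z) (slab 0 t) Lam →
      Tendsto (fun n => ∫ z in slab 0 t, ψ z * F n z ∂Lam) atTop
        (𝓝 (∫ z in slab 0 t, ψ z * F' z ∂Lam)))
    (x : ℝ) {t : ℝ} {τ : ℕ → ℝ}
    (h0 : ∀ n, 0 ≤ τ n) (h1 : ∀ n, τ n ≤ t) (hτ : Tendsto τ atTop (𝓝 t)) :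
    Tendsto (fun n => heatSol (F n) (x, τ n)) atTop (𝓝 (heatSol F' (x, t))) := by
  have ht : 0 ≤ t := (h0 0).trans (h1 0)
  have hc : ∀ k, Tendsto (fun n => coef (F n) k (τ n)) atTop (𝓝 (coef F' k t)) := by
    intro k
    have a := tendsto_coef_sub hm hF hb k h0 h1 hτ
    have b := hw (fun z => kern t k z.2 * cosk k z.1)
      (((continuous_kern t k).comp continuous_snd).mul ((continuous_cosk k).comp continuous_fst))
      t ht (by simpa only [mul_assoc] using hm.integrableOn_kern k t)
    simp only [mul_assoc] at b
    rw [← hF'.coef_eq_integral_slab k ht] at b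
    have := a.add b
    simp only [zero_add] at this
    refine this.congr fun n => ?_
    rw [(hF n).coef_eq_integral_slab k ht]; ring
  obtain ⟨B, hB⟩ := hm.bdd
  have hBm : ∀ G : ℝ × ℝ → ℝ, (∀ z, |G z| ≤ m z) → ∀ z : ℝ × ℝ, z.1 = 0 ∨ z.1 = 1 → |G z| ≤ B :=
    fun G hG z hz => (hG z).trans ((le_abs_self _).trans (hB z hz))
  have hA : ∀ G : ℝ × ℝ → ℝ, IsForcing G → (∀ z, |G z| ≤ m z) →
      ∫ z in strip t, G z ^ 2 ≤ ∫ z in strip t, m z ^ 2 := fun G hGf hG => by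
    refine integral_mono (hGf.sq t).integrable_sq (hm.sq t).integrable_sq fun z => ?_
    exact sq_le_sq.2 ((hG z).trans (le_abs_self _))
  rw [Metric.tendsto_atTop]
  intro ε hε
  obtain ⟨N, hN⟩ := exists_heatSum_approx t (∫ z in strip t, m z ^ 2) B
    (show (0 : ℝ) < ε / 4 by linarith)
  have hs : Tendsto (fun n => heatSum (F n) N (x, τ n)) atTop (𝓝 (heatSum F' N (x, t))) :=
    tendsto_finsetSum _ fun k _ => ((hc k).const_mul _).mul_const _
  rw [Metric.tendsto_atTop] at hs
  obtain ⟨n0, hn0⟩ := hs (ε / 4) (by linarith)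
  refine ⟨n0, fun n hn => ?_⟩
  have b1 := hN _ (hF n) (hBm _ (hb n)) (hA _ (hF n) (hb n)) (x, τ n) (h1 n)
  have b2 := hN _ hF' (hBm _ hb') (hA _ hF' hb') (x, t) le_rfl
  have b3 := hn0 n hn
  rw [Real.dist_eq] at b3 ⊢
  rw [abs_le] at b1 b2
  rw [abs_lt] at b3 ⊢
  constructor <;> linarith [b1.1, b1.2, b2.1, b2.2, b3.1, b3.2]

end WeakLimit


/-! ### Penalized equation: delay and passage to the limit -/

/-- A version of `exists_subseq_weak` for `[0,1]`-valued functions. -/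
theorem exists_subseq_weak_unit {X : Type*} [MeasurableSpace X]
    [MeasurableSpace.CountablyGenerated X] (μ : Measure X) [SigmaFinite μ] (θ : ℕ → X → ℝ)
    (hm : ∀ n, Measurable (θ n)) (hb : ∀ n z, θ n z ∈ Icc (0 : ℝ) 1) :
    ∃ (θ' : X → ℝ) (ns : ℕ → ℕ), Measurable θ' ∧ (∀ z, θ' z ∈ Icc (0 : ℝ) 1) ∧ StrictMono ns ∧
      ∀ G : X → ℝ, Integrable G μ →
        Tendsto (fun n => ∫ z, θ (ns n) z * G z ∂μ) atTop (𝓝 (∫ z, θ' z * G z ∂μ)) := by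
  obtain ⟨ϑ, ns, h1, h2, h3, h4⟩ := exists_subseq_weak μ (fun n z => 2 * θ n z - 1)
    (fun n => ((hm n).const_mul 2).sub_const 1) (fun n z => by
      obtain ⟨a, b⟩ := hb n z
      rw [abs_le]; constructor <;> linarith)
  refine ⟨fun z => (1 + ϑ z) / 2, ns, (h1.const_add 1).div_const 2, fun z => ?_, h3,
    fun G hG => ?_⟩
  · obtain ⟨a, b⟩ := abs_le.1 (h2 z)
    constructor <;> linarith
  · have key : ∀ q : X → ℝ, Measurable q → (∀ z, |q z| ≤ 1) →
        ∫ z, (1 + q z) / 2 * G z ∂μ = (∫ z, G z ∂μ) / 2 + (∫ z, q z * G z ∂μ) / 2 := by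
      intro q hq hq1
      have i1 : Integrable (fun z => G z / 2) μ := hG.div_const 2
      have i2 : Integrable (fun z => q z * G z / 2) μ :=
        (hG.bdd_mul hq.aestronglyMeasurable (c := 1) (Eventually.of_forall hq1)).div_const 2
      rw [← integral_div, ← integral_div, ← integral_add i1 i2]
      congr 1; funext z; ring
    rw [key ϑ h1 h2]
    refine (((h4 G hG).div_const 2).const_add ((∫ z, G z ∂μ) / 2)).congr fun n => ?_
    rw [← key _ (((hm (ns n)).const_mul 2).sub_const 1) (fun z => by
      obtain ⟨a, b⟩ := hb (ns n) z
      rw [abs_le]; constructor <;> linarith)]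
    congr 1; funext z; ring

theorem tendsto_setIntegral_of_weak {X : Type*} [MeasurableSpace X] {μ : Measure X}
    {θ : ℕ → X → ℝ} {θ' : X → ℝ}
    (hw : ∀ G : X → ℝ, Integrable G μ →
        Tendsto (fun n => ∫ z, θ n z * G z ∂μ) atTop (𝓝 (∫ z, θ' z * G z ∂μ)))
    {s : Set X} (hs : MeasurableSet s) {G : X → ℝ} (hG : IntegrableOn G s μ) :
    Tendsto (fun n => ∫ z in s, θ n z * G z ∂μ) atTop (𝓝 (∫ z in s, θ' z * G z ∂μ)) := by
  have h := hw _ (hG.integrable_indicator hs)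
  have key : ∀ q : X → ℝ, ∫ z, q z * s.indicator G z ∂μ = ∫ z in s, q z * G z ∂μ := by
    intro q
    rw [← integral_indicator hs]
    congr 1; funext z
    by_cases hz : z ∈ s <;> simp [hz]
  simpa only [key] using h

/-- An obstacle together with the measure representing its second derivative, boundary fluxes
included. -/
structure IsObstacle (K κ : ℝ → ℝ) : Prop where
  continuous : Continuous K
  measurable : Measurable κ
  memLp : MemLp κ 2 (volume.restrict (Icc (0 : ℝ) 1))
  weak : ∀ φ, IsTest φ →
    ∫ x in Icc (0 : ℝ) 1, K x * iteratedDeriv 2 φ x = ∫ x, φ x * κ x ∂rho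

/-- A nonlinear drift, dominated by a forcing term. -/
structure IsDrift (g : ℝ × ℝ → ℝ → ℝ) (m : ℝ × ℝ → ℝ) : Prop where
  measurable : Measurable fun p : (ℝ × ℝ) × ℝ => g p.1 p.2
  continuous : ∀ z, Continuous (g z)
  abs_le : ∀ z y, |g z y| ≤ m z
  measurable_bound : Measurable m
  isForcing : IsForcing m

/-- The maximal reflection rate at an obstacle with curvature `κ`. -/
noncomputable def load (κ : ℝ → ℝ) (m : ℝ × ℝ → ℝ) (z : ℝ × ℝ) : ℝ := max 0 (-κ z.1) + m z

/-- The penalized drift. -/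
noncomputable def penForce (g : ℝ × ℝ → ℝ → ℝ) (L U : ℝ → ℝ) (a b : ℝ × ℝ → ℝ) (y : ℝ × ℝ → ℝ)
    (z : ℝ × ℝ) : ℝ :=
  g z (y z) + (if y z < L z.1 then 1 else 0) * a z - (if U z.1 < y z then 1 else 0) * b z

/-- A function delayed in time. -/
def delay (δ : ℝ) (u : ℝ × ℝ → ℝ) (z : ℝ × ℝ) : ℝ := u (z.1, max 0 (z.2 - δ))

theorem continuous_delay (δ : ℝ) {u : ℝ × ℝ → ℝ} (hu : Continuous u) : Continuous (delay δ u) := by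
  unfold delay; fun_prop

theorem isForcing_load {κ : ℝ → ℝ} {m : ℝ × ℝ → ℝ} (hκ : Measurable κ)
    (h2 : MemLp κ 2 (volume.restrict (Icc (0 : ℝ) 1))) (hm : IsForcing m) :
    IsForcing (load κ m) := by
  have h3 : IsForcing fun z => |κ z.1| :=
    isForcing_fst (κ := fun x => |κ x|) (by measurability) h2.abs
  refine IsForcing.add (IsForcing.of_abs_le h3 (by fun_prop) fun z => ?_) hm
  rw [abs_of_nonneg (le_max_left _ _)]
  exact max_le (abs_nonneg _) (neg_le_abs _)

theorem measurable_load {κ : ℝ → ℝ} {m : ℝ × ℝ → ℝ} (hκ : Measurable κ) (hm : Measurable m) :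
    Measurable (load κ m) := by unfold load; fun_prop

section Penalized
variable {g : ℝ × ℝ → ℝ → ℝ} {L U : ℝ → ℝ} {m a b : ℝ × ℝ → ℝ}

theorem measurable_penForce (hg : IsDrift g m) (hL : Continuous L) (hU : Continuous U)
    (ha : Measurable a) (hb : Measurable b) {y : ℝ × ℝ → ℝ} (hy : Measurable y) :
    Measurable (penForce g L U a b y) := by
  unfold penForce
  have h1 : Measurable fun z => g z (y z) := hg.measurable.comp (measurable_id.prodMk hy)
  have h2 : Measurable fun z : ℝ × ℝ => (if y z < L z.1 then (1 : ℝ) else 0) :=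
    Measurable.ite (measurableSet_lt hy (hL.measurable.comp measurable_fst)) measurable_const
      measurable_const
  have h3 : Measurable fun z : ℝ × ℝ => (if U z.1 < y z then (1 : ℝ) else 0) :=
    Measurable.ite (measurableSet_lt (hU.measurable.comp measurable_fst) hy) measurable_const
      measurable_const
  exact (h1.add (h2.mul ha)).sub (h3.mul hb)

theorem abs_penForce_le (hg : IsDrift g m) (ha : ∀ z, 0 ≤ a z) (hb : ∀ z, 0 ≤ b z)
    (y : ℝ × ℝ → ℝ) (z : ℝ × ℝ) : |penForce g L U a b y z| ≤ m z + a z + b z := by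
  have h1 := abs_le.1 (hg.abs_le z (y z))
  have h2 := ha z
  have h3 := hb z
  unfold penForce
  rw [abs_le]
  split_ifs <;> constructor <;> linarith

/-- The forcing at time t sees the profile only up to time max(0, t − δ), so each application of the
solution map extends the validity of the equation by one step of length δ. No continuity of the
penalty is used. -/
theorem exists_delayed (hg : IsDrift g m) (hL : Continuous L) (hU : Continuous U)
    (ha : Measurable a) (hb : Measurable b) (ha0 : ∀ z, 0 ≤ a z) (hb0 : ∀ z, 0 ≤ b z)
    (hfa : IsForcing a) (hfb : IsForcing b) {V : ℝ × ℝ → ℝ} (hV : Continuous V) {δ : ℝ}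
    (hδ : 0 < δ) (j : ℕ) :
    ∃ u : ℝ × ℝ → ℝ, Continuous u ∧ ∀ z : ℝ × ℝ, z.2 ≤ j * δ →
      u z = V z + heatSol (penForce g L U a b (delay δ u)) z := by
  have hF : ∀ u : ℝ × ℝ → ℝ, Continuous u → IsForcing (penForce g L U a b (delay δ u)) :=
    fun u hu => ((hg.isForcing.add hfa).add hfb).of_abs_le
      (measurable_penForce hg hL hU ha hb (continuous_delay δ hu).measurable)
      (abs_penForce_le hg ha0 hb0 _)
  induction j with
  | zero =>
    refine ⟨V, hV, fun z hz => ?_⟩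
    rw [heatSol_of_nonpos _ (by simpa using hz), add_zero]
  | succ j ih =>
    obtain ⟨u, hu, h⟩ := ih
    have hu' : Continuous fun z => V z + heatSol (penForce g L U a b (delay δ u)) z :=
      hV.add (hF u hu).continuous_heatSol
    refine ⟨_, hu', fun z hz => ?_⟩
    congr 1
    refine heatSol_congr (hF u hu) (hF _ hu') fun w _ hw => ?_
    have e : delay δ u w =
        delay δ (fun z => V z + heatSol (penForce g L U a b (delay δ u)) z) w := by
      refine h _ ?_
      push_cast at hz
      refine max_le (by positivity) ?_
      linarith
    simp only [penForce, e]

/-- The discontinuous switches need not converge pointwise, so they are replaced by weak-* limits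
θ₁, θ₂. These are identified only off the contact sets {u = L} and {u = U}, which is all that an
obstacle problem prescribes. -/
theorem exists_penalized_limit (hg : IsDrift g m) (hL : Continuous L) (hU : Continuous U)
    (ha : Measurable a) (hb : Measurable b) (ha0 : ∀ z, 0 ≤ a z) (hb0 : ∀ z, 0 ≤ b z)
    (hfa : IsForcing a) (hfb : IsForcing b) {V : ℝ × ℝ → ℝ} (hV : Continuous V) :
    ∃ (u F θ₁ θ₂ : ℝ × ℝ → ℝ), Continuous u ∧ IsForcing F ∧ (∀ z, u z = V z + heatSol F z) ∧
      Measurable θ₁ ∧ Measurable θ₂ ∧ (∀ z, θ₁ z ∈ Icc (0 : ℝ) 1) ∧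
      (∀ z, θ₂ z ∈ Icc (0 : ℝ) 1) ∧
      ∀ᵐ z ∂Lam, F z = g z (u z) + θ₁ z * a z - θ₂ z * b z ∧
        (L z.1 < u z → θ₁ z = 0) ∧ (u z < L z.1 → θ₁ z = 1) ∧
        (u z < U z.1 → θ₂ z = 0) ∧ (U z.1 < u z → θ₂ z = 1) := by
  set δ : ℕ → ℝ := fun n => 1 / ((n : ℝ) + 1) with hδ
  have hδ0 : ∀ n, 0 < δ n := fun n => by positivity
  have hm0 : ∀ z, 0 ≤ m z := fun z => (abs_nonneg _).trans (hg.abs_le z 0)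
  -- With steps of length 1/(n + 1), taking n(n + 1) of them reaches time n, so every fixed time is
  -- eventually covered.
  choose w hwc hw using fun n : ℕ =>
    exists_delayed hg hL hU ha hb ha0 hb0 hfa hfb hV (hδ0 n) (n * (n + 1))
  have hw' : ∀ (n : ℕ) (z : ℝ × ℝ), z.2 ≤ n →
      w n z = V z + heatSol (penForce g L U a b (delay (δ n) (w n))) z := fun n z hz => by
    refine hw n z (hz.trans (le_of_eq ?_))
    simp only [hδ]; push_cast; field_simp
  set y : ℕ → ℝ × ℝ → ℝ := fun n => delay (δ n) (w n) with hy
  have hyc : ∀ n, Continuous (y n) := fun n => continuous_delay _ (hwc n)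
  -- Dividing by m + 1, which is positive even where m = 0, puts the drift in [−1,1] so that weak-*
  -- compactness applies to it too.
  set t0 : ℕ → ℝ × ℝ → ℝ := fun n z => g z (y n z) / (m z + 1) with ht0
  set t1 : ℕ → ℝ × ℝ → ℝ := fun n z => if y n z < L z.1 then 1 else 0 with ht1
  set t2 : ℕ → ℝ × ℝ → ℝ := fun n z => if U z.1 < y n z then 1 else 0 with ht2
  have hgm : ∀ q : ℝ × ℝ → ℝ, Continuous q → Measurable fun z => g z (q z) / (m z + 1) :=
    fun q hq => (hg.measurable.comp (measurable_id.prodMk hq.measurable)).div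
      (hg.measurable_bound.add_const 1)
  have hgb : ∀ (q : ℝ × ℝ → ℝ) z, |g z (q z) / (m z + 1)| ≤ 1 := fun q z => by
    have := hm0 z
    rw [abs_div, abs_of_pos (show 0 < m z + 1 by linarith), div_le_one (by linarith)]
    linarith [hg.abs_le z (q z)]
  have m0 : ∀ n, Measurable (t0 n) := fun n => hgm _ (hyc n)
  have m1 : ∀ n, Measurable (t1 n) := fun n =>
    Measurable.ite (measurableSet_lt (hyc n).measurable (hL.measurable.comp measurable_fst))
      measurable_const measurable_const
  have m2 : ∀ n, Measurable (t2 n) := fun n =>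
    Measurable.ite (measurableSet_lt (hU.measurable.comp measurable_fst) (hyc n).measurable)
      measurable_const measurable_const
  have b1 : ∀ n z, t1 n z ∈ Icc (0 : ℝ) 1 := fun n z => by
    simp only [ht1]; split_ifs <;> simp
  have b2 : ∀ n z, t2 n z ∈ Icc (0 : ℝ) 1 := fun n z => by
    simp only [ht2]; split_ifs <;> simp
  obtain ⟨θ₀, n0, θm0, θb0, hn0, W0⟩ := exists_subseq_weak Lam t0 m0 (fun n z => hgb _ z)
  obtain ⟨θ₁, n1, θm1, θb1, hn1, W1⟩ := exists_subseq_weak_unit Lam (fun n => t1 (n0 n))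
    (fun n => m1 _) (fun n z => b1 _ z)
  obtain ⟨θ₂, n2, θm2, θb2, hn2, W2⟩ := exists_subseq_weak_unit Lam (fun n => t2 (n0 (n1 n)))
    (fun n => m2 _) (fun n z => b2 _ z)
  set ns : ℕ → ℕ := fun n => n0 (n1 (n2 n)) with hns
  have hnsm : StrictMono ns := hn0.comp (hn1.comp hn2)
  have W0' : ∀ G : ℝ × ℝ → ℝ, Integrable G Lam →
      Tendsto (fun n => ∫ z, t0 (ns n) z * G z ∂Lam) atTop (𝓝 (∫ z, θ₀ z * G z ∂Lam)) :=
    fun G hG => (W0 G hG).comp (hn1.comp hn2).tendsto_atTop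
  have W1' : ∀ G : ℝ × ℝ → ℝ, Integrable G Lam →
      Tendsto (fun n => ∫ z, t1 (ns n) z * G z ∂Lam) atTop (𝓝 (∫ z, θ₁ z * G z ∂Lam)) :=
    fun G hG => (W1 G hG).comp hn2.tendsto_atTop
  have W2' : ∀ G : ℝ × ℝ → ℝ, Integrable G Lam →
      Tendsto (fun n => ∫ z, t2 (ns n) z * G z ∂Lam) atTop (𝓝 (∫ z, θ₂ z * G z ∂Lam)) := W2
  set F' : ℝ × ℝ → ℝ := fun z => θ₀ z * (m z + 1) + θ₁ z * a z - θ₂ z * b z with hF'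
  set M : ℝ × ℝ → ℝ := fun z => (m z + 1) + a z + b z with hM
  have hMf : IsForcing M := ((hg.isForcing.add (isForcing_const 1)).add hfa).add hfb
  have hmul : ∀ q c : ℝ, |q| ≤ 1 → 0 ≤ c → |q * c| ≤ c := fun q c hq hc => by
    rw [abs_mul, abs_of_nonneg hc]; exact mul_le_of_le_one_left hc hq
  have hunit : ∀ q : ℝ, q ∈ Icc (0 : ℝ) 1 → |q| ≤ 1 := fun q hq => by
    rw [abs_of_nonneg hq.1]; exact hq.2
  have hF'b : ∀ z, |F' z| ≤ M z := fun z => by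
    have e0 := abs_le.1 (hmul _ _ (θb0 z) (show 0 ≤ m z + 1 by linarith [hm0 z]))
    have e1 := abs_le.1 (hmul _ _ (hunit _ (θb1 z)) (ha0 z))
    have e2 := abs_le.1 (hmul _ _ (hunit _ (θb2 z)) (hb0 z))
    simp only [hF', hM]
    rw [abs_le]; constructor <;> linarith [e0.1, e0.2, e1.1, e1.2, e2.1, e2.2]
  have hF'm : Measurable F' :=
    ((θm0.mul (hg.measurable_bound.add_const 1)).add (θm1.mul ha)).sub (θm2.mul hb)
  have hF'f : IsForcing F' := hMf.of_abs_le hF'm hF'b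
  set F : ℕ → ℝ × ℝ → ℝ := fun n => penForce g L U a b (y (ns n)) with hF
  have hFb : ∀ n z, |F n z| ≤ M z := fun n z =>
    (abs_penForce_le hg ha0 hb0 _ z).trans (by simp only [hM]; linarith)
  have hFf : ∀ n, IsForcing (F n) := fun n =>
    hMf.of_abs_le (measurable_penForce hg hL hU ha hb (hyc _).measurable) (hFb n)
  have hweak : ∀ ψ : ℝ × ℝ → ℝ, Continuous ψ → ∀ t, 0 ≤ t →
      IntegrableOn (fun z => ψ z * M z) (slab 0 t) Lam →
      Tendsto (fun n => ∫ z in slab 0 t, ψ z * F n z ∂Lam) atTop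
        (𝓝 (∫ z in slab 0 t, ψ z * F' z ∂Lam)) := by
    intro ψ hψ t ht hI
    have hS := measurableSet_univ_slab 0 t
    have hle : ∀ c : ℝ × ℝ → ℝ, Measurable c → (∀ z, 0 ≤ c z) → (∀ z, c z ≤ M z) →
        IntegrableOn (fun z => ψ z * c z) (slab 0 t) Lam := fun c hc hc0 hcM => by
      refine Integrable.mono hI (hψ.measurable.mul hc).aestronglyMeasurable
        (Eventually.of_forall fun z => ?_)
      rw [norm_mul, norm_mul, Real.norm_of_nonneg (hc0 z),
        Real.norm_of_nonneg ((hc0 z).trans (hcM z))]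
      exact mul_le_mul_of_nonneg_left (hcM z) (norm_nonneg _)
    have I0 := hle (fun z => m z + 1) (hg.measurable_bound.add_const 1)
      (fun z => by linarith [hm0 z]) (fun z => by simp only [hM]; linarith [ha0 z, hb0 z])
    have I1 := hle a ha ha0 (fun z => by simp only [hM]; linarith [hm0 z, hb0 z])
    have I2 := hle b hb hb0 (fun z => by simp only [hM]; linarith [hm0 z, ha0 z])
    have T0 := tendsto_setIntegral_of_weak W0' hS I0
    have T1 := tendsto_setIntegral_of_weak W1' hS I1
    have T2 := tendsto_setIntegral_of_weak W2' hS I2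
    have bI : ∀ (q c : ℝ × ℝ → ℝ), Measurable q → (∀ z, |q z| ≤ 1) →
        IntegrableOn c (slab 0 t) Lam → Integrable (fun z => q z * c z) (Lam.restrict (slab 0 t)) :=
      fun q c hq hq1 hc => Integrable.bdd_mul (c := 1) hc hq.aestronglyMeasurable
        (Eventually.of_forall hq1)
    have key : ∀ q0 q1 q2 : ℝ × ℝ → ℝ, Measurable q0 → Measurable q1 → Measurable q2 →
        (∀ z, |q0 z| ≤ 1) → (∀ z, |q1 z| ≤ 1) → (∀ z, |q2 z| ≤ 1) →
        (∫ z in slab 0 t, q0 z * (ψ z * (m z + 1)) ∂Lam) +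
          (∫ z in slab 0 t, q1 z * (ψ z * a z) ∂Lam) -
          (∫ z in slab 0 t, q2 z * (ψ z * b z) ∂Lam) =
        ∫ z in slab 0 t, ψ z * (q0 z * (m z + 1) + q1 z * a z - q2 z * b z) ∂Lam := by
      intro q0 q1 q2 a0 a1 a2 c0 c1 c2
      have J0 := bI _ _ a0 c0 I0
      have J1 := bI _ _ a1 c1 I1
      have J2 := bI _ _ a2 c2 I2
      have J01 : Integrable (fun z => q0 z * (ψ z * (m z + 1)) + q1 z * (ψ z * a z))
        (Lam.restrict (slab 0 t)) := J0.add J1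
      rw [← integral_add J0 J1, ← integral_sub J01 J2]
      congr 1; funext z; ring
    have T := (T0.add T1).sub T2
    rw [key _ _ _ θm0 θm1 θm2 θb0 (fun z => hunit _ (θb1 z)) (fun z => hunit _ (θb2 z))] at T
    refine T.congr fun n => ?_
    rw [key _ _ _ (m0 _) (m1 _) (m2 _) (fun z => hgb _ z) (fun z => hunit _ (b1 _ z))
      (fun z => hunit _ (b2 _ z))]
    congr 1; funext z
    simp only [hF, penForce, ht0, ht1, ht2]
    rw [div_mul_cancel₀ _ (by linarith [hm0 z])]
  set u : ℝ × ℝ → ℝ := fun z => V z + heatSol F' z with hu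
  have huc : Continuous u := hV.add hF'f.continuous_heatSol
  have hδt : Tendsto δ atTop (𝓝 0) := tendsto_one_div_add_atTop_nhds_zero_nat
  -- The delayed profiles converge pointwise to u, although their forcings converge only weakly;
  -- this is what identifies the weak limits below.
  have hyt : ∀ z : ℝ × ℝ, 0 ≤ z.2 → Tendsto (fun n => y (ns n) z) atTop (𝓝 (u z)) := by
    rintro ⟨x, t⟩ ht
    simp only at ht
    have hτ : Tendsto (fun n => max 0 (t - δ (ns n))) atTop (𝓝 t) := by
      have h1 := (hδt.comp hnsm.tendsto_atTop).const_sub t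
      rw [sub_zero] at h1
      have h2 := (continuous_const.max continuous_id : Continuous fun r : ℝ => max 0 r).tendsto t
      rw [max_eq_right ht] at h2
      exact h2.comp h1
    have h1 := tendsto_heatSol hMf hFf hFb hF'f hF'b hweak x (t := t)
      (τ := fun n => max 0 (t - δ (ns n))) (fun n => le_max_left _ _)
      (fun n => max_le ht (by linarith [hδ0 (ns n)])) hτ
    have h2 : Tendsto (fun n => V (x, max 0 (t - δ (ns n)))) atTop (𝓝 (V (x, t))) :=
      ((hV.comp (Continuous.prodMk_right x)).tendsto t).comp hτ
    refine (h2.add h1).congr' ?_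
    obtain ⟨N, hN⟩ := exists_nat_ge t
    filter_upwards [eventually_ge_atTop N] with n hn
    rw [hy]
    simp only [delay]
    rw [hw' (ns n) _ ?_]
    refine max_le (Nat.cast_nonneg _) ?_
    have : (N : ℝ) ≤ ns n := Nat.cast_le.2 (hn.trans (hnsm.id_le n))
    linarith [hδ0 (ns n)]
  refine ⟨u, F', θ₁, θ₂, huc, hF'f, fun z => rfl, θm1, θm2, θb1, θb2, ?_⟩
  have hpos : ∀ᵐ z ∂Lam, 0 ≤ z.2 := ae_Lam_snd_pos.mono fun z hz => hz.le
  have hLm : Measurable fun z : ℝ × ℝ => L z.1 := hL.measurable.comp measurable_fst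
  have hUm : Measurable fun z : ℝ × ℝ => U z.1 := hU.measurable.comp measurable_fst
  have A0 := ae_eq_of_weak_of_pointwise (fun n => m0 (ns n)) (fun n z => hgb _ z) θm0 θb0
    (hgm u huc) (hgb u) W0' MeasurableSet.univ (hpos.mono fun z hz _ => by
      exact ((hg.continuous z).tendsto _ |>.comp (hyt z hz)).div_const _)
  -- Where u is strictly on one side of a wall, the convergent profiles are eventually on that side
  -- and the switch is eventually constant, so its weak limit is that constant.
  have cst : ∀ c : ℝ, |c| ≤ 1 → ∀ (t : ℕ → ℝ × ℝ → ℝ) (θ : ℝ × ℝ → ℝ), (∀ n, Measurable (t n)) →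
      (∀ n z, t n z ∈ Icc (0 : ℝ) 1) → Measurable θ → (∀ z, θ z ∈ Icc (0 : ℝ) 1) →
      (∀ G : ℝ × ℝ → ℝ, Integrable G Lam →
        Tendsto (fun n => ∫ z, t (ns n) z * G z ∂Lam) atTop (𝓝 (∫ z, θ z * G z ∂Lam))) →
      ∀ E, MeasurableSet E → (∀ z, z ∈ E → 0 ≤ z.2 → ∀ᶠ n in atTop, t (ns n) z = c) →
      ∀ᵐ z ∂Lam, z ∈ E → θ z = c := by
    intro c hc t θ htm htb hθm hθb W E hE hev
    refine ae_eq_of_weak_of_pointwise (θ'' := fun _ => c) (fun n => htm (ns n))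
      (fun n z => hunit _ (htb _ z)) hθm (fun z => hunit _ (hθb z)) measurable_const
      (fun _ => hc) W hE (hpos.mono fun z hz hzE => ?_)
    exact tendsto_const_nhds.congr' ((hev z hzE hz).mono fun n hn => hn.symm)
  have A1 := cst 0 (by simp) t1 θ₁ m1 b1 θm1 θb1 W1' {z | L z.1 < u z}
    (measurableSet_lt hLm huc.measurable) (fun z hz hz0 =>
      ((hyt z hz0).eventually (lt_mem_nhds hz)).mono fun n hn => if_neg (not_lt.2 hn.le))
  have A2 := cst 1 (by simp) t1 θ₁ m1 b1 θm1 θb1 W1' {z | u z < L z.1}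
    (measurableSet_lt huc.measurable hLm) (fun z hz hz0 =>
      ((hyt z hz0).eventually (gt_mem_nhds hz)).mono fun n hn => if_pos hn)
  have A3 := cst 0 (by simp) t2 θ₂ m2 b2 θm2 θb2 W2' {z | u z < U z.1}
    (measurableSet_lt huc.measurable hUm) (fun z hz hz0 =>
      ((hyt z hz0).eventually (gt_mem_nhds hz)).mono fun n hn => if_neg (not_lt.2 hn.le))
  have A4 := cst 1 (by simp) t2 θ₂ m2 b2 θm2 θb2 W2' {z | U z.1 < u z}
    (measurableSet_lt hUm huc.measurable) (fun z hz hz0 =>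
      ((hyt z hz0).eventually (lt_mem_nhds hz)).mono fun n hn => if_pos hn)
  filter_upwards [A0, A1, A2, A3, A4] with z c0 c1 c2 c3 c4
  refine ⟨?_, c1, c2, c3, c4⟩
  simp only [hF']
  rw [c0 (mem_univ z), div_mul_cancel₀ _ (by linarith [hm0 z])]

end Penalized


/-! ### Obstacle problem via the maximum principle -/

theorem IsForcing.sub {F G : ℝ × ℝ → ℝ} (hF : IsForcing F) (hG : IsForcing G) :
    IsForcing fun z => F z - G z := by
  simpa [sub_eq_add_neg] using hF.add (hG.const_mul (-1))

/-- `w` solves the Neumann heat equation with forcing `R` weakly. -/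
structure IsWeakHeat (w R : ℝ × ℝ → ℝ) : Prop where
  continuous : Continuous w
  isForcing : IsForcing R
  weak : ∀ φ, IsTest φ → ∀ s t, 0 ≤ s → s ≤ t →
    (∫ y in Icc (0 : ℝ) 1, w (y, t) * φ y) - (∫ y in Icc (0 : ℝ) 1, w (y, s) * φ y) =
      (∫ z in Icc (0 : ℝ) 1 ×ˢ Ioc s t, w z * iteratedDeriv 2 φ z.1) +
        ∫ z in slab s t, φ z.1 * R z ∂Lam

theorem integrableOn_slice {w : ℝ × ℝ → ℝ} (hw : Continuous w) {φ : ℝ → ℝ} (hφ : Continuous φ)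
    (t : ℝ) : IntegrableOn (fun y => w (y, t) * φ y) (Icc (0 : ℝ) 1) :=
  integrableOn_Icc_of_continuous (by fun_prop) 0 1

theorem integrableOn_mul_deriv2 {w : ℝ × ℝ → ℝ} (hw : Continuous w) {φ : ℝ → ℝ} (hφ : IsTest φ)
    (s t : ℝ) :
    IntegrableOn (fun z => w z * iteratedDeriv 2 φ z.1) (Icc (0 : ℝ) 1 ×ˢ Ioc s t) :=
  integrableOn_slab_of_continuous (hw.mul (hφ.continuous_deriv2.comp continuous_fst)) s t

theorem IsWeakHeat.sub {w R w' R' : ℝ × ℝ → ℝ} (h : IsWeakHeat w R) (h' : IsWeakHeat w' R') :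
    IsWeakHeat (fun z => w z - w' z) (fun z => R z - R' z) where
  continuous := h.continuous.sub h'.continuous
  isForcing := h.isForcing.sub h'.isForcing
  weak φ hφ s t hs hst := by
    have e1 := h.weak φ hφ s t hs hst
    have e2 := h'.weak φ hφ s t hs hst
    have c := hφ.continuous
    have a1 := integral_sub (integrableOn_slice h.continuous c t)
      (integrableOn_slice h'.continuous c t)
    have a2 := integral_sub (integrableOn_slice h.continuous c s)
      (integrableOn_slice h'.continuous c s)
    have a3 := integral_sub (integrableOn_mul_deriv2 h.continuous hφ s t)
      (integrableOn_mul_deriv2 h'.continuous hφ s t)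
    have a4 := integral_sub (h.isForcing.mul_continuous c hs t)
      (h'.isForcing.mul_continuous c hs t)
    simp only [sub_mul, mul_sub]
    rw [a1, a2, a3, a4]
    linarith

theorem IsHeatFlow.isWeakHeat {V : ℝ × ℝ → ℝ} (hV : IsHeatFlow V) :
    IsWeakHeat V (fun _ => 0) where
  continuous := hV.continuous
  isForcing := isForcing_const 0
  weak φ hφ s t hs hst := by
    rcases hst.eq_or_lt with rfl | h
    · simp [slab]
    · rw [hV.weak φ hφ s t hs h]; simp

theorem IsForcing.isWeakHeat {F : ℝ × ℝ → ℝ} (hF : IsForcing F) : IsWeakHeat (heatSol F) F where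
  continuous := hF.continuous_heatSol
  isForcing := hF
  weak _ hφ _ _ hs hst := hF.weak hφ hs hst

/-- A wall does not move, so the source −κ must balance its second derivative, boundary masses
included. -/
theorem IsObstacle.isWeakHeat {K κ : ℝ → ℝ} (hK : IsObstacle K κ) :
    IsWeakHeat (fun z => K z.1) (fun z => -κ z.1) where
  continuous := hK.continuous.comp continuous_fst
  isForcing := isForcing_fst (κ := fun x => -κ x) hK.measurable.neg hK.memLp.neg
  weak φ hφ s t hs hst := by
    rw [sub_self, Lam_restrict_slab hs, ← prod_restrict_slab,
      integral_fun_fst (fun x => K x * iteratedDeriv 2 φ x),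
      integral_fun_fst (fun x => φ x * -κ x), hK.weak φ hφ]
    simp only [mul_neg, integral_neg, smul_eq_mul]
    ring

/-- The maximum principle for forced solutions. -/
theorem IsWeakHeat.nonpos {w R : ℝ × ℝ → ℝ} (h : IsWeakHeat w R)
    (h0 : ∀ x ∈ Icc (0 : ℝ) 1, w (x, 0) ≤ 0) (hR : ∀ᵐ z ∂Lam, z ∈ Q → 0 < w z → R z ≤ 0) :
    ∀ z ∈ Q, w z ≤ 0 := by
  intro z hz
  refine le_of_subsolution (T := z.2) h.continuous.continuousOn h0 ?_ z ⟨hz.1, hz.2, le_rfl⟩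
  intro φ hφ hφ0 s t hs hst _ hpos
  rw [h.weak φ hφ s t hs hst.le]
  have : ∫ z in slab s t, φ z.1 * R z ∂Lam ≤ 0 := by
    refine integral_nonpos_of_ae ?_
    filter_upwards [ae_restrict_mem (measurableSet_univ_slab s t), ae_restrict_of_ae ae_Lam_fst_mem,
      ae_restrict_of_ae hR] with v hv hv1 hvR
    by_cases hφv : φ v.1 = 0
    · simp [hφv]
    · exact mul_nonpos_of_nonneg_of_nonpos (hφ0 _)
        (hvR ⟨hv1, hs.trans hv.2.1.le⟩ (hpos v.1 hv1 v.2 ⟨hv.2.1.le, hv.2.2⟩ hφv))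
  linarith

/-- The obstacle problem with reaction `g` and given continuous initial profile `V (·, 0)`; the
reflection densities are dominated by the loads of the obstacles. -/
theorem exists_reflected {g : ℝ × ℝ → ℝ → ℝ} {m : ℝ × ℝ → ℝ} (hg : IsDrift g m)
    {L U κ₁ κ₂ : ℝ → ℝ} (hL : IsObstacle L κ₁) (hU : IsObstacle U κ₂) (hLU : ∀ x, L x < U x)
    {V : ℝ × ℝ → ℝ} (hV : IsHeatFlow V) (hV1 : ∀ x ∈ Icc (0 : ℝ) 1, L x ≤ V (x, 0))
    (hV2 : ∀ x ∈ Icc (0 : ℝ) 1, V (x, 0) ≤ U x) :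
    ∃ (u p q : ℝ × ℝ → ℝ), Measurable p ∧ Measurable q ∧
      IsWeakHeat u (fun z => g z (u z) + p z - q z) ∧ (∀ x, u (x, 0) = V (x, 0)) ∧
      (∀ z ∈ Q, L z.1 ≤ u z) ∧ (∀ z ∈ Q, u z ≤ U z.1) ∧
      (∀ z, 0 ≤ p z ∧ p z ≤ load κ₁ m z) ∧ (∀ z, 0 ≤ q z ∧ q z ≤ load (fun x => -κ₂ x) m z) ∧
      (∀ᵐ z ∂Lam, L z.1 < u z → p z = 0) ∧ (∀ᵐ z ∂Lam, u z < U z.1 → q z = 0) := by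
  have hm0 : ∀ z, 0 ≤ m z := fun z => (abs_nonneg _).trans (hg.abs_le z 0)
  set a := load κ₁ m with ha
  set b := load (fun x => -κ₂ x) m with hb
  have ham : Measurable a := measurable_load hL.measurable hg.measurable_bound
  have hbm : Measurable b := measurable_load hU.measurable.neg hg.measurable_bound
  have ha0 : ∀ z, 0 ≤ a z := fun z => add_nonneg (le_max_left _ _) (hm0 z)
  have hb0 : ∀ z, 0 ≤ b z := fun z => add_nonneg (le_max_left _ _) (hm0 z)
  have haf : IsForcing a := isForcing_load hL.measurable hL.memLp hg.isForcing
  have hbf : IsForcing b :=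
    isForcing_load (κ := fun x => -κ₂ x) hU.measurable.neg hU.memLp.neg hg.isForcing
  obtain ⟨u, F, θ₁, θ₂, huc, hF, hu, θm1, θm2, θb1, θb2, hae⟩ :=
    exists_penalized_limit hg hL.continuous hU.continuous ham hbm ha0 hb0 haf hbf
      hV.continuous
  have huF : IsWeakHeat u F := by
    refine ⟨huc, hF, fun φ hφ s t hs hst => ?_⟩
    have e1 := hV.isWeakHeat.weak φ hφ s t hs hst
    have e2 := hF.weak hφ hs hst
    have c := hφ.continuous
    have a1 := integral_add (integrableOn_slice hV.continuous c t)
      (integrableOn_slice hF.continuous_heatSol c t)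
    have a2 := integral_add (integrableOn_slice hV.continuous c s)
      (integrableOn_slice hF.continuous_heatSol c s)
    have a3 := integral_add (integrableOn_mul_deriv2 hV.continuous hφ s t)
      (integrableOn_mul_deriv2 hF.continuous_heatSol hφ s t)
    simp only [mul_zero, integral_zero, add_zero] at e1
    simp only [hu, add_mul]
    rw [a1, a2, a3]
    linarith
  have hu0 : ∀ x, u (x, 0) = V (x, 0) := fun x => by
    rw [hu, heatSol_of_nonpos _ le_rfl, add_zero]
  -- Below L the lower switch is 1 and, as L < U, the upper one is 0. The source of u is then at
  -- least −m + max(0, −κ₁) + m ≥ −κ₁, the source of L. This is the reason for the form of `load`.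
  have low : ∀ z ∈ Q, L z.1 - u z ≤ 0 := by
    refine (hL.isWeakHeat.sub huF).nonpos (fun x hx => ?_) ?_
    · simp only [hu0]; linarith [hV1 x hx]
    · filter_upwards [hae] with z hz _ hzu
      obtain ⟨h1, h2, h3, h4, h5⟩ := hz
      have hlt : u z < L z.1 := by linarith
      rw [h1, h3 hlt, h4 (hlt.trans (hLU _))]
      have := (abs_le.1 (hg.abs_le z (u z))).1
      have h6 : -κ₁ z.1 ≤ max 0 (-κ₁ z.1) := le_max_right _ _
      simp only [ha, load]; linarith
  have upp : ∀ z ∈ Q, u z - U z.1 ≤ 0 := by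
    refine (huF.sub hU.isWeakHeat).nonpos (fun x hx => ?_) ?_
    · simp only [hu0]; linarith [hV2 x hx]
    · filter_upwards [hae] with z hz _ hzu
      obtain ⟨h1, h2, h3, h4, h5⟩ := hz
      have hlt : U z.1 < u z := by linarith
      rw [h1, h5 hlt, h2 ((hLU _).trans hlt)]
      have := (abs_le.1 (hg.abs_le z (u z))).2
      have h6 : - -κ₂ z.1 ≤ max 0 (- -κ₂ z.1) := le_max_right _ _
      simp only [hb, load]; linarith
  have hFm : Measurable fun z => g z (u z) + θ₁ z * a z - θ₂ z * b z :=
    ((hg.measurable.comp (measurable_id.prodMk huc.measurable)).add (θm1.mul ham)).sub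
      (θm2.mul hbm)
  have hp : ∀ z, 0 ≤ θ₁ z * a z ∧ θ₁ z * a z ≤ a z := fun z =>
    ⟨mul_nonneg (θb1 z).1 (ha0 z), mul_le_of_le_one_left (ha0 z) (θb1 z).2⟩
  have hq : ∀ z, 0 ≤ θ₂ z * b z ∧ θ₂ z * b z ≤ b z := fun z =>
    ⟨mul_nonneg (θb2 z).1 (hb0 z), mul_le_of_le_one_left (hb0 z) (θb2 z).2⟩
  refine ⟨u, fun z => θ₁ z * a z, fun z => θ₂ z * b z, θm1.mul ham, θm2.mul hbm,
    ⟨huc, ?_, fun φ hφ s t hs hst => ?_⟩, hu0, fun z hz => by linarith [low z hz],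
    fun z hz => by linarith [upp z hz], hp, hq, ?_, ?_⟩
  · refine ((hg.isForcing.add haf).add hbf).of_abs_le hFm fun z => ?_
    have h1 := abs_le.1 (hg.abs_le z (u z))
    have h2 := hp z
    have h3 := hq z
    rw [abs_le]
    constructor <;> linarith [h2.1, h2.2, h3.1, h3.2]
  · rw [huF.weak φ hφ s t hs hst]
    congr 1
    refine integral_congr_ae (ae_restrict_of_ae ?_)
    filter_upwards [hae] with z hz
    rw [hz.1]
  · filter_upwards [hae] with z hz h
    rw [hz.2.1 h, zero_mul]
  · filter_upwards [hae] with z hz h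
    rw [hz.2.2.2.1 h, zero_mul]


/-! ### Measurable modifications and the truncated reaction -/

theorem restrict_strip (t : ℝ) : (volume : Measure (ℝ × ℝ)).restrict (strip t) =
    (volume : Measure (ℝ × ℝ)).restrict (Icc (0 : ℝ) 1 ×ˢ Ioc 0 t) := by
  rw [strip, Measure.volume_eq_prod, ← Measure.prod_restrict, ← Measure.prod_restrict,
    restrict_Ioc_eq_restrict_Icc]

theorem Lam_restrict_strip (t : ℝ) : Lam.restrict (strip t) = Lam.restrict (slab 0 t) := by
  refine Measure.restrict_congr_set ?_
  filter_upwards [ae_Lam_fst_mem, ae_Lam_snd_pos] with z h1 h2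
  refine propext ⟨fun h => ⟨mem_univ _, h2, h.2.2⟩, fun h => ⟨h1, h2.le, h.2.2⟩⟩

theorem strip_mono {s t : ℝ} (h : s ≤ t) : strip s ⊆ strip t :=
  fun _ hz => ⟨hz.1, hz.2.1, hz.2.2.trans h⟩

theorem ae_Lam_mem_Q : ∀ᵐ z ∂Lam, z ∈ Q := by
  filter_upwards [ae_Lam_fst_mem, ae_Lam_snd_pos] with z h1 h2
  exact ⟨h1, h2.le⟩

theorem measurableSet_Q : MeasurableSet Q := measurableSet_Icc.prod measurableSet_Ici

theorem iUnion_strip : ⋃ n : ℕ, strip n = Q := by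
  ext z
  simp only [mem_iUnion]
  refine ⟨fun ⟨n, h⟩ => ⟨h.1, h.2.1⟩, fun h => ?_⟩
  obtain ⟨n, hn⟩ := exists_nat_ge z.2
  exact ⟨n, h.1, h.2, hn⟩

/-- A Carathéodory function has a jointly measurable modification. -/
theorem exists_measurable_modification {f : ℝ → ℝ → ℝ}
    (hm : ∀ y, AEMeasurable (fun x => f x y) (volume.restrict (Icc (0 : ℝ) 1)))
    (hc : ∀ x ∈ Icc (0 : ℝ) 1, Continuous (f x)) :
    ∃ E : Set ℝ, MeasurableSet E ∧ E ⊆ Icc 0 1 ∧ (∀ᵐ x ∂volume.restrict (Icc (0 : ℝ) 1), x ∈ E) ∧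
      Measurable fun p : ℝ × ℝ => E.indicator (fun x => f x p.2) p.1 := by
  -- Countably many rational values of y can be corrected on one common null set; continuity in y
  -- then gives all real values.
  have h1 : ∀ᵐ x ∂volume.restrict (Icc (0 : ℝ) 1),
      x ∈ Icc (0 : ℝ) 1 ∧ ∀ q : ℚ, f x q = (hm q).mk _ x :=
    (ae_restrict_mem measurableSet_Icc).and (ae_all_iff.2 fun q => (hm q).ae_eq_mk)
  obtain ⟨E, hEae, hEm, hE⟩ := h1.exists_measurable_mem
  refine ⟨E, hEm, fun x hx => (hE x hx).1, hEae, ?_⟩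
  have hcE : ∀ x, Continuous fun y => E.indicator (fun x => f x y) x := fun x => by
    by_cases hx : x ∈ E
    · simpa only [indicator_of_mem hx] using hc x (hE x hx).1
    · simpa only [indicator_of_notMem hx] using continuous_const
  have hq : ∀ q : ℚ, Measurable (E.indicator fun x => f x q) := fun q => by
    have e : (E.indicator fun x => f x q) = E.indicator ((hm q).mk _) :=
      indicator_congr fun x hx => (hE x hx).2 q
    rw [e]
    exact (hm q).measurable_mk.indicator hEm
  have hy : ∀ y : ℝ, Measurable (E.indicator fun x => f x y) := fun y => by
    obtain ⟨q, hqy⟩ : ∃ q : ℕ → ℚ, Tendsto (fun n => (q n : ℝ)) atTop (𝓝 y) := by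
      obtain ⟨v, hv, hvt⟩ := mem_closure_iff_seq_limit.1 (Rat.denseRange_cast (𝕜 := ℝ) y)
      choose q hq using hv
      exact ⟨q, by simpa only [hq] using hvt⟩
    refine measurable_of_tendsto_metrizable (fun n => hq (q n)) (tendsto_pi_nhds.2 fun x => ?_)
    exact ((hcE x).tendsto y).comp hqy
  have := measurable_uncurry_of_continuous_of_measurable
    (u := fun y x => E.indicator (fun x => f x y) x) hcE hy
  exact this.comp measurable_swap

/-- Everywhere defined, measurable modifications of the coefficients and of the control. -/
structure IsRegularized (f σ : ℝ → ℝ → ℝ) (hdot : ℝ × ℝ → ℝ) (f' σ' : ℝ → ℝ → ℝ)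
    (hd : ℝ × ℝ → ℝ) (M C : ℝ) : Prop where
  measurable_f : Measurable fun p : ℝ × ℝ => f' p.1 p.2
  measurable_σ : Measurable fun p : ℝ × ℝ => σ' p.1 p.2
  measurable_hd : Measurable hd
  bound_f : ∀ x y, |f' x y| ≤ M
  bound_σ : ∀ x y, |σ' x y| ≤ M
  lip_f : ∀ x y y', |f' x y - f' x y'| ≤ C * |y - y'|
  lip_σ : ∀ x y y', |σ' x y - σ' x y'| ≤ C * |y - y'|
  nonneg : 0 ≤ C
  memLp : ∀ T, MemLp hd 2 (volume.restrict (strip T))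
  ae_eq : ∀ᵐ z ∂(volume : Measure (ℝ × ℝ)).restrict Q,
    hd z = hdot z ∧ ∀ y, f' z.1 y = f z.1 y ∧ σ' z.1 y = σ z.1 y

/-- Off the good sets the coefficients are put equal to zero, which keeps the bound M and the
Lipschitz constant. The same M must be retained because the constants of the final estimates are
expressed through it. -/
theorem exists_isRegularized {f σ : ℝ → ℝ → ℝ} (hc : CoeffCondition f σ) {h hdot : ℝ × ℝ → ℝ}
    (hh : IsCameronMartin h hdot) {M : ℝ}
    (hM : ∀ x ∈ Icc (0 : ℝ) 1, ∀ y : ℝ, |f x y| ≤ M ∧ |σ x y| ≤ M) :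
    ∃ (f' σ' : ℝ → ℝ → ℝ) (hd : ℝ × ℝ → ℝ) (C : ℝ), IsRegularized f σ hdot f' σ' hd M C := by
  obtain ⟨C, hC, hL⟩ := hc.lipschitz
  have hM0 : 0 ≤ M := (abs_nonneg _).trans (hM 0 (by simp) 0).1
  have hLf : ∀ x ∈ Icc (0 : ℝ) 1, ∀ y y', |f x y - f x y'| ≤ C * |y - y'| := fun x hx y y' =>
    (le_add_of_nonneg_right (abs_nonneg _)).trans (hL x hx y y')
  have hLσ : ∀ x ∈ Icc (0 : ℝ) 1, ∀ y y', |σ x y - σ x y'| ≤ C * |y - y'| := fun x hx y y' =>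
    (le_add_of_nonneg_left (abs_nonneg _)).trans (hL x hx y y')
  have hcont : ∀ g : ℝ → ℝ, (∀ y y', |g y - g y'| ≤ C * |y - y'|) → Continuous g := fun g hg =>
    (LipschitzWith.of_dist_le_mul (K := ⟨C, hC.le⟩) hg).continuous
  obtain ⟨E, hEm, hEs, hEae, hEf⟩ := exists_measurable_modification hc.aemeasurable_f
    (fun x hx => hcont _ (hLf x hx))
  obtain ⟨D, hDm, hDs, hDae, hDσ⟩ := exists_measurable_modification hc.aemeasurable_σ
    (fun x hx => hcont _ (hLσ x hx))
  have hmem : AEMeasurable hdot ((volume : Measure (ℝ × ℝ)).restrict Q) := by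
    rw [← iUnion_strip, aemeasurable_iUnion_iff]
    intro n
    refine ((hh.memLp (n + 1) (by positivity)).aestronglyMeasurable.aemeasurable).mono_measure
      (Measure.restrict_mono (strip_mono (by simp)) le_rfl)
  have hstrip : ∀ T, strip T ⊆ Q := fun T z hz => ⟨hz.1, hz.2.1⟩
  have hmk : ∀ T, hmem.mk hdot =ᵐ[volume.restrict (strip T)] hdot := fun T =>
    ae_restrict_of_ae_restrict_of_subset (hstrip T) (hmem.ae_eq_mk.symm)
  have hfst : ∀ E : Set ℝ, (∀ᵐ x ∂volume.restrict (Icc (0 : ℝ) 1), x ∈ E) →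
      ∀ᵐ z ∂(volume : Measure (ℝ × ℝ)).restrict Q, z.1 ∈ E := fun E hE => by
    rw [Q, Measure.volume_eq_prod, ← Measure.prod_restrict]
    exact Measure.quasiMeasurePreserving_fst.ae hE
  refine ⟨fun x y => E.indicator (fun x => f x y) x, fun x y => D.indicator (fun x => σ x y) x,
    hmem.mk hdot, C, hEf, hDσ, hmem.measurable_mk, fun x y => ?_, fun x y => ?_, fun x y y' => ?_,
    fun x y y' => ?_, hC.le, fun T => ?_, ?_⟩
  · by_cases hx : x ∈ E
    · rw [indicator_of_mem hx]; exact (hM x (hEs hx) y).1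
    · rw [indicator_of_notMem hx, abs_zero]; exact hM0
  · by_cases hx : x ∈ D
    · rw [indicator_of_mem hx]; exact (hM x (hDs hx) y).2
    · rw [indicator_of_notMem hx, abs_zero]; exact hM0
  · by_cases hx : x ∈ E
    · simp only [indicator_of_mem hx]; exact hLf x (hEs hx) y y'
    · simp only [indicator_of_notMem hx, sub_zero, abs_zero]; positivity
  · by_cases hx : x ∈ D
    · simp only [indicator_of_mem hx]; exact hLσ x (hDs hx) y y'
    · simp only [indicator_of_notMem hx, sub_zero, abs_zero]; positivity
  · rcases le_or_gt T 0 with hT | hT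
    · refine ((hh.memLp 1 one_pos).mono_measure
        (Measure.restrict_mono (strip_mono (hT.trans zero_le_one)) le_rfl)).ae_eq (hmk T).symm
    · exact (hh.memLp T hT).ae_eq (hmk T).symm
  · filter_upwards [hmem.ae_eq_mk, hfst E hEae, hfst D hDae] with z h1 h2 h3
    exact ⟨h1.symm, fun y => ⟨indicator_of_mem h2 _, indicator_of_mem h3 _⟩⟩

/-- The reaction term, set to zero on the lateral boundary, with the linear part truncated. -/
noncomputable def reaction (α : ℝ) (L U : ℝ → ℝ) (f' σ' : ℝ → ℝ → ℝ) (hd : ℝ × ℝ → ℝ)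
    (z : ℝ × ℝ) (y : ℝ) : ℝ :=
  (Ioo (0 : ℝ) 1).indicator
    (fun x => f' x y + σ' x y * hd z - α * max (L x) (min (U x) y)) z.1

/-- A bound for the reaction term. -/
noncomputable def reactionBound (α M B : ℝ) (hd : ℝ × ℝ → ℝ) (z : ℝ × ℝ) : ℝ :=
  (Ioo (0 : ℝ) 1).indicator (fun _ => M + M * |hd z| + |α| * B) z.1

section Reaction
variable {α M C B : ℝ} {L U : ℝ → ℝ} {f σ f' σ' : ℝ → ℝ → ℝ} {hdot hd : ℝ × ℝ → ℝ}

theorem measurable_indicator_fst {X : Type*} [MeasurableSpace X] {p : X → ℝ} (hp : Measurable p)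
    {g : X → ℝ → ℝ} (hg : Measurable fun z => g z (p z)) :
    Measurable fun z => (Ioo (0 : ℝ) 1).indicator (g z) (p z) := by
  have : (fun z => (Ioo (0 : ℝ) 1).indicator (g z) (p z)) =
      (p ⁻¹' Ioo (0 : ℝ) 1).indicator fun z => g z (p z) := by
    funext z
    by_cases h : p z ∈ Ioo (0 : ℝ) 1
    · rw [indicator_of_mem h, indicator_of_mem (show z ∈ p ⁻¹' Ioo (0 : ℝ) 1 from h)]
    · rw [indicator_of_notMem h, indicator_of_notMem (show z ∉ p ⁻¹' Ioo (0 : ℝ) 1 from h)]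
  rw [this]
  exact hg.indicator (hp measurableSet_Ioo)

theorem reactionBound_bdry {z : ℝ × ℝ} (hz : z.1 = 0 ∨ z.1 = 1) :
    reactionBound α M B hd z = 0 := by
  refine indicator_of_notMem (fun h => ?_) _
  rcases hz with hz | hz <;> rw [hz] at h
  · exact lt_irrefl _ h.1
  · exact lt_irrefl _ h.2

/-- Truncation between the walls bounds the linear term by |α|B for arbitrary arguments. The cut-off
to (0,1) removes the reaction from the lateral boundary, where hd is uncontrolled and where the
equation has no reaction source. -/
theorem IsRegularized.isDrift (hr : IsRegularized f σ hdot f' σ' hd M C) (hL : Continuous L)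
    (hU : Continuous U) (hLB : ∀ x, |L x| ≤ B) (hUB : ∀ x, |U x| ≤ B) :
    IsDrift (reaction α L U f' σ' hd) (reactionBound α M B hd) where
  measurable := by
    have m1 : Measurable fun p : (ℝ × ℝ) × ℝ => (p.1.1, p.2) := by fun_prop
    refine measurable_indicator_fst (p := fun p : (ℝ × ℝ) × ℝ => p.1.1) (by fun_prop)
      (g := fun p x => f' x p.2 + σ' x p.2 * hd p.1 - α * max (L x) (min (U x) p.2)) ?_
    have a1 : Measurable fun p : (ℝ × ℝ) × ℝ => f' p.1.1 p.2 := hr.measurable_f.comp m1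
    have a2 : Measurable fun p : (ℝ × ℝ) × ℝ => σ' p.1.1 p.2 := hr.measurable_σ.comp m1
    have a3 : Measurable fun p : (ℝ × ℝ) × ℝ => hd p.1 := hr.measurable_hd.comp measurable_fst
    have a4 : Continuous fun p : (ℝ × ℝ) × ℝ => α * max (L p.1.1) (min (U p.1.1) p.2) := by
      fun_prop
    exact (a1.add (a2.mul a3)).sub a4.measurable
  continuous z := by
    have hcont : ∀ g : ℝ → ℝ, (∀ y y', |g y - g y'| ≤ C * |y - y'|) → Continuous g := fun g hg =>
      (LipschitzWith.of_dist_le_mul (K := ⟨C, hr.nonneg⟩) hg).continuous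
    have a1 := hcont _ (hr.lip_f z.1)
    have a2 := hcont _ (hr.lip_σ z.1)
    unfold reaction
    by_cases hx : z.1 ∈ Ioo (0 : ℝ) 1
    · simp only [indicator_of_mem hx]
      have a3 : Continuous fun y => α * max (L z.1) (min (U z.1) y) := by fun_prop
      exact (a1.add (a2.mul continuous_const)).sub a3
    · simp only [indicator_of_notMem hx]; exact continuous_const
  abs_le z y := by
    unfold reaction reactionBound
    by_cases hx : z.1 ∈ Ioo (0 : ℝ) 1
    · simp only [indicator_of_mem hx]
      have a1 := hr.bound_f z.1 y
      have a2 : |σ' z.1 y * hd z| ≤ M * |hd z| := by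
        rw [abs_mul]; exact mul_le_mul_of_nonneg_right (hr.bound_σ z.1 y) (abs_nonneg _)
      have a3 : |α * max (L z.1) (min (U z.1) y)| ≤ |α| * B := by
        rw [abs_mul]
        refine mul_le_mul_of_nonneg_left (abs_le.2 ⟨?_, ?_⟩) (abs_nonneg _)
        · exact (abs_le.1 (hLB _)).1.trans (le_max_left _ _)
        · exact max_le (abs_le.1 (hLB _)).2 ((min_le_left _ _).trans (abs_le.1 (hUB _)).2)
      exact (abs_sub _ _).trans (add_le_add ((abs_add_le _ _).trans (add_le_add a1 a2)) a3)
    · simp only [indicator_of_notMem hx, abs_zero, le_refl]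
  measurable_bound := measurable_indicator_fst measurable_fst
    ((measurable_const.add ((hr.measurable_hd.abs).const_mul M)).add_const _)
  isForcing := by
    have hm : Measurable (reactionBound α M B hd) := measurable_indicator_fst measurable_fst
      ((measurable_const.add ((hr.measurable_hd.abs).const_mul M)).add_const _)
    refine ⟨hm.aestronglyMeasurable, fun T => ?_, 0, fun z hz => by
      rw [reactionBound_bdry hz, abs_zero]⟩
    have : IsFiniteMeasure ((volume : Measure (ℝ × ℝ)).restrict (strip T)) :=
      ⟨by simpa using (isCompact_strip T).measure_lt_top⟩
    have h1 : MemLp (fun z => M + M * |hd z| + |α| * B) 2 (volume.restrict (strip T)) :=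
      ((memLp_const M).add ((hr.memLp T).abs.const_mul M)).add (memLp_const (|α| * B))
    refine h1.mono hm.aestronglyMeasurable (Eventually.of_forall fun z => ?_)
    unfold reactionBound
    by_cases hx : z.1 ∈ Ioo (0 : ℝ) 1
    · rw [indicator_of_mem hx]
    · rw [indicator_of_notMem hx, norm_zero]; exact norm_nonneg _

theorem ae_fst_mem_Ioo (S : Set ℝ) :
    ∀ᵐ z ∂(volume : Measure (ℝ × ℝ)).restrict (Icc (0 : ℝ) 1 ×ˢ S), z.1 ∈ Ioo (0 : ℝ) 1 := by
  rw [Measure.volume_eq_prod, ← Measure.prod_restrict]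
  refine Measure.quasiMeasurePreserving_fst.ae (p := fun x => x ∈ Ioo (0 : ℝ) 1) ?_
  rw [← restrict_Ioo_eq_restrict_Icc]
  exact ae_restrict_mem measurableSet_Ioo

/-- The weak contribution of the reaction term in terms of the original coefficients. -/
theorem IsRegularized.integral_reaction (hr : IsRegularized f σ hdot f' σ' hd M C)
    (hL : Continuous L) (hU : Continuous U) (hLB : ∀ x, |L x| ≤ B) (hUB : ∀ x, |U x| ≤ B)
    {u v : ℝ × ℝ → ℝ} (hv : Continuous v) (huv : EqOn v u Q)
    (h1 : ∀ z ∈ Q, L z.1 ≤ u z) (h2 : ∀ z ∈ Q, u z ≤ U z.1) {φ : ℝ → ℝ} (hφ : Continuous φ)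
    (t : ℝ) :
    ∫ z in slab 0 t, φ z.1 * reaction α L U f' σ' hd z (v z) ∂Lam =
      (∫ z in strip t, f z.1 (u z) * φ z.1) + (∫ z in strip t, σ z.1 (u z) * hdot z * φ z.1) -
        α * ∫ z in strip t, u z * φ z.1 := by
  have hd' := hr.isDrift (α := α) hL hU hLB hUB
  have hRf : IsForcing fun z => reaction α L U f' σ' hd z (v z) :=
    hd'.isForcing.of_abs_le (hd'.measurable.comp (measurable_id.prodMk hv.measurable))
      fun z => hd'.abs_le z _
  have hb0 : ∀ z : ℝ × ℝ, z.1 = 0 ∨ z.1 = 1 → reaction α L U f' σ' hd z (v z) = 0 :=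
    fun z hz => abs_nonpos_iff.1 ((hd'.abs_le z _).trans (reactionBound_bdry hz).le)
  rw [integral_slab le_rfl (hRf.mul_continuous hφ le_rfl t)]
  have e0 : ∀ a : ℝ, a = 0 ∨ a = 1 → ∀ r : ℝ,
      φ a * reaction α L U f' σ' hd (a, r) (v (a, r)) = 0 := fun a ha r => by
    rw [hb0 _ ha, mul_zero]
  simp only [e0 0 (Or.inl rfl), e0 1 (Or.inr rfl), integral_zero, add_zero]
  rw [← restrict_strip]
  obtain ⟨D, hD⟩ := isCompact_Icc.exists_bound_of_continuousOn (s := Icc (0 : ℝ) 1) hφ.continuousOn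
  have : IsFiniteMeasure ((volume : Measure (ℝ × ℝ)).restrict (strip t)) :=
    ⟨by simpa using (isCompact_strip t).measure_lt_top⟩
  have hstrip : strip t ⊆ Q := fun z hz => ⟨hz.1, hz.2.1⟩
  have hae := ae_restrict_of_ae_restrict_of_subset hstrip hr.ae_eq
  have hmem : ∀ᵐ z ∂(volume : Measure (ℝ × ℝ)).restrict (strip t), z ∈ strip t :=
    ae_restrict_mem (measurableSet_strip t)
  have hφb : ∀ g : ℝ × ℝ → ℝ, Integrable g (volume.restrict (strip t)) →
      Integrable (fun z => g z * φ z.1) (volume.restrict (strip t)) := fun g hg =>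
    Integrable.mul_bdd (c := D) hg (hφ.comp continuous_fst).aestronglyMeasurable
      (hmem.mono fun z hz => hD _ hz.1)
  have mm : Measurable fun z : ℝ × ℝ => (z.1, v z) := measurable_fst.prodMk hv.measurable
  have mf : Measurable fun z : ℝ × ℝ => f' z.1 (v z) := hr.measurable_f.comp mm
  have mσ : Measurable fun z : ℝ × ℝ => σ' z.1 (v z) := hr.measurable_σ.comp mm
  have i1 : Integrable (fun z => f' z.1 (v z) * φ z.1) (volume.restrict (strip t)) :=
    hφb _ (Integrable.of_bound mf.aestronglyMeasurable M
      (Eventually.of_forall fun z => hr.bound_f _ _))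
  have i2 : Integrable (fun z => σ' z.1 (v z) * hd z * φ z.1) (volume.restrict (strip t)) :=
    hφb _ (Integrable.bdd_mul (c := M) ((hr.memLp t).integrable (by norm_num))
      mσ.aestronglyMeasurable (Eventually.of_forall fun z => hr.bound_σ _ _))
  have i3 : Integrable (fun z => α * (v z * φ z.1)) (volume.restrict (strip t)) :=
    (hφb _ (hv.continuousOn.integrableOn_compact (isCompact_strip t))).const_mul α
  have e1 : ∫ z in strip t, f z.1 (u z) * φ z.1 = ∫ z in strip t, f' z.1 (v z) * φ z.1 := by
    refine integral_congr_ae ?_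
    filter_upwards [hae, hmem] with z hz hzs
    rw [(hz.2 (v z)).1, huv (hstrip hzs)]
  have e2 : ∫ z in strip t, σ z.1 (u z) * hdot z * φ z.1 =
      ∫ z in strip t, σ' z.1 (v z) * hd z * φ z.1 := by
    refine integral_congr_ae ?_
    filter_upwards [hae, hmem] with z hz hzs
    rw [(hz.2 (v z)).2, hz.1, huv (hstrip hzs)]
  have e3 : α * ∫ z in strip t, u z * φ z.1 = ∫ z in strip t, α * (v z * φ z.1) := by
    rw [integral_const_mul]
    congr 1
    refine integral_congr_ae ?_
    filter_upwards [hmem] with z hzs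
    rw [huv (hstrip hzs)]
  have i12 : Integrable (fun z => f' z.1 (v z) * φ z.1 + σ' z.1 (v z) * hd z * φ z.1)
    (volume.restrict (strip t)) := i1.add i2
  rw [e1, e2, e3, ← integral_add i1 i2, ← integral_sub i12 i3]
  refine integral_congr_ae ?_
  -- Almost everywhere the cut-off is inactive, and between the walls so is the truncation.
  filter_upwards [ae_fst_mem_Ioo (Icc (0 : ℝ) t), hmem] with z hz hzs
  rw [reaction, indicator_of_mem hz, huv (hstrip hzs), min_eq_right (h2 z (hstrip hzs)),
    max_eq_right (h1 z (hstrip hzs))]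
  ring

end Reaction


/-! ### Reflection measures and existence -/

/-- The measure with density `p` with respect to the reference measure `Lam`. -/
noncomputable def reflMeasure (p : ℝ × ℝ → ℝ) : Measure (ℝ × ℝ) :=
  Lam.withDensity fun z => ENNReal.ofReal (p z)

section ReflMeasure
variable {p : ℝ × ℝ → ℝ}

theorem setIntegral_reflMeasure (hp : Measurable p) (h0 : ∀ z, 0 ≤ p z) (ψ : ℝ × ℝ → ℝ) (T : ℝ) :
    ∫ z in strip T, ψ z ∂reflMeasure p = ∫ z in slab 0 T, ψ z * p z ∂Lam := by
  rw [reflMeasure, setIntegral_withDensity_eq_setIntegral_toReal_smul hp.ennreal_ofReal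
    (Eventually.of_forall fun z => ENNReal.ofReal_lt_top) _ (measurableSet_strip T),
    Lam_restrict_strip]
  congr 1; funext z
  rw [ENNReal.toReal_ofReal (h0 z), smul_eq_mul, mul_comm]

theorem reflMeasure_compl_Q : reflMeasure p Qᶜ = 0 :=
  withDensity_absolutelyContinuous _ _ ae_Lam_mem_Q

theorem reflMeasure_strip_lt_top (hp : IsForcing p) (T : ℝ) : reflMeasure p (strip T) < ⊤ := by
  rw [reflMeasure, withDensity_apply _ (measurableSet_strip T), Lam_restrict_strip]
  exact (hp.integrableOn le_rfl T).lintegral_lt_top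

end ReflMeasure

theorem integrableOn_strip_mul_deriv2 {w : ℝ × ℝ → ℝ} (hw : Continuous w) {φ : ℝ → ℝ}
    (hφ : IsTest φ) (t : ℝ) : IntegrableOn (fun z => w z * iteratedDeriv 2 φ z.1) (strip t) := by
  rw [IntegrableOn, restrict_strip]; exact integrableOn_mul_deriv2 hw hφ 0 t

/-- Existence, with reflection measures dominated by the loads of the obstacles. -/
theorem exists_dominated_solution {α M C B : ℝ} {L U K₁ K₂ κ₁ κ₂ u₀ : ℝ → ℝ}
    {f σ f' σ' : ℝ → ℝ → ℝ} {hdot hd : ℝ × ℝ → ℝ} (hL : IsObstacle L κ₁) (hU : IsObstacle U κ₂)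
    (hLK : EqOn L K₁ (Icc 0 1)) (hUK : EqOn U K₂ (Icc 0 1)) (hLU : ∀ x, L x < U x)
    (hLB : ∀ x, |L x| ≤ B) (hUB : ∀ x, |U x| ≤ B)
    (hr : IsRegularized f σ hdot f' σ' hd M C) (h0 : IsInitialValue K₁ K₂ u₀) :
    ∃ (u p q : ℝ × ℝ → ℝ), Measurable p ∧ Measurable q ∧
      (∀ z, 0 ≤ p z ∧ p z ≤ load κ₁ (reactionBound α M B hd) z) ∧
      (∀ z, 0 ≤ q z ∧ q z ≤ load (fun x => -κ₂ x) (reactionBound α M B hd) z) ∧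
      IsSolution α K₁ K₂ f σ u₀ hdot u (reflMeasure p) (reflMeasure q) := by
  obtain ⟨V, hV, hV0⟩ := exists_isHeatFlow h0.continuousOn
  have hg := hr.isDrift (α := α) hL.continuous hU.continuous hLB hUB
  obtain ⟨u, p, q, hpm, hqm, hu, hu0, hlow, hupp, hp, hq, hpu, hqu⟩ := exists_reflected hg hL hU hLU
    hV (fun x hx => by rw [hLK hx, hV0 x hx]; exact h0.lower_le x hx)
    (fun x hx => by rw [hUK hx, hV0 x hx]; exact h0.le_upper x hx)
  have hpf : IsForcing p := (isForcing_load hL.measurable hL.memLp hg.isForcing).of_abs_le hpm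
    fun z => by rw [abs_of_nonneg (hp z).1]; exact (hp z).2
  have hqf : IsForcing q :=
    (isForcing_load (κ := fun x => -κ₂ x) hU.measurable.neg hU.memLp.neg hg.isForcing).of_abs_le hqm
    fun z => by rw [abs_of_nonneg (hq z).1]; exact (hq z).2
  have hgf : IsForcing fun z => reaction α L U f' σ' hd z (u z) :=
    hg.isForcing.of_abs_le (hg.measurable.comp (measurable_id.prodMk hu.continuous.measurable))
      fun z => hg.abs_le z _
  refine ⟨u, p, q, hpm, hqm, hp, hq, hu.continuous.continuousOn,
    fun z hz => by rw [← hLK hz.1]; exact hlow z hz, fun z hz => by rw [← hUK hz.1]; exact hupp z hz,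
    fun x hx => by rw [hu0, hV0 x hx], reflMeasure_compl_Q, reflMeasure_compl_Q,
    fun T _ => reflMeasure_strip_lt_top hpf T, fun T _ => reflMeasure_strip_lt_top hqf T, ?_,
    fun T _ => ?_, fun T _ => ?_⟩
  · intro t ht φ h1 h2 h3
    have hφ : IsTest φ := ⟨h1, h2, h3⟩
    have e := hu.weak φ hφ 0 t le_rfl ht
    have e2 := hr.integral_reaction (α := α) hL.continuous hU.continuous hLB hUB hu.continuous
      (fun z _ => rfl) hlow hupp hφ.continuous t
    rw [← restrict_strip] at e
    have i1 := hgf.mul_continuous hφ.continuous le_rfl t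
    have i2 := hpf.mul_continuous hφ.continuous le_rfl t
    have i3 := hqf.mul_continuous hφ.continuous le_rfl t
    have i12 : Integrable (fun z => φ z.1 * reaction α L U f' σ' hd z (u z) + φ z.1 * p z)
      (Lam.restrict (slab 0 t)) := i1.add i2
    have e3 : ∫ z in slab 0 t, φ z.1 * (reaction α L U f' σ' hd z (u z) + p z - q z) ∂Lam =
        (∫ z in slab 0 t, φ z.1 * reaction α L U f' σ' hd z (u z) ∂Lam) +
          (∫ z in slab 0 t, φ z.1 * p z ∂Lam) - ∫ z in slab 0 t, φ z.1 * q z ∂Lam := by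
      rw [← integral_add i1 i2, ← integral_sub i12 i3]
      congr 1; funext z; ring
    have e4 : ∫ y in Icc (0 : ℝ) 1, u (y, 0) * φ y = ∫ y in Icc (0 : ℝ) 1, u₀ y * φ y :=
      setIntegral_congr_fun measurableSet_Icc fun y hy => by
        simp only [hu0, hV0 y hy]
    rw [setIntegral_reflMeasure hpm (fun z => (hp z).1),
      setIntegral_reflMeasure hqm (fun z => (hq z).1)]
    rw [e3, e2, e4] at e
    linarith
  · rw [setIntegral_reflMeasure hpm (fun z => (hp z).1)]
    refine integral_eq_zero_of_ae (ae_restrict_of_ae ?_)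
    filter_upwards [hpu, ae_Lam_mem_Q] with z h1 h2
    rcases (hlow z h2).eq_or_lt with h | h
    · simp [← hLK h2.1, h]
    · simp [h1 h]
  · rw [setIntegral_reflMeasure hqm (fun z => (hq z).1)]
    refine integral_eq_zero_of_ae (ae_restrict_of_ae ?_)
    filter_upwards [hqu, ae_Lam_mem_Q] with z h1 h2
    rcases (hupp z h2).eq_or_lt with h | h
    · simp [← hUK h2.1, h]
    · simp [h1 h]


/-! ### Arbitrary solutions: contact sets and comparison -/

theorem strip_eq_union {s t : ℝ} (hs : 0 ≤ s) (hst : s ≤ t) :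
    strip t = strip s ∪ Icc (0 : ℝ) 1 ×ˢ Ioc s t := by
  ext z
  simp only [strip, mem_union, mem_prod]
  constructor
  · rintro ⟨h1, h2⟩
    rcases le_or_gt z.2 s with h | h
    · exact Or.inl ⟨h1, h2.1, h⟩
    · exact Or.inr ⟨h1, h, h2.2⟩
  · rintro (⟨h1, h2⟩ | ⟨h1, h2⟩)
    · exact ⟨h1, h2.1, h2.2.trans hst⟩
    · exact ⟨h1, hs.trans h2.1.le, h2.2⟩

theorem disjoint_strip_slab (s t : ℝ) : Disjoint (strip s) (Icc (0 : ℝ) 1 ×ˢ Ioc s t) :=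
  Set.disjoint_left.2 fun _ h1 h2 => not_lt.2 h1.2.2 h2.2.1

section Solution
variable {α : ℝ} {K₁ K₂ : ℝ → ℝ} {f σ : ℝ → ℝ → ℝ} {u₀ : ℝ → ℝ} {hdot u : ℝ × ℝ → ℝ}
  {η ξ : Measure (ℝ × ℝ)}

theorem IsSolution.η_strip_lt_top (h : IsSolution α K₁ K₂ f σ u₀ hdot u η ξ) (T : ℝ) :
    η (strip T) < ⊤ :=
  (measure_mono (strip_mono (le_max_left T 1))).trans_lt
    (h.finite_η (max T 1) (lt_max_of_lt_right one_pos))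

theorem IsSolution.ξ_strip_lt_top (h : IsSolution α K₁ K₂ f σ u₀ hdot u η ξ) (T : ℝ) :
    ξ (strip T) < ⊤ :=
  (measure_mono (strip_mono (le_max_left T 1))).trans_lt
    (h.finite_ξ (max T 1) (lt_max_of_lt_right one_pos))

theorem integrableOn_strip_of_finite {η : Measure (ℝ × ℝ)} {T : ℝ} (h : η (strip T) < ⊤)
    {g : ℝ × ℝ → ℝ} (hg : ContinuousOn g (strip T)) : IntegrableOn g (strip T) η := by
  obtain ⟨C, hC⟩ := (isCompact_strip T).exists_bound_of_continuousOn hg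
  exact IntegrableOn.of_bound h (hg.aestronglyMeasurable (measurableSet_strip T)) C
    ((ae_restrict_mem (measurableSet_strip T)).mono fun z hz => hC z hz)

/-- Each strip is compact with finite measure, so g is integrable there and the vanishing integral
is genuine, not the default value of the Bochner integral. A countable union of strips covers Q. -/
theorem ae_eq_zero_of_strip_integrals {η : Measure (ℝ × ℝ)} (hQ : η Qᶜ = 0)
    (hf : ∀ T, η (strip T) < ⊤) {g : ℝ × ℝ → ℝ} (hg : ContinuousOn g Q) (h0 : ∀ z ∈ Q, 0 ≤ g z)
    (hI : ∀ T, 0 < T → ∫ z in strip T, g z ∂η = 0) : ∀ᵐ z ∂η, g z = 0 := by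
  have hsub : ∀ T, strip T ⊆ Q := fun T z hz => ⟨hz.1, hz.2.1⟩
  have h1 : ∀ n : ℕ, ∀ᵐ z ∂η, z ∈ strip n → g z = 0 := fun n => by
    have hle : strip n ⊆ strip (n + 1) := strip_mono (by simp)
    have h2 := (setIntegral_eq_zero_iff_of_nonneg_ae (μ := η) (s := strip ((n : ℝ) + 1)) (f := g)
      ((ae_restrict_mem (measurableSet_strip _)).mono fun z hz => h0 z (hsub _ hz))
      (integrableOn_strip_of_finite (hf _) (hg.mono (hsub _)))).1 (hI _ (by positivity))
    rw [EventuallyEq, ae_restrict_iff' (measurableSet_strip _)] at h2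
    exact h2.mono fun z hz hzn => hz (hle hzn)
  have hQ' : ∀ᵐ z ∂η, z ∈ Q := hQ
  filter_upwards [ae_all_iff.2 h1, hQ'] with z hz hzQ
  obtain ⟨n, hn⟩ := exists_nat_ge z.2
  exact hz n ⟨hzQ.1, hzQ.2, hn⟩

theorem continuousOn_wall {K : ℝ → ℝ} (hK : ContinuousOn K (Icc 0 1)) :
    ContinuousOn (fun z : ℝ × ℝ => K z.1) Q :=
  hK.comp continuous_fst.continuousOn fun _ hz => hz.1

theorem IsSolution.ae_η (h : IsSolution α K₁ K₂ f σ u₀ hdot u η ξ)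
    (hK : ContinuousOn K₁ (Icc 0 1)) : ∀ᵐ z ∂η, u z = K₁ z.1 :=
  (ae_eq_zero_of_strip_integrals h.supp_η h.η_strip_lt_top
    (h.continuousOn.sub (continuousOn_wall hK)) (fun z hz => sub_nonneg.2 (h.lower_le z hz))
    h.reflect_η).mono fun _ hz => sub_eq_zero.1 hz

theorem IsSolution.ae_ξ (h : IsSolution α K₁ K₂ f σ u₀ hdot u η ξ)
    (hK : ContinuousOn K₂ (Icc 0 1)) : ∀ᵐ z ∂ξ, u z = K₂ z.1 :=
  (ae_eq_zero_of_strip_integrals h.supp_ξ h.ξ_strip_lt_top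
    ((continuousOn_wall hK).sub h.continuousOn) (fun z hz => sub_nonneg.2 (h.le_upper z hz))
    h.reflect_ξ).mono fun _ hz => (sub_eq_zero.1 hz).symm

theorem IsSolution.continuous_clamp (h : IsSolution α K₁ K₂ f σ u₀ hdot u η ξ) :
    Continuous fun z => u (clampQ z) :=
  h.continuousOn.comp_continuous continuous_clampQ clampQ_mem

/-- The walls are replaced by continuous functions on the whole line, and the coefficients by
measurable modifications. -/
structure IsSetting (K₁ K₂ L U : ℝ → ℝ) (f σ : ℝ → ℝ → ℝ) (hdot : ℝ × ℝ → ℝ) (f' σ' : ℝ → ℝ → ℝ)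
    (hd : ℝ × ℝ → ℝ) (M C B : ℝ) : Prop where
  reg : IsRegularized f σ hdot f' σ' hd M C
  cont_lower : Continuous L
  cont_upper : Continuous U
  lower_eq : EqOn L K₁ (Icc 0 1)
  upper_eq : EqOn U K₂ (Icc 0 1)
  abs_lower_le : ∀ x, |L x| ≤ B
  abs_upper_le : ∀ x, |U x| ≤ B

variable {L U : ℝ → ℝ} {f' σ' : ℝ → ℝ → ℝ} {hd : ℝ × ℝ → ℝ} {M C B : ℝ}

theorem IsSetting.isForcing (hs : IsSetting K₁ K₂ L U f σ hdot f' σ' hd M C B)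
    (α : ℝ) {v : ℝ × ℝ → ℝ} (hv : Continuous v) :
    IsForcing fun z => reaction α L U f' σ' hd z (v z) := by
  have hg := hs.reg.isDrift (α := α) hs.cont_lower hs.cont_upper hs.abs_lower_le hs.abs_upper_le
  exact hg.isForcing.of_abs_le (hg.measurable.comp (measurable_id.prodMk hv.measurable))
    fun z => hg.abs_le z _

/-- The weak form is rewritten for the globally continuous extension of u by clamping and with the
reaction integrated against `Lam`, so that the theory of forced heat equations applies. -/
theorem IsSolution.weak_strip (hs : IsSetting K₁ K₂ L U f σ hdot f' σ' hd M C B)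
    (h : IsSolution α K₁ K₂ f σ u₀ hdot u η ξ) {φ : ℝ → ℝ} (hφ : IsTest φ) {t : ℝ} (ht : 0 ≤ t) :
    (∫ x in Icc (0 : ℝ) 1, u (clampQ (x, t)) * φ x) =
      (∫ x in Icc (0 : ℝ) 1, u₀ x * φ x) +
      (∫ z in strip t, u (clampQ z) * iteratedDeriv 2 φ z.1) +
      (∫ z in slab 0 t, φ z.1 * reaction α L U f' σ' hd z (u (clampQ z)) ∂Lam) +
      (∫ z in strip t, φ z.1 ∂η) - ∫ z in strip t, φ z.1 ∂ξ := by
  have e := h.weak t ht φ hφ.contDiff hφ.left hφ.right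
  have huv : EqOn (fun z => u (clampQ z)) u Q := fun z hz => by simp only [clampQ_eq hz]
  have e2 := hs.reg.integral_reaction (α := α) hs.cont_lower hs.cont_upper hs.abs_lower_le
    hs.abs_upper_le h.continuous_clamp huv
    (fun z hz => by rw [hs.lower_eq hz.1]; exact h.lower_le z hz)
    (fun z hz => by rw [hs.upper_eq hz.1]; exact h.le_upper z hz) hφ.continuous t
  have e3 : ∫ x in Icc (0 : ℝ) 1, u (clampQ (x, t)) * φ x = ∫ x in Icc (0 : ℝ) 1, u (x, t) * φ x :=
    setIntegral_congr_fun measurableSet_Icc fun x hx => by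
      simp only [clampQ_eq (mk_mem_Q hx ht)]
  have e4 : ∫ z in strip t, u (clampQ z) * iteratedDeriv 2 φ z.1 =
      ∫ z in strip t, u z * iteratedDeriv 2 φ z.1 :=
    setIntegral_congr_fun (measurableSet_strip t) fun z hz => by
      simp only [clampQ_eq (show z ∈ Q from ⟨hz.1, hz.2.1⟩)]
  rw [e3, e4, e2]
  linarith

theorem setIntegral_strip_sub {η : Measure (ℝ × ℝ)} {s t : ℝ} (hs : 0 ≤ s) (hst : s ≤ t)
    {g : ℝ × ℝ → ℝ} (hg : IntegrableOn g (strip t) η) :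
    ∫ z in strip t, g z ∂η = (∫ z in strip s, g z ∂η) + ∫ z in Icc (0 : ℝ) 1 ×ˢ Ioc s t, g z ∂η := by
  rw [strip_eq_union hs hst] at hg ⊢
  exact setIntegral_union (disjoint_strip_slab s t) (measurableSet_slab s t)
    hg.left_of_union hg.right_of_union

theorem IsSolution.weak_slab (hs : IsSetting K₁ K₂ L U f σ hdot f' σ' hd M C B)
    (h : IsSolution α K₁ K₂ f σ u₀ hdot u η ξ) {φ : ℝ → ℝ} (hφ : IsTest φ) {s t : ℝ} (h0 : 0 ≤ s)
    (hst : s ≤ t) :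
    (∫ x in Icc (0 : ℝ) 1, u (clampQ (x, t)) * φ x) -
        (∫ x in Icc (0 : ℝ) 1, u (clampQ (x, s)) * φ x) =
      (∫ z in Icc (0 : ℝ) 1 ×ˢ Ioc s t, u (clampQ z) * iteratedDeriv 2 φ z.1) +
      (∫ z in slab s t, φ z.1 * reaction α L U f' σ' hd z (u (clampQ z)) ∂Lam) +
      (∫ z in Icc (0 : ℝ) 1 ×ˢ Ioc s t, φ z.1 ∂η) - ∫ z in Icc (0 : ℝ) 1 ×ˢ Ioc s t, φ z.1 ∂ξ := by
  have hc : ContinuousOn (fun z : ℝ × ℝ => φ z.1) (strip t) :=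
    (hφ.continuous.comp continuous_fst).continuousOn
  have e1 := h.weak_strip hs hφ h0
  have e2 := h.weak_strip hs hφ (h0.trans hst)
  have a1 := setIntegral_strip_sub h0 hst (integrableOn_strip_mul_deriv2 h.continuous_clamp hφ t)
  have a2 := setIntegral_strip_sub h0 hst (integrableOn_strip_of_finite (h.η_strip_lt_top t) hc)
  have a3 := setIntegral_strip_sub h0 hst (integrableOn_strip_of_finite (h.ξ_strip_lt_top t) hc)
  have hI := (hs.isForcing α h.continuous_clamp).mul_continuous hφ.continuous le_rfl t
  have hU : slab 0 t = slab 0 s ∪ slab s t := by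
    rw [slab, slab, slab, ← prod_union, Ioc_union_Ioc_eq_Ioc h0 hst]
  have hdj : Disjoint (slab 0 s) (slab s t) :=
    Set.disjoint_left.2 fun _ h1 h2 => not_lt.2 h1.2.2 h2.2.1
  have a4 : ∫ z in slab 0 t, φ z.1 * reaction α L U f' σ' hd z (u (clampQ z)) ∂Lam =
      (∫ z in slab 0 s, φ z.1 * reaction α L U f' σ' hd z (u (clampQ z)) ∂Lam) +
        ∫ z in slab s t, φ z.1 * reaction α L U f' σ' hd z (u (clampQ z)) ∂Lam := by
    rw [hU] at hI ⊢
    exact setIntegral_union hdj (measurableSet_univ_slab s t) hI.left_of_union hI.right_of_union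
  rw [a1, a2, a3, a4] at e2
  linarith

/-- Comparison of two solutions: their difference is controlled by the heat flow driven by the
difference of the reaction terms. -/
theorem IsSolution.sub_le {u' : ℝ × ℝ → ℝ} {η' ξ' : Measure (ℝ × ℝ)}
    (hs : IsSetting K₁ K₂ L U f σ hdot f' σ' hd M C B)
    (hK₁ : ContinuousOn K₁ (Icc 0 1)) (hK₂ : ContinuousOn K₂ (Icc 0 1))
    (h : IsSolution α K₁ K₂ f σ u₀ hdot u η ξ) (h' : IsSolution α K₁ K₂ f σ u₀ hdot u' η' ξ')
    {T c : ℝ} (hc0 : 0 ≤ c)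
    (hc : ∀ z ∈ strip T, |heatSol (fun z => reaction α L U f' σ' hd z (u (clampQ z)) -
      reaction α L U f' σ' hd z (u' (clampQ z))) z| ≤ c) :
    ∀ z ∈ strip T, u z - u' z ≤ 2 * c := by
  set G : ℝ × ℝ → ℝ := fun z => reaction α L U f' σ' hd z (u (clampQ z)) -
      reaction α L U f' σ' hd z (u' (clampQ z)) with hG
  have f1 := hs.isForcing α h.continuous_clamp
  have f2 := hs.isForcing α h'.continuous_clamp
  have hGf : IsForcing G := f1.sub f2
  have hH := hGf.isWeakHeat
  -- Subtracting the heat solution driven by the reaction difference leaves only reflection measures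
  -- as sources: η − ξ − η' + ξ'.
  set w : ℝ × ℝ → ℝ := fun z => u (clampQ z) - u' (clampQ z) - heatSol G z with hw
  have hsub : ∀ T, strip T ⊆ Q := fun T z hz => ⟨hz.1, hz.2.1⟩
  have hwc : Continuous w := (h.continuous_clamp.sub h'.continuous_clamp).sub hH.continuous
  have key : ∀ z ∈ strip T, w z ≤ c := by
    refine le_of_subsolution hwc.continuousOn (fun x hx => ?_) ?_
    · simp only [hw]
      rw [clampQ_eq (mk_mem_Q hx le_rfl), h.initial x hx, h'.initial x hx,
        heatSol_of_nonpos _ le_rfl]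
      linarith
    · intro φ hφ hφ0 s t h0 hst htT hpos
      have e1 := h.weak_slab hs hφ h0 hst.le
      have e2 := h'.weak_slab hs hφ h0 hst.le
      have e3 := hH.weak φ hφ s t h0 hst.le
      have cφ := hφ.continuous
      have a1 : ∀ r, ∫ y in Icc (0 : ℝ) 1, w (y, r) * φ y =
          (∫ y in Icc (0 : ℝ) 1, u (clampQ (y, r)) * φ y) -
            (∫ y in Icc (0 : ℝ) 1, u' (clampQ (y, r)) * φ y) -
            ∫ y in Icc (0 : ℝ) 1, heatSol G (y, r) * φ y := fun r => by
        have i1 := integrableOn_slice h.continuous_clamp cφ r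
        have i2 := integrableOn_slice h'.continuous_clamp cφ r
        have i3 := integrableOn_slice hH.continuous cφ r
        have i12 : Integrable (fun y => u (clampQ (y, r)) * φ y - u' (clampQ (y, r)) * φ y)
          (volume.restrict (Icc (0 : ℝ) 1)) := i1.sub i2
        rw [← integral_sub i1 i2, ← integral_sub i12 i3]
        congr 1; funext y; simp only [hw]; ring
      have a2 : ∫ z in Icc (0 : ℝ) 1 ×ˢ Ioc s t, w z * iteratedDeriv 2 φ z.1 =
          (∫ z in Icc (0 : ℝ) 1 ×ˢ Ioc s t, u (clampQ z) * iteratedDeriv 2 φ z.1) -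
            (∫ z in Icc (0 : ℝ) 1 ×ˢ Ioc s t, u' (clampQ z) * iteratedDeriv 2 φ z.1) -
            ∫ z in Icc (0 : ℝ) 1 ×ˢ Ioc s t, heatSol G z * iteratedDeriv 2 φ z.1 := by
        have i1 := integrableOn_mul_deriv2 h.continuous_clamp hφ s t
        have i2 := integrableOn_mul_deriv2 h'.continuous_clamp hφ s t
        have i3 := integrableOn_mul_deriv2 hH.continuous hφ s t
        have i12 : Integrable (fun z : ℝ × ℝ => u (clampQ z) * iteratedDeriv 2 φ z.1 -
          u' (clampQ z) * iteratedDeriv 2 φ z.1)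
          (volume.restrict (Icc (0 : ℝ) 1 ×ˢ Ioc s t)) := i1.sub i2
        rw [← integral_sub i1 i2, ← integral_sub i12 i3]
        congr 1; funext y; simp only [hw]; ring
      have a3 : ∫ z in slab s t, φ z.1 * G z ∂Lam =
          (∫ z in slab s t, φ z.1 * reaction α L U f' σ' hd z (u (clampQ z)) ∂Lam) -
            ∫ z in slab s t, φ z.1 * reaction α L U f' σ' hd z (u' (clampQ z)) ∂Lam := by
        rw [← integral_sub (f1.mul_continuous cφ h0 t) (f2.mul_continuous cφ h0 t)]
        congr 1; funext y; simp only [hG]; ring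
      -- Where w > c, the bound |heatSol| ≤ c gives u > u'. Then u is off the lower wall and u' off
      -- the upper one, so η and ξ' do not act, while −ξ and −η' have the favourable sign.
      have hgt : ∀ z ∈ Icc (0 : ℝ) 1 ×ˢ Ioc s t, φ z.1 ≠ 0 → u' z < u z := by
        intro z hz hzφ
        have hzs : z ∈ strip T := ⟨hz.1, h0.trans hz.2.1.le, hz.2.2.trans htT⟩
        have b1 := hpos z.1 hz.1 z.2 ⟨hz.2.1.le, hz.2.2⟩ hzφ
        have b2 := (abs_le.1 (hc z hzs)).1
        simp only [hw, Prod.mk.eta, clampQ_eq (hsub T hzs)] at b1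
        linarith
      have b1 : ∫ z in Icc (0 : ℝ) 1 ×ˢ Ioc s t, φ z.1 ∂η = 0 := by
        refine integral_eq_zero_of_ae ?_
        filter_upwards [ae_restrict_mem (measurableSet_slab s t),
          ae_restrict_of_ae (h.ae_η hK₁)] with z hz hzη
        by_contra hne
        have := hgt z hz hne
        have := h'.lower_le z (slab_subset_Q h0 hz)
        linarith
      have b2 : ∫ z in Icc (0 : ℝ) 1 ×ˢ Ioc s t, φ z.1 ∂ξ' = 0 := by
        refine integral_eq_zero_of_ae ?_
        filter_upwards [ae_restrict_mem (measurableSet_slab s t),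
          ae_restrict_of_ae (h'.ae_ξ hK₂)] with z hz hzξ
        by_contra hne
        have := hgt z hz hne
        have := h.le_upper z (slab_subset_Q h0 hz)
        linarith
      have b3 : 0 ≤ ∫ z in Icc (0 : ℝ) 1 ×ˢ Ioc s t, φ z.1 ∂η' := integral_nonneg fun z => hφ0 _
      have b4 : 0 ≤ ∫ z in Icc (0 : ℝ) 1 ×ˢ Ioc s t, φ z.1 ∂ξ := integral_nonneg fun z => hφ0 _
      rw [a1, a1, a2]
      linarith
  intro z hz
  have h1 := key z hz
  have h2 := (abs_le.1 (hc z hz)).2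
  simp only [hw, clampQ_eq (hsub T hz)] at h1
  linarith

end Solution


/-! ### Uniqueness of the profile -/

theorem exists_pos_integral_slab_le {F : ℝ × ℝ → ℝ} {T : ℝ} (hF : IntegrableOn F (strip T))
    (h0 : ∀ z, 0 ≤ F z) {ε : ℝ} (hε : 0 < ε) :
    ∃ δ > 0, ∀ s t, 0 ≤ s → t ≤ T → t - s ≤ δ → ∫ z in Icc (0 : ℝ) 1 ×ˢ Ioc s t, F z ≤ ε := by
  obtain ⟨δ, hδ, h⟩ := exists_pos_setLIntegral_lt_of_measure_lt
    (μ := (volume : Measure (ℝ × ℝ)).restrict (strip T)) (f := fun z => ENNReal.ofReal (F z))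
    hF.lintegral_lt_top.ne (ε := ENNReal.ofReal ε) (by simpa using hε)
  obtain ⟨d, hd0, hdδ⟩ := ENNReal.lt_iff_exists_nnreal_btwn.1 hδ
  have hd0' : (0 : ℝ) < d := by exact_mod_cast hd0
  refine ⟨d, hd0', fun s t hs ht hst => ?_⟩
  have hsub : Icc (0 : ℝ) 1 ×ˢ Ioc s t ⊆ strip T :=
    (slab_subset_strip hs).trans (strip_mono ht)
  have hvol : (volume : Measure (ℝ × ℝ)).restrict (strip T) (Icc (0 : ℝ) 1 ×ˢ Ioc s t) < δ := by
    refine ((Measure.restrict_apply_le _ _).trans ?_).trans_lt hdδ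
    rw [Measure.volume_eq_prod, Measure.prod_prod, Real.volume_Icc, Real.volume_Ioc, sub_zero,
      ENNReal.ofReal_one, one_mul]
    exact ENNReal.ofReal_le_of_le_toReal (by simpa using hst)
  have h1 := h _ hvol
  rw [Measure.restrict_restrict (measurableSet_slab s t), inter_eq_left.2 hsub] at h1
  rw [integral_eq_lintegral_of_nonneg_ae (Eventually.of_forall h0)
    (hF.mono_set hsub).aestronglyMeasurable]
  exact ENNReal.toReal_le_of_le_ofReal hε.le h1.le

section Uniqueness
variable {α : ℝ} {K₁ K₂ : ℝ → ℝ} {f σ : ℝ → ℝ → ℝ} {u₀ : ℝ → ℝ} {hdot u u' : ℝ × ℝ → ℝ}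
  {η ξ η' ξ' : Measure (ℝ × ℝ)}
  {L U : ℝ → ℝ} {f' σ' : ℝ → ℝ → ℝ} {hd : ℝ × ℝ → ℝ} {M C B : ℝ}

theorem IsRegularized.abs_reaction_sub_le (hr : IsRegularized f σ hdot f' σ' hd M C) (α : ℝ)
    (L U : ℝ → ℝ) (z : ℝ × ℝ) (y y' : ℝ) :
    |reaction α L U f' σ' hd z y - reaction α L U f' σ' hd z y'| ≤
      (C + C * |hd z| + |α|) * |y - y'| := by
  have hC := hr.nonneg
  unfold reaction
  by_cases hx : z.1 ∈ Ioo (0 : ℝ) 1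
  · simp only [indicator_of_mem hx]
    have a1 := hr.lip_f z.1 y y'
    have a2 : |(σ' z.1 y - σ' z.1 y') * hd z| ≤ C * |y - y'| * |hd z| := by
      rw [abs_mul]; exact mul_le_mul_of_nonneg_right (hr.lip_σ z.1 y y') (abs_nonneg _)
    have a3 : |max (L z.1) (min (U z.1) y) - max (L z.1) (min (U z.1) y')| ≤ |y - y'| := by
      refine (abs_max_sub_max_le_max _ _ _ _).trans ?_
      rw [sub_self, abs_zero]
      refine max_le (abs_nonneg _) ((abs_min_sub_min_le_max _ _ _ _).trans ?_)
      rw [sub_self, abs_zero]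
      exact max_le (abs_nonneg _) le_rfl
    have a4 : |α * (max (L z.1) (min (U z.1) y) - max (L z.1) (min (U z.1) y'))| ≤
        |α| * |y - y'| := by
      rw [abs_mul]; exact mul_le_mul_of_nonneg_left a3 (abs_nonneg _)
    calc _ = |(f' z.1 y - f' z.1 y') + (σ' z.1 y - σ' z.1 y') * hd z -
          α * (max (L z.1) (min (U z.1) y) - max (L z.1) (min (U z.1) y'))| := by ring_nf
      _ ≤ C * |y - y'| + C * |y - y'| * |hd z| + |α| * |y - y'| :=
        (abs_sub _ _).trans (add_le_add ((abs_add_le _ _).trans (add_le_add a1 a2)) a4)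
      _ = _ := by ring
  · simp only [indicator_of_notMem hx, sub_zero, abs_zero]; positivity

theorem reaction_bdry (α : ℝ) (L U : ℝ → ℝ) {z : ℝ × ℝ} (hz : z.1 = 0 ∨ z.1 = 1) (y : ℝ) :
    reaction α L U f' σ' hd z y = 0 := by
  refine indicator_of_notMem (fun h => ?_) _
  rcases hz with hz | hz <;> rw [hz] at h
  · exact lt_irrefl _ h.1
  · exact lt_irrefl _ h.2

/-- Uniqueness of the profile on a short time interval. -/
theorem IsSolution.eqOn_step
    (hs : IsSetting K₁ K₂ L U f σ hdot f' σ' hd M C B)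
    (hK₁ : ContinuousOn K₁ (Icc 0 1)) (hK₂ : ContinuousOn K₂ (Icc 0 1))
    (h : IsSolution α K₁ K₂ f σ u₀ hdot u η ξ) (h' : IsSolution α K₁ K₂ f σ u₀ hdot u' η' ξ')
    {s t T : ℝ} (h0 : 0 ≤ s) (hst : s ≤ t) (htT : t ≤ T) (heq : EqOn u u' (strip s))
    (hsmall : (8 * (1 + T) * (∑' k, wgt k) + 1) * (8 * ∫ z in Icc (0 : ℝ) 1 ×ˢ Ioc s t,
      (C + C * |hd z| + |α|) ^ 2) ≤ 1) : EqOn u u' (strip t) := by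
  set S := ∑' k, wgt k with hS
  have hS0 : 0 ≤ S := tsum_nonneg fun k => (wgt_pos k).le
  set A := 8 * (1 + T) * S + 1 with hA
  have hT0 : 0 ≤ T := h0.trans (hst.trans htT)
  have hA0 : 0 < A := by rw [hA]; positivity
  set E := ∫ z in Icc (0 : ℝ) 1 ×ˢ Ioc s t, (C + C * |hd z| + |α|) ^ 2 with hE
  have hsub : strip t ⊆ Q := fun z hz => ⟨hz.1, hz.2.1⟩
  have hcont : ContinuousOn (fun z => |u z - u' z|) (strip t) :=
    ((h.continuousOn.sub h'.continuousOn).mono hsub).abs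
  obtain ⟨z0, hz0, hmax⟩ := (isCompact_strip t).exists_isMaxOn
    ⟨(0, 0), ⟨by simp, ⟨le_rfl, h0.trans hst⟩⟩⟩ hcont
  set D := |u z0 - u' z0| with hD
  have hmax' : ∀ z ∈ strip t, |u z - u' z| ≤ D := fun z hz => hmax hz
  have hfin : IsFiniteMeasure ((volume : Measure (ℝ × ℝ)).restrict (strip t)) :=
    ⟨by simpa using (isCompact_strip t).measure_lt_top⟩
  have hℓ : MemLp (fun z => C + C * |hd z| + |α|) 2 (volume.restrict (strip t)) :=
    ((memLp_const C).add ((hs.reg.memLp t).abs.const_mul C)).add (memLp_const |α|)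
  by_cases hD0 : D ≤ 0
  · intro z hz
    have := abs_nonpos_iff.1 ((hmax' z hz).trans hD0)
    linarith
  exfalso
  push Not at hD0
  have est : ∀ v v' : ℝ × ℝ → ℝ, Continuous v → Continuous v' →
      (∀ z ∈ strip s, v z = v' z) → (∀ z ∈ strip t, |v z - v' z| ≤ D) →
      ∀ z ∈ strip t, |heatSol (fun z => reaction α L U f' σ' hd z (v z) -
        reaction α L U f' σ' hd z (v' z)) z| ≤ D / 4 := by
    intro v v' hv hv' hvs hvD z hz
    set G : ℝ × ℝ → ℝ := fun z => reaction α L U f' σ' hd z (v z) -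
        reaction α L U f' σ' hd z (v' z) with hG
    have hGf : IsForcing G := (hs.isForcing α hv).sub (hs.isForcing α hv')
    have hb : ∀ z : ℝ × ℝ, z.1 = 0 ∨ z.1 = 1 → G z = 0 := fun z hz => by
      simp only [hG, reaction_bdry α L U hz, sub_self]
    -- With r = A/D the energy term is at most A·D·E and the weight term (1 + T)S·D/A. The choice A
    -- = 8(1 + T)S + 1 and the smallness of E make each at most D/8.
    have hr : 0 < A / D := by positivity
    have e1 := hGf.abs_heatSol_le hb hT0 hr (hz.2.2.trans htT)
    have e2 := hGf.integral_strip_mono hz.2.2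
    have e3 : ∫ z in strip t, G z ^ 2 ≤ D ^ 2 * E := by
      have hℓi : IntegrableOn (fun z => D ^ 2 * (C + C * |hd z| + |α|) ^ 2) (strip t) :=
        hℓ.integrable_sq.const_mul _
      calc ∫ z in strip t, G z ^ 2
          ≤ ∫ z in strip t, (Icc (0 : ℝ) 1 ×ˢ Ioc s t).indicator
              (fun z => D ^ 2 * (C + C * |hd z| + |α|) ^ 2) z := by
            refine setIntegral_mono_on (hGf.sq t).integrable_sq
              (hℓi.indicator (measurableSet_slab s t)) (measurableSet_strip t) fun z hz => ?_
            rcases le_or_gt z.2 s with hzs | hzs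
            · have : G z = 0 := by
                simp only [hG, hvs z ⟨hz.1, hz.2.1, hzs⟩, sub_self]
              rw [this, zero_pow two_ne_zero]
              exact indicator_nonneg (fun _ _ => by positivity) _
            · rw [indicator_of_mem (show z ∈ Icc (0 : ℝ) 1 ×ˢ Ioc s t from ⟨hz.1, hzs, hz.2.2⟩),
                ← mul_pow, ← sq_abs]
              have b1 := hs.reg.abs_reaction_sub_le α L U z (v z) (v' z)
              have hC := hs.reg.nonneg
              have b2 : (C + C * |hd z| + |α|) * |v z - v' z| ≤ (C + C * |hd z| + |α|) * D :=
                mul_le_mul_of_nonneg_left (hvD z hz) (by positivity)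
              refine pow_le_pow_left₀ (abs_nonneg _) ?_ 2
              calc |G z| ≤ _ := b1
                _ ≤ _ := b2
                _ = _ := mul_comm _ _
        _ = D ^ 2 * E := by
            rw [setIntegral_indicator (measurableSet_slab s t),
              inter_eq_right.2 (slab_subset_strip h0), integral_const_mul]
    have e4 : A / D * (∫ z in strip z.2, G z ^ 2) ≤ D / 8 := by
      calc A / D * (∫ z in strip z.2, G z ^ 2) ≤ A / D * (D ^ 2 * E) :=
            mul_le_mul_of_nonneg_left (e2.trans e3) hr.le
        _ = D * (A * (8 * E)) / 8 := by field_simp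
        _ ≤ D * 1 / 8 := by gcongr
        _ = D / 8 := by ring
    have e5 : (1 + T) * (1 / (A / D)) * S ≤ D / 8 := by
      have : (1 + T) * (1 / (A / D)) * S = D / 8 * ((8 * (1 + T) * S) / A) := by field_simp
      rw [this]
      refine mul_le_of_le_one_right (by positivity) ?_
      rw [div_le_one hA0, hA]; linarith
    linarith
  have hv := h.continuous_clamp
  have hv' := h'.continuous_clamp
  have cs : ∀ r, ∀ z ∈ strip r, clampQ z = z := fun r z hz => clampQ_eq ⟨hz.1, hz.2.1⟩
  have c1 := est _ _ hv hv' (fun z hz => by simp only [cs s z hz, heq hz])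
    (fun z hz => by simp only [cs t z hz]; exact hmax' z hz)
  have c2 := est _ _ hv' hv (fun z hz => by simp only [cs s z hz, heq hz])
    (fun z hz => by simp only [cs t z hz]; rw [abs_sub_comm]; exact hmax' z hz)
  have d1 := h.sub_le hs hK₁ hK₂ h' (by positivity) c1 z0 hz0
  have d2 := h'.sub_le hs hK₁ hK₂ h (by positivity) c2 z0 hz0
  -- Comparison in both directions bounds |u − u'| at its maximum point by 2·(D/4), which
  -- contradicts D > 0.
  have : D ≤ D / 2 := abs_le.2 ⟨by linarith, by linarith⟩
  linarith

/-- The admissible step length comes from absolute continuity of the integral of (C + C|hd| + |α|)²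
over [0,1] × [0,T]. It is the same at every stage, so finitely many steps reach T. -/
theorem IsSolution.eqOn
    (hs : IsSetting K₁ K₂ L U f σ hdot f' σ' hd M C B)
    (hK₁ : ContinuousOn K₁ (Icc 0 1)) (hK₂ : ContinuousOn K₂ (Icc 0 1))
    (h : IsSolution α K₁ K₂ f σ u₀ hdot u η ξ) (h' : IsSolution α K₁ K₂ f σ u₀ hdot u' η' ξ') :
    EqOn u u' Q := by
  have main : ∀ T : ℝ, 0 < T → EqOn u u' (strip T) := by
    intro T hT
    have hS0 : 0 ≤ ∑' k, wgt k := tsum_nonneg fun k => (wgt_pos k).le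
    set A := 8 * (1 + T) * (∑' k, wgt k) + 1 with hA
    have hA0 : 0 < A := by
      have : 0 ≤ 8 * (1 + T) * (∑' k, wgt k) := mul_nonneg (by positivity) hS0
      linarith
    have hfin : IsFiniteMeasure ((volume : Measure (ℝ × ℝ)).restrict (strip T)) :=
      ⟨by simpa using (isCompact_strip T).measure_lt_top⟩
    have hℓ : MemLp (fun z => C + C * |hd z| + |α|) 2 (volume.restrict (strip T)) :=
      ((memLp_const C).add ((hs.reg.memLp T).abs.const_mul C)).add (memLp_const |α|)
    obtain ⟨δ, hδ, hsm⟩ := exists_pos_integral_slab_le hℓ.integrable_sq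
      (fun z => sq_nonneg _) (show 0 < 1 / (8 * A) by positivity)
    have step : ∀ n : ℕ, EqOn u u' (strip (min (n * δ) T)) := by
      intro n
      induction n with
      | zero =>
        intro z hz
        have h2 : z.2 = 0 := le_antisymm (hz.2.2.trans (by simp)) hz.2.1
        have hz' : z = (z.1, 0) := by rw [← h2]
        rw [hz', h.initial _ hz.1, h'.initial _ hz.1]
      | succ n ih =>
        have h0 : 0 ≤ min (n * δ) T := le_min (by positivity) hT.le
        have hst : min (n * δ) T ≤ min ((n + 1 : ℕ) * δ) T :=
          min_le_min_right _ (by push_cast; nlinarith)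
        refine h.eqOn_step hs hK₁ hK₂ h' h0 hst (min_le_right _ _) ih ?_
        have h1 := hsm (min (n * δ) T) (min ((n + 1 : ℕ) * δ) T) h0 (min_le_right _ _) (by
          push_cast
          rcases min_cases ((n : ℝ) * δ) T with ⟨e, _⟩ | ⟨e, _⟩ <;> rw [e]
          · have := min_le_left (((n : ℝ) + 1) * δ) T; linarith
          · have := min_le_right (((n : ℝ) + 1) * δ) T; linarith)
        calc A * (8 * _) ≤ A * (8 * (1 / (8 * A))) := by gcongr
          _ = 1 := by field_simp
    obtain ⟨n, hn⟩ := exists_nat_ge (T / δ)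
    have := step n
    rwa [min_eq_right ((div_le_iff₀ hδ).1 hn)] at this
  intro z hz
  exact main (z.2 + 1) (by linarith [mem_Ici.1 hz.2]) ⟨hz.1, hz.2, by linarith⟩

end Uniqueness


/-! ### Uniqueness of the reflection measures -/

/-- Finite measures on `[0,1]` are determined by their integrals against test functions. -/
theorem ext_of_isTest {μ ν : Measure ℝ} [IsFiniteMeasure μ] [IsFiniteMeasure ν]
    (hμ : ∀ᵐ x ∂μ, x ∈ Icc (0 : ℝ) 1) (hν : ∀ᵐ x ∂ν, x ∈ Icc (0 : ℝ) 1)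
    (h : ∀ φ, IsTest φ → ∫ x, φ x ∂μ = ∫ x, φ x ∂ν) : μ = ν := by
  refine ext_of_forall_integral_eq_of_IsFiniteMeasure fun f => ?_
  have hI : ∀ (κ : Measure ℝ) [IsFiniteMeasure κ], (∀ᵐ x ∂κ, x ∈ Icc (0 : ℝ) 1) →
      ∀ g : ℝ → ℝ, Continuous g → Integrable g κ := fun κ _ hκ g hg => by
    obtain ⟨C, hC⟩ := isCompact_Icc.exists_bound_of_continuousOn (s := Icc (0 : ℝ) 1) hg.continuousOn
    exact Integrable.of_bound hg.aestronglyMeasurable C (hκ.mono fun x hx => hC x hx)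
  have happ : ∀ (κ : Measure ℝ) [IsFiniteMeasure κ], (∀ᵐ x ∂κ, x ∈ Icc (0 : ℝ) 1) →
      ∀ g : ℝ → ℝ, Continuous g → ∀ ε, (∀ x ∈ Icc (0 : ℝ) 1, |f x - g x| ≤ ε) →
      |∫ x, f x ∂κ - ∫ x, g x ∂κ| ≤ ε * κ.real univ := fun κ _ hκ g hg ε hε => by
    rw [← integral_sub (hI κ hκ f f.continuous) (hI κ hκ g hg), ← Real.norm_eq_abs]
    exact norm_integral_le_of_norm_le_const (hκ.mono fun x hx => hε x hx)
  refine eq_of_abs_sub_le_all fun ε hε => ?_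
  set m := μ.real univ + ν.real univ with hm
  have hm0 : 0 ≤ m := by positivity
  obtain ⟨s, a, ha⟩ := exists_cos_approx (f := f) f.continuous.continuousOn
    (show 0 < ε / (m + 1) by positivity)
  have ht := isTest_cos_sum s a
  have e1 := abs_le.1 (happ μ hμ _ ht.continuous _ ha)
  have e2 := abs_le.1 (happ ν hν _ ht.continuous _ ha)
  have e3 := h _ ht
  have e4 : ε / (m + 1) * μ.real univ + ε / (m + 1) * ν.real univ ≤ ε := by
    rw [← mul_add, div_mul_eq_mul_div, div_le_iff₀ (by positivity)]
    nlinarith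
  rw [abs_le]; constructor <;> linarith [e1.1, e1.2, e2.1, e2.2]

/-- Locally finite measures on `Q` are determined by the integrals of spatial test functions over
all strips. -/
theorem ext_of_strip_integrals {μ ν : Measure (ℝ × ℝ)} (hμQ : μ Qᶜ = 0) (hνQ : ν Qᶜ = 0)
    (hμ : ∀ T, μ (strip T) < ⊤) (hν : ∀ T, ν (strip T) < ⊤)
    (h : ∀ t, 0 ≤ t → ∀ φ, IsTest φ → ∫ z in strip t, φ z.1 ∂μ = ∫ z in strip t, φ z.1 ∂ν) :
    μ = ν := by
  have hfst : ∀ κ : Measure (ℝ × ℝ), ∀ t, ∀ᵐ x ∂(κ.restrict (strip t)).map Prod.fst,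
      x ∈ Icc (0 : ℝ) 1 := fun κ t => by
    rw [ae_map_iff (p := fun x => x ∈ Icc (0 : ℝ) 1) measurable_fst.aemeasurable measurableSet_Icc]
    exact (ae_restrict_mem (measurableSet_strip t)).mono fun z hz => hz.1
  have hfin : ∀ κ : Measure (ℝ × ℝ), (∀ T, κ (strip T) < ⊤) → ∀ t,
      IsFiniteMeasure (κ.restrict (strip t)) := fun κ hκ t => ⟨by simpa using hκ t⟩
  have hmarg : ∀ t, 0 ≤ t → (μ.restrict (strip t)).map Prod.fst =
      (ν.restrict (strip t)).map Prod.fst := fun t ht => by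
    have := hfin μ hμ t
    have := hfin ν hν t
    refine ext_of_isTest (hfst μ t) (hfst ν t) fun φ hφ => ?_
    rw [integral_map measurable_fst.aemeasurable hφ.continuous.aestronglyMeasurable,
      integral_map measurable_fst.aemeasurable hφ.continuous.aestronglyMeasurable]
    exact h t ht φ hφ
  have hrect : ∀ A : Set ℝ, MeasurableSet A → ∀ t, 0 ≤ t →
      μ ((A ×ˢ univ) ∩ strip t) = ν ((A ×ˢ univ) ∩ strip t) := fun A hA t ht => by
    have e := congrArg (fun κ => κ A) (hmarg t ht)
    simp only [Measure.map_apply measurable_fst hA] at e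
    rw [Measure.restrict_apply (measurable_fst hA), Measure.restrict_apply (measurable_fst hA)] at e
    have e2 : A ×ˢ (univ : Set ℝ) = Prod.fst ⁻¹' A := by ext z; simp
    rwa [e2]
  have hstrip : ∀ n : ℕ, μ.restrict (strip n) = ν.restrict (strip n) := fun n => by
    have i1 := hfin μ hμ n
    have i2 := hfin ν hν n
    refine Measure.ext_prod fun {A B} hA hB => ?_
    have hAu : MeasurableSet (A ×ˢ (univ : Set ℝ)) := hA.prod MeasurableSet.univ
    -- For fixed A the masses of A × [0,t] form a distribution function in t, which determines the
    -- measure in time.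
    have e : ((μ.restrict (strip n)).restrict (A ×ˢ univ)).map Prod.snd =
        ((ν.restrict (strip n)).restrict (A ×ˢ univ)).map Prod.snd := by
      refine Measure.ext_of_Iic _ _ fun t => ?_
      rw [Measure.map_apply measurable_snd measurableSet_Iic,
        Measure.map_apply measurable_snd measurableSet_Iic,
        Measure.restrict_apply (measurable_snd measurableSet_Iic),
        Measure.restrict_apply (measurable_snd measurableSet_Iic),
        Measure.restrict_apply ((measurable_snd measurableSet_Iic).inter hAu),
        Measure.restrict_apply ((measurable_snd measurableSet_Iic).inter hAu)]
      rcases lt_or_ge t 0 with ht | ht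
      · have : Prod.snd ⁻¹' Iic t ∩ A ×ˢ univ ∩ strip n = ∅ := by
          ext z
          simp only [mem_inter_iff, mem_empty_iff_false, iff_false]
          rintro ⟨⟨h1, -⟩, h2⟩
          have h3 : z.2 ≤ t := h1
          linarith [h2.2.1]
        rw [this, measure_empty, measure_empty]
      · have : Prod.snd ⁻¹' Iic t ∩ A ×ˢ univ ∩ strip n = (A ×ˢ univ) ∩ strip (min t n) := by
          ext z
          constructor
          · rintro ⟨⟨h1, h2⟩, h3⟩
            exact ⟨h2, h3.1, h3.2.1, le_min h1 h3.2.2⟩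
          · rintro ⟨h2, h3⟩
            exact ⟨⟨h3.2.2.trans (min_le_left _ _), h2⟩, h3.1, h3.2.1,
              h3.2.2.trans (min_le_right _ _)⟩
        rw [this]
        exact hrect A hA _ (le_min ht (Nat.cast_nonneg n))
    have e' := congrArg (fun κ => κ B) e
    simp only [Measure.map_apply measurable_snd hB] at e'
    rw [Measure.restrict_apply (measurable_snd hB), Measure.restrict_apply (measurable_snd hB)] at e'
    have e2 : A ×ˢ B = Prod.snd ⁻¹' B ∩ A ×ˢ univ := by
      ext z; simp [and_comm]
    rwa [e2]
  have hQ : μ.restrict Q = ν.restrict Q := by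
    rw [← iUnion_strip]; exact Measure.restrict_iUnion_congr.2 hstrip
  rwa [Measure.restrict_eq_self_of_ae_mem (show ∀ᵐ z ∂μ, z ∈ Q from hμQ),
    Measure.restrict_eq_self_of_ae_mem (show ∀ᵐ z ∂ν, z ∈ Q from hνQ)] at hQ

section Uniqueness
variable {α : ℝ} {K₁ K₂ : ℝ → ℝ} {f σ : ℝ → ℝ → ℝ} {u₀ : ℝ → ℝ} {hdot u u' : ℝ × ℝ → ℝ}
  {η ξ η' ξ' : Measure (ℝ × ℝ)}
  {L U : ℝ → ℝ} {f' σ' : ℝ → ℝ → ℝ} {hd : ℝ × ℝ → ℝ} {M C B : ℝ}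

/-- With equal profiles the weak forms differ only in the reflection terms, whence η + ξ' = η' + ξ.
The lower measures live on {u = K₁} and the upper ones on {u = K₂}; these sets are disjoint, so
restriction to each separates the identity. -/
theorem IsSolution.measures_eq
    (hs : IsSetting K₁ K₂ L U f σ hdot f' σ' hd M C B)
    (hK₁ : ContinuousOn K₁ (Icc 0 1)) (hK₂ : ContinuousOn K₂ (Icc 0 1))
    (hK : ∀ x ∈ Icc (0 : ℝ) 1, K₁ x < K₂ x)
    (h : IsSolution α K₁ K₂ f σ u₀ hdot u η ξ) (h' : IsSolution α K₁ K₂ f σ u₀ hdot u' η' ξ') :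
    η = η' ∧ ξ = ξ' := by
  have huu := h.eqOn hs hK₁ hK₂ h'
  have hcl : (fun z => u (clampQ z)) = fun z => u' (clampQ z) := by
    funext z; exact huu (clampQ_mem z)
  have hsum : η + ξ' = η' + ξ := by
    refine ext_of_strip_integrals ?_ ?_ ?_ ?_ ?_
    · simp [h.supp_η, h'.supp_ξ]
    · simp [h'.supp_η, h.supp_ξ]
    · exact fun T => by simpa using ⟨h.η_strip_lt_top T, h'.ξ_strip_lt_top T⟩
    · exact fun T => by simpa using ⟨h'.η_strip_lt_top T, h.ξ_strip_lt_top T⟩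
    · intro t ht φ hφ
      have e1 := h.weak_strip hs hφ ht
      have e2 := h'.weak_strip hs hφ ht
      have hcl' : ∀ z, u (clampQ z) = u' (clampQ z) := fun z => congrFun hcl z
      simp only [hcl'] at e1
      have hc : ContinuousOn (fun z : ℝ × ℝ => φ z.1) (strip t) :=
        (hφ.continuous.comp continuous_fst).continuousOn
      rw [Measure.restrict_add, Measure.restrict_add,
        integral_add_measure (integrableOn_strip_of_finite (h.η_strip_lt_top t) hc)
          (integrableOn_strip_of_finite (h'.ξ_strip_lt_top t) hc),
        integral_add_measure (integrableOn_strip_of_finite (h'.η_strip_lt_top t) hc)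
          (integrableOn_strip_of_finite (h.ξ_strip_lt_top t) hc)]
      linarith
  have a1 : ∀ᵐ z ∂η, z ∈ Q ∧ u z = K₁ z.1 :=
    (show ∀ᵐ z ∂η, z ∈ Q from h.supp_η).and (h.ae_η hK₁)
  have a2 : ∀ᵐ z ∂η', z ∈ Q ∧ u z = K₁ z.1 := by
    filter_upwards [show ∀ᵐ z ∂η', z ∈ Q from h'.supp_η, h'.ae_η hK₁] with z h1 h2
    exact ⟨h1, (huu h1).trans h2⟩
  have a3 : ∀ᵐ z ∂ξ, z ∈ Q ∧ u z = K₂ z.1 :=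
    (show ∀ᵐ z ∂ξ, z ∈ Q from h.supp_ξ).and (h.ae_ξ hK₂)
  have a4 : ∀ᵐ z ∂ξ', z ∈ Q ∧ u z = K₂ z.1 := by
    filter_upwards [show ∀ᵐ z ∂ξ', z ∈ Q from h'.supp_ξ, h'.ae_ξ hK₂] with z h1 h2
    exact ⟨h1, (huu h1).trans h2⟩
  have n3 : ∀ κ : Measure (ℝ × ℝ), (∀ᵐ z ∂κ, z ∈ Q ∧ u z = K₂ z.1) →
      κ {z | z ∈ Q ∧ u z = K₁ z.1} = 0 := fun κ hκ => by
    refine measure_mono_null (fun z hz => ?_) hκ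
    rintro ⟨-, h2⟩
    have := hK z.1 hz.1.1
    have := hz.2
    linarith
  have n1 : ∀ κ : Measure (ℝ × ℝ), (∀ᵐ z ∂κ, z ∈ Q ∧ u z = K₁ z.1) →
      κ {z | z ∈ Q ∧ u z = K₂ z.1} = 0 := fun κ hκ => by
    refine measure_mono_null (fun z hz => ?_) hκ
    rintro ⟨-, h2⟩
    have := hK z.1 hz.1.1
    have := hz.2
    linarith
  constructor
  · have e := congrArg (fun κ => κ.restrict {z | z ∈ Q ∧ u z = K₁ z.1}) hsum
    simp only [Measure.restrict_add] at e
    rwa [Measure.restrict_eq_zero.2 (n3 _ a4), Measure.restrict_eq_zero.2 (n3 _ a3), add_zero,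
      add_zero, Measure.restrict_eq_self_of_ae_mem (s := {z | z ∈ Q ∧ u z = K₁ z.1}) a1, Measure.restrict_eq_self_of_ae_mem (s := {z | z ∈ Q ∧ u z = K₁ z.1}) a2] at e
  · have e := congrArg (fun κ => κ.restrict {z | z ∈ Q ∧ u z = K₂ z.1}) hsum
    simp only [Measure.restrict_add] at e
    rw [Measure.restrict_eq_zero.2 (n1 _ a1), Measure.restrict_eq_zero.2 (n1 _ a2), zero_add,
      zero_add, Measure.restrict_eq_self_of_ae_mem (s := {z | z ∈ Q ∧ u z = K₂ z.1}) a4, Measure.restrict_eq_self_of_ae_mem (s := {z | z ∈ Q ∧ u z = K₂ z.1}) a3] at e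
    exact e.symm

end Uniqueness


/-! ### Lebesgue decomposition of the reflection measures -/

/-- Clamping the argument extends the wall to the whole line, continuous and bounded, without
changing it on [0,1]. -/
theorem exists_obstacle {K : ℝ → ℝ} (hK : ContinuousOn K (Icc 0 1)) (h2 : HasL2SecondDeriv K) :
    ∃ (κ : ℝ → ℝ) (B : ℝ), IsObstacle (fun x => K (max 0 (min x 1))) κ ∧
      EqOn (fun x => K (max 0 (min x 1))) K (Icc 0 1) ∧ (∀ x, |K (max 0 (min x 1))| ≤ B) ∧
      κ 0 = derivWithin K (Icc 0 1) 0 ∧ κ 1 = -derivWithin K (Icc 0 1) 1 := by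
  obtain ⟨κ, hκm, hκ2, hκ0, hκ1, hκ⟩ := exists_wall_density hK h2
  obtain ⟨B, hB⟩ := isCompact_Icc.exists_bound_of_continuousOn hK
  have hmem : ∀ x : ℝ, max 0 (min x 1) ∈ Icc (0 : ℝ) 1 := fun x =>
    ⟨le_max_left _ _, max_le zero_le_one (min_le_right _ _)⟩
  have heq : EqOn (fun x => K (max 0 (min x 1))) K (Icc 0 1) := fun x hx => by
    simp only [min_eq_left hx.2, max_eq_right hx.1]
  refine ⟨κ, B, ⟨hK.comp_continuous (by fun_prop) hmem, hκm, hκ2, fun φ hφ => ?_⟩, heq,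
    fun x => hB _ (hmem x), hκ0, hκ1⟩
  rw [← hκ φ hφ]
  exact setIntegral_congr_fun measurableSet_Icc fun x hx => by
    have := heq hx
    simp only at this ⊢
    rw [this]

/-- Boundary traces of the time axis. -/
noncomputable def sideMeasure (a : ℝ) : Measure (ℝ × ℝ) :=
  (volume.restrict (Ici (0 : ℝ))).map (Prod.mk a)

theorem Lam_eq : Lam = (volume : Measure (ℝ × ℝ)).restrict Q + sideMeasure 0 + sideMeasure 1 := by
  rw [Lam, rho_prod, Measure.prod_restrict, ← Measure.volume_eq_prod]; rfl

theorem ae_sideMeasure (a : ℝ) : ∀ᵐ z ∂sideMeasure a, z.1 = a := by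
  rw [sideMeasure, ae_map_iff (p := fun z : ℝ × ℝ => z.1 = a) (measurable_mk a).aemeasurable
    (measurable_fst (measurableSet_singleton a))]
  exact Eventually.of_forall fun _ => rfl

theorem sideMeasure_mutuallySingular (a : ℝ) : sideMeasure a ⟂ₘ (volume : Measure (ℝ × ℝ)) := by
  refine ⟨{z | z.1 ≠ a}, (measurable_fst (measurableSet_singleton a)).compl, ae_sideMeasure a, ?_⟩
  have : {z : ℝ × ℝ | z.1 ≠ a}ᶜ = {a} ×ˢ univ := by ext z; simp
  rw [this, Measure.volume_eq_prod, Measure.prod_prod, Real.volume_singleton, zero_mul]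

section Density
variable {p : ℝ × ℝ → ℝ}

theorem reflMeasure_eq : reflMeasure p =
    ((volume : Measure (ℝ × ℝ)).restrict Q).withDensity (fun z => ENNReal.ofReal (p z)) +
      (sideMeasure 0).withDensity (fun z => ENNReal.ofReal (p z)) +
      (sideMeasure 1).withDensity (fun z => ENNReal.ofReal (p z)) := by
  rw [reflMeasure, Lam_eq, withDensity_add_measure, withDensity_add_measure]

/-- The boundary parts sit on two vertical lines of zero area, hence are singular; the Radon–Nikodym
derivative sees only the interior. The energy estimates therefore need no sign condition on the
slopes. -/
theorem rnDeriv_reflMeasure (hp : Measurable p) :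
    (reflMeasure p).rnDeriv volume =ᵐ[volume]
      Q.indicator fun z => ENNReal.ofReal (p z) := by
  have hs : ∀ a, (sideMeasure a).withDensity (fun z => ENNReal.ofReal (p z)) ⟂ₘ
      (volume : Measure (ℝ × ℝ)) := fun a =>
    (sideMeasure_mutuallySingular a).mono_ac (withDensity_absolutelyContinuous _ _)
      Measure.AbsolutelyContinuous.rfl
  refine (Measure.eq_rnDeriv (s := (sideMeasure 0).withDensity (fun z => ENNReal.ofReal (p z)) +
    (sideMeasure 1).withDensity (fun z => ENNReal.ofReal (p z)))
    (hp.ennreal_ofReal.indicator measurableSet_Q) ((hs 0).add_left (hs 1)) ?_).symm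
  rw [reflMeasure_eq, withDensity_indicator measurableSet_Q]
  abel

theorem reflMeasure_restrict_openStrip : (reflMeasure p).restrict openStrip ≪ volume := by
  have hO : MeasurableSet openStrip := measurableSet_Ioo.prod measurableSet_Ici
  refine Measure.AbsolutelyContinuous.mk fun s hs h0 => ?_
  have hside : ∀ a : ℝ, a ∉ Ioo (0 : ℝ) 1 →
      (sideMeasure a).withDensity (fun z => ENNReal.ofReal (p z)) (s ∩ openStrip) = 0 := by
    intro a ha
    refine withDensity_absolutelyContinuous _ _ (measure_mono_null ?_ (ae_sideMeasure a))
    intro z hz hza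
    have h1 : z.1 ∈ Ioo (0 : ℝ) 1 := hz.2.1
    have h2 : z.1 = a := hza
    exact ha (h2 ▸ h1)
  rw [Measure.restrict_apply hs, reflMeasure_eq, Measure.add_apply, Measure.add_apply,
    hside 0 (by simp), hside 1 (by simp), add_zero, add_zero]
  refine withDensity_absolutelyContinuous _ _ (le_antisymm ?_ (zero_le))
  exact (Measure.restrict_apply_le _ _).trans ((measure_mono inter_subset_left).trans h0.le)

theorem reflMeasure_absolutelyContinuous (hp : ∀ z : ℝ × ℝ, z.1 = 0 ∨ z.1 = 1 → p z = 0) :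
    reflMeasure p ≪ volume := by
  have hside : ∀ a : ℝ, a = 0 ∨ a = 1 →
      (sideMeasure a).withDensity (fun z => ENNReal.ofReal (p z)) = 0 := by
    intro a ha
    rw [withDensity_congr_ae (g := 0), withDensity_zero]
    filter_upwards [ae_sideMeasure a] with z hz
    rw [hp z (by rw [hz]; exact ha), ENNReal.ofReal_zero]
    rfl
  rw [reflMeasure_eq, hside 0 (Or.inl rfl), hside 1 (Or.inr rfl), add_zero, add_zero]
  exact (withDensity_absolutelyContinuous _ _).trans Measure.restrict_le_self.absolutelyContinuous

end Density

/-- Every solution has reflection measures dominated by the loads of the obstacles. -/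
theorem IsSolution.exists_density {α M B : ℝ} {L U K₁ K₂ κ₁ κ₂ u₀ : ℝ → ℝ}
    {f σ : ℝ → ℝ → ℝ} {h hdot u : ℝ × ℝ → ℝ} {η ξ : Measure (ℝ × ℝ)}
    (hK : IsWallPair K₁ K₂) (hL : IsObstacle L κ₁) (hU : IsObstacle U κ₂)
    (hLK : EqOn L K₁ (Icc 0 1)) (hUK : EqOn U K₂ (Icc 0 1)) (hLU : ∀ x, L x < U x)
    (hLB : ∀ x, |L x| ≤ B) (hUB : ∀ x, |U x| ≤ B) (hc : CoeffCondition f σ)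
    (hM : ∀ x ∈ Icc (0 : ℝ) 1, ∀ y : ℝ, |f x y| ≤ M ∧ |σ x y| ≤ M)
    (h0 : IsInitialValue K₁ K₂ u₀) (hh : IsCameronMartin h hdot)
    (hsol : IsSolution α K₁ K₂ f σ u₀ hdot u η ξ) :
    ∃ (hd p q : ℝ × ℝ → ℝ), (∀ᵐ z ∂(volume : Measure (ℝ × ℝ)).restrict Q, hd z = hdot z) ∧
      Measurable p ∧ Measurable q ∧
      (∀ z, 0 ≤ p z ∧ p z ≤ load κ₁ (reactionBound α M B hd) z) ∧
      (∀ z, 0 ≤ q z ∧ q z ≤ load (fun x => -κ₂ x) (reactionBound α M B hd) z) ∧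
      η = reflMeasure p ∧ ξ = reflMeasure q := by
  obtain ⟨f', σ', hd, C, hr⟩ := exists_isRegularized hc hh hM
  obtain ⟨u', p, q, hpm, hqm, hp, hq, hs'⟩ := exists_dominated_solution (α := α) hL hU hLK hUK hLU
    hLB hUB hr h0
  have hset : IsSetting K₁ K₂ L U f σ hdot f' σ' hd M C B :=
    ⟨hr, hL.continuous, hU.continuous, hLK, hUK, hLB, hUB⟩
  -- Uniqueness transfers the domination by the loads from the constructed solution to the given
  -- one.
  obtain ⟨e1, e2⟩ := hsol.measures_eq hset hK.continuousOn_lower hK.continuousOn_upper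
    (fun x hx => (hK.lower_neg x hx).trans (hK.upper_pos x hx)) hs'
  exact ⟨hd, p, q, hr.ae_eq.mono fun z hz => hz.1, hpm, hqm, hp, hq, e1, e2⟩

/-! ### Energy estimates for the densities -/

theorem integral_strip_mul (a b : ℝ → ℝ) (T : ℝ) :
    ∫ z in strip T, a z.1 * b z.2 = (∫ x in Icc (0 : ℝ) 1, a x) * ∫ t in Icc 0 T, b t := by
  rw [strip, Measure.volume_eq_prod, ← Measure.prod_restrict]
  exact integral_prod_mul a b

/-- The weighted energy of a reflection density. -/
theorem lintegral_weight_rnDeriv_sq_le {α M B : ℝ} {κ : ℝ → ℝ} {hd hdot p : ℝ × ℝ → ℝ}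
    (hM : 0 ≤ M) (hB : 0 ≤ B) (hκ : MemLp κ 2 (volume.restrict (Icc (0 : ℝ) 1)))
    (hae : ∀ᵐ z ∂(volume : Measure (ℝ × ℝ)).restrict Q, hd z = hdot z) (hpm : Measurable p)
    (hp : ∀ z, 0 ≤ p z ∧ p z ≤ load κ (reactionBound α M B hd) z) {T : ℝ}
    (hh : MemLp hdot 2 (volume.restrict (strip T))) {e : ℝ → ℝ} (he : Continuous e)
    (he0 : ∀ t, 0 ≤ e t) (he1 : ∀ t ≤ T, e t ≤ 1) :
    ∫⁻ z in strip T, ENNReal.ofReal (e z.2) * (reflMeasure p).rnDeriv volume z ^ 2 ≤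
      ENNReal.ofReal (3 * (((∫ x in Icc (0 : ℝ) 1, κ x ^ 2) + (M + |α| * B) ^ 2) *
        (∫ t in Icc 0 T, e t) + M ^ 2 * ∫ z in strip T, hdot z ^ 2)) := by
  set A := M + |α| * B with hA
  have hfin : IsFiniteMeasure ((volume : Measure (ℝ × ℝ)).restrict (strip T)) :=
    ⟨by simpa using (isCompact_strip T).measure_lt_top⟩
  have hsub : strip T ⊆ Q := fun z hz => ⟨hz.1, hz.2.1⟩
  have hmem := ae_restrict_mem (μ := (volume : Measure (ℝ × ℝ))) (measurableSet_strip T)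
  have heI : IntegrableOn e (Icc 0 T) := he.continuousOn.integrableOn_Icc
  have i1 : IntegrableOn (fun z : ℝ × ℝ => κ z.1 ^ 2 * e z.2) (strip T) := by
    rw [IntegrableOn, strip, Measure.volume_eq_prod, ← Measure.prod_restrict]
    exact hκ.integrable_sq.mul_prod heI
  have i2 : IntegrableOn (fun z : ℝ × ℝ => A ^ 2 * e z.2) (strip T) :=
    (Continuous.continuousOn (by fun_prop)).integrableOn_compact (isCompact_strip T)
  have i3 : IntegrableOn (fun z : ℝ × ℝ => M ^ 2 * hdot z ^ 2) (strip T) :=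
    hh.integrable_sq.const_mul _
  have i12 : IntegrableOn (fun z : ℝ × ℝ => κ z.1 ^ 2 * e z.2 + A ^ 2 * e z.2) (strip T) :=
    i1.add i2
  have i123 : IntegrableOn (fun z : ℝ × ℝ => 3 * (κ z.1 ^ 2 * e z.2 + A ^ 2 * e z.2 +
    M ^ 2 * hdot z ^ 2)) (strip T) := (i12.add i3).const_mul 3
  have hA0 : 0 ≤ A := by positivity
  have hpt : ∀ᵐ z ∂(volume : Measure (ℝ × ℝ)).restrict (strip T),
      ENNReal.ofReal (e z.2) * (reflMeasure p).rnDeriv volume z ^ 2 ≤ ENNReal.ofReal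
        (3 * (κ z.1 ^ 2 * e z.2 + A ^ 2 * e z.2 + M ^ 2 * hdot z ^ 2)) := by
    filter_upwards [hmem, ae_restrict_of_ae (rnDeriv_reflMeasure hpm),
      ae_restrict_of_ae_restrict_of_subset hsub hae] with z hz h1 h2
    rw [h1, indicator_of_mem (hsub hz), ← ENNReal.ofReal_pow (hp z).1,
      ← ENNReal.ofReal_mul (he0 _)]
    refine ENNReal.ofReal_le_ofReal ?_
    have b1 : p z ≤ |κ z.1| + A + M * |hdot z| := by
      refine (hp z).2.trans ?_
      have c1 : max 0 (-κ z.1) ≤ |κ z.1| := max_le (abs_nonneg _) (neg_le_abs _)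
      have c2 : reactionBound α M B hd z ≤ M + M * |hd z| + |α| * B :=
        indicator_le_self' (fun _ _ => by positivity) _
      rw [h2] at c2
      simp only [load]
      linarith
    have b2 : p z ^ 2 ≤ 3 * (κ z.1 ^ 2 + A ^ 2 + M ^ 2 * hdot z ^ 2) := by
      have c1 := pow_le_pow_left₀ (hp z).1 b1 2
      have c2 : M ^ 2 * hdot z ^ 2 = (M * |hdot z|) ^ 2 := by rw [mul_pow, sq_abs]
      rw [c2, ← sq_abs (κ z.1)]
      nlinarith [sq_nonneg (|κ z.1| - A), sq_nonneg (|κ z.1| - M * |hdot z|),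
        sq_nonneg (A - M * |hdot z|)]
    -- The weight is discarded only on the control term, whose energy is assumed finite; on the
    -- other two terms it is kept, and they contribute the time integral of e.
    have b3 : e z.2 * (M ^ 2 * hdot z ^ 2) ≤ M ^ 2 * hdot z ^ 2 :=
      mul_le_of_le_one_left (by positivity) (he1 _ hz.2.2)
    calc e z.2 * p z ^ 2 ≤ e z.2 * (3 * (κ z.1 ^ 2 + A ^ 2 + M ^ 2 * hdot z ^ 2)) :=
          mul_le_mul_of_nonneg_left b2 (he0 _)
      _ ≤ _ := by linarith
  refine (lintegral_mono_ae hpt).trans (le_of_eq ?_)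
  rw [← ofReal_integral_eq_lintegral_ofReal i123 (Eventually.of_forall fun z => by
    have := he0 z.2
    simp only [Pi.zero_apply]
    positivity)]
  congr 1
  have j1 := integral_strip_mul (fun x => κ x ^ 2) e T
  have j2 : ∫ z in strip T, A ^ 2 * e z.2 = A ^ 2 * ∫ t in Icc 0 T, e t := by
    rw [integral_strip_mul (fun _ => A ^ 2) e T]; simp
  rw [integral_const_mul, integral_add i12 i3, integral_add i1 i2, j1, j2, integral_const_mul]
  ring

/-- The bound does not involve T, which is what makes the weighted estimate uniform in time. -/
theorem integral_exp_weight_le {α : ℝ} (hα : 0 < α) {T : ℝ} (hT : 0 ≤ T) :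
    ∫ t in Icc 0 T, Real.exp (-α * (T - t)) ≤ 1 / α := by
  have h1 : ∫ t in (0 : ℝ)..T, Real.exp (-α * (T - t)) = (1 - Real.exp (-α * T)) / α := by
    rw [intervalIntegral.integral_eq_sub_of_hasDerivAt
      (f := fun t => Real.exp (-α * (T - t)) / α)]
    · simp; ring
    · intro t _
      have := ((((hasDerivAt_id t).const_sub T).const_mul (-α)).exp).div_const α
      exact this.congr_deriv (by simp; field_simp)
    · exact Continuous.intervalIntegrable (by fun_prop) _ _
  rw [integral_Icc_eq_integral_Ioc, ← intervalIntegral.integral_of_le hT, h1]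
  gcongr
  linarith [Real.exp_pos (-α * T)]

end ReflectedSkeleton

/-! ### The main theorem -/

open ReflectedSkeleton in
theorem theorem4p1 (α : ℝ) (K₁ K₂ : ℝ → ℝ) (hK : IsWallPair K₁ K₂) :
    -- existence and uniqueness
    (∀ (f σ : ℝ → ℝ → ℝ) (u₀ : ℝ → ℝ) (h hdot : ℝ × ℝ → ℝ),
      CoeffCondition f σ → IsInitialValue K₁ K₂ u₀ → IsCameronMartin h hdot →
      ∃ (u : ℝ × ℝ → ℝ) (η ξ : Measure (ℝ × ℝ)),
        IsSolution α K₁ K₂ f σ u₀ hdot u η ξ ∧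
        ∀ (u' : ℝ × ℝ → ℝ) (η' ξ' : Measure (ℝ × ℝ)),
          IsSolution α K₁ K₂ f σ u₀ hdot u' η' ξ' → EqOn u' u Q ∧ η' = η ∧ ξ' = ξ) ∧
    -- absolute continuity of the reflection measures
    (∀ (f σ : ℝ → ℝ → ℝ) (u₀ : ℝ → ℝ) (h hdot : ℝ × ℝ → ℝ)
        (u : ℝ × ℝ → ℝ) (η ξ : Measure (ℝ × ℝ)),
      CoeffCondition f σ → IsInitialValue K₁ K₂ u₀ → IsCameronMartin h hdot →
      IsSolution α K₁ K₂ f σ u₀ hdot u η ξ →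
      η.restrict openStrip ≪ volume ∧ ξ.restrict openStrip ≪ volume ∧
      (0 ≤ derivWithin K₁ (Icc 0 1) 0 → derivWithin K₁ (Icc 0 1) 1 ≤ 0 → η ≪ volume) ∧
      (derivWithin K₂ (Icc 0 1) 0 ≤ 0 → 0 ≤ derivWithin K₂ (Icc 0 1) 1 → ξ ≪ volume)) ∧
    -- square integrability of the densities on bounded time intervals
    (∀ M R T : ℝ, 0 < T → ∃ C : ℝ,
      ∀ (f σ : ℝ → ℝ → ℝ) (u₀ : ℝ → ℝ) (h hdot : ℝ × ℝ → ℝ)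
        (u : ℝ × ℝ → ℝ) (η ξ : Measure (ℝ × ℝ)),
      CoeffCondition f σ → (∀ x ∈ Icc (0 : ℝ) 1, ∀ y : ℝ, |f x y| ≤ M ∧ |σ x y| ≤ M) →
      IsInitialValue K₁ K₂ u₀ → IsCameronMartin h hdot →
      ∫ z in strip T, hdot z ^ 2 ≤ R →
      IsSolution α K₁ K₂ f σ u₀ hdot u η ξ →
      ∫⁻ z in strip T, η.rnDeriv volume z ^ 2 ≤ ENNReal.ofReal C ∧
      ∫⁻ z in strip T, ξ.rnDeriv volume z ^ 2 ≤ ENNReal.ofReal C) ∧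
    -- weighted estimate, uniform in time, for controls of finite energy
    (0 < α → ∀ M : ℝ, ∃ C : ℝ,
      ∀ (f σ : ℝ → ℝ → ℝ) (u₀ : ℝ → ℝ) (h hdot : ℝ × ℝ → ℝ)
        (u : ℝ × ℝ → ℝ) (η ξ : Measure (ℝ × ℝ)),
      CoeffCondition f σ → (∀ x ∈ Icc (0 : ℝ) 1, ∀ y : ℝ, |f x y| ≤ M ∧ |σ x y| ≤ M) →
      IsInitialValue K₁ K₂ u₀ → IsCameronMartin h hdot →
      MemLp hdot 2 (volume.restrict Q) →
      IsSolution α K₁ K₂ f σ u₀ hdot u η ξ →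
      ∀ T : ℝ, 0 < T →
        ∫⁻ z in strip T, ENNReal.ofReal (Real.exp (-α * (T - z.2))) * η.rnDeriv volume z ^ 2
          ≤ ENNReal.ofReal (C * (1 + ∫ z in Q, hdot z ^ 2)) ∧
        ∫⁻ z in strip T, ENNReal.ofReal (Real.exp (-α * (T - z.2))) * ξ.rnDeriv volume z ^ 2
          ≤ ENNReal.ofReal (C * (1 + ∫ z in Q, hdot z ^ 2))) := by
  obtain ⟨κ₁, B₁, hL, hLK, hLB, hκ₁0, hκ₁1⟩ := exists_obstacle hK.continuousOn_lower hK.lower_deriv2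
  obtain ⟨κ₂, B₂, hU, hUK, hUB, hκ₂0, hκ₂1⟩ := exists_obstacle hK.continuousOn_upper hK.upper_deriv2
  set L : ℝ → ℝ := fun x => K₁ (max 0 (min x 1)) with hLdef
  set U : ℝ → ℝ := fun x => K₂ (max 0 (min x 1)) with hUdef
  set B := max B₁ B₂ with hB
  have hLB' : ∀ x, |L x| ≤ B := fun x => (hLB x).trans (le_max_left _ _)
  have hUB' : ∀ x, |U x| ≤ B := fun x => (hUB x).trans (le_max_right _ _)
  have hB0 : 0 ≤ B := (abs_nonneg _).trans (hLB' 0)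
  have hLU : ∀ x, L x < U x := fun x => by
    have hx : max 0 (min x 1) ∈ Icc (0 : ℝ) 1 :=
      ⟨le_max_left _ _, max_le zero_le_one (min_le_right _ _)⟩
    exact (hK.lower_neg _ hx).trans (hK.upper_pos _ hx)
  have hI₁ : 0 ≤ ∫ x in Icc (0 : ℝ) 1, κ₁ x ^ 2 := integral_nonneg fun _ => sq_nonneg _
  have hI₂ : 0 ≤ ∫ x in Icc (0 : ℝ) 1, κ₂ x ^ 2 := integral_nonneg fun _ => sq_nonneg _
  have hneg : MemLp (fun x => -κ₂ x) 2 (volume.restrict (Icc (0 : ℝ) 1)) := hU.memLp.neg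
  refine ⟨?_, ?_, ?_, ?_⟩
  · intro f σ u₀ h hdot hc h0 hh
    obtain ⟨M, hM⟩ := hc.bounded
    obtain ⟨f', σ', hd, C, hr⟩ := exists_isRegularized hc hh hM
    obtain ⟨u, p, q, -, -, -, -, hs⟩ := exists_dominated_solution (α := α) hL hU hLK hUK hLU
      hLB' hUB' hr h0
    have hset : IsSetting K₁ K₂ L U f σ hdot f' σ' hd M C B :=
      ⟨hr, hL.continuous, hU.continuous, hLK, hUK, hLB', hUB'⟩
    refine ⟨u, _, _, hs, fun u' η' ξ' hs' => ⟨?_, ?_⟩⟩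
    · exact hs'.eqOn hset hK.continuousOn_lower hK.continuousOn_upper hs
    · exact hs'.measures_eq hset hK.continuousOn_lower hK.continuousOn_upper
        (fun x hx => (hK.lower_neg x hx).trans (hK.upper_pos x hx)) hs
  · intro f σ u₀ h hdot u η ξ hc h0 hh hs
    obtain ⟨M, hM⟩ := hc.bounded
    obtain ⟨hd, p, q, -, -, -, hp, hq, rfl, rfl⟩ := hs.exists_density hK hL hU hLK hUK hLU hLB' hUB'
      hc hM h0 hh
    refine ⟨reflMeasure_restrict_openStrip, reflMeasure_restrict_openStrip, fun h1 h2 => ?_,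
      fun h1 h2 => ?_⟩
    · refine reflMeasure_absolutelyContinuous fun z hz => le_antisymm ?_ (hp z).1
      refine (hp z).2.trans (le_of_eq ?_)
      -- On the lateral boundary the load is max(0, −κ₁), that is max(0, −K₁'(0)) at 0 and max(0,
      -- K₁'(1)) at 1; the sign conditions make both vanish.
      rw [load, reactionBound_bdry hz, add_zero, max_eq_left]
      rcases hz with hz | hz <;> rw [hz]
      · rw [hκ₁0]; linarith
      · rw [hκ₁1]; linarith
    · refine reflMeasure_absolutelyContinuous fun z hz => le_antisymm ?_ (hq z).1
      refine (hq z).2.trans (le_of_eq ?_)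
      rw [load, reactionBound_bdry hz, add_zero, max_eq_left]
      rcases hz with hz | hz <;> rw [hz]
      · rw [hκ₂0]; linarith
      · rw [hκ₂1]; linarith
  · intro M R T hT
    -- The weight is constantly 1, with time integral T. Adding the energies of both curvatures
    -- gives one constant for both measures.
    refine ⟨3 * (((∫ x in Icc (0 : ℝ) 1, κ₁ x ^ 2) + (∫ x in Icc (0 : ℝ) 1, κ₂ x ^ 2) +
      (M + |α| * B) ^ 2) * T + M ^ 2 * R), fun f σ u₀ h hdot u η ξ hc hM h0 hh hR hs => ?_⟩
    have hM0 : 0 ≤ M := (abs_nonneg _).trans (hM 0 (by simp) 0).1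
    obtain ⟨hd, p, q, hae, hpm, hqm, hp, hq, rfl, rfl⟩ := hs.exists_density hK hL hU hLK hUK hLU
      hLB' hUB' hc hM h0 hh
    have e1 := lintegral_weight_rnDeriv_sq_le hM0 hB0 hL.memLp hae hpm hp (hh.memLp T hT)
      (continuous_const (y := (1 : ℝ))) (fun _ => zero_le_one) (fun _ _ => le_rfl)
    have e2 := lintegral_weight_rnDeriv_sq_le hM0 hB0 hneg hae hqm hq (hh.memLp T hT)
      (continuous_const (y := (1 : ℝ))) (fun _ => zero_le_one) (fun _ _ => le_rfl)
    have hT1 : ∫ _ in Icc (0 : ℝ) T, (1 : ℝ) = T := by simp [hT.le]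
    have hMR : M ^ 2 * ∫ z in strip T, hdot z ^ 2 ≤ M ^ 2 * R :=
      mul_le_mul_of_nonneg_left hR (sq_nonneg _)
    have hT₁ := mul_nonneg hI₁ hT.le
    have hT₂ := mul_nonneg hI₂ hT.le
    simp only [ENNReal.ofReal_one, one_mul, hT1, neg_sq] at e1 e2
    exact ⟨e1.trans (ENNReal.ofReal_le_ofReal (by linarith)),
      e2.trans (ENNReal.ofReal_le_ofReal (by linarith))⟩
  · intro hα M
    -- The same constant with T replaced by 1/α, the bound for the integral of the exponential
    -- weight; the energy of the control is left to the factor 1 + ∫hdot².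
    refine ⟨3 * (((∫ x in Icc (0 : ℝ) 1, κ₁ x ^ 2) + (∫ x in Icc (0 : ℝ) 1, κ₂ x ^ 2) +
      (M + |α| * B) ^ 2) * (1 / α) + M ^ 2), fun f σ u₀ h hdot u η ξ hc hM h0 hh hQ hs T hT => ?_⟩
    have hM0 : 0 ≤ M := (abs_nonneg _).trans (hM 0 (by simp) 0).1
    obtain ⟨hd, p, q, hae, hpm, hqm, hp, hq, rfl, rfl⟩ := hs.exists_density hK hL hU hLK hUK hLU
      hLB' hUB' hc hM h0 hh
    have hw : Continuous fun t => Real.exp (-α * (T - t)) := by fun_prop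
    have hw1 : ∀ t ≤ T, Real.exp (-α * (T - t)) ≤ 1 := fun t ht =>
      Real.exp_le_one_iff.2 (mul_nonpos_of_nonpos_of_nonneg (by linarith) (by linarith))
    have e1 := lintegral_weight_rnDeriv_sq_le hM0 hB0 hL.memLp hae hpm hp (hh.memLp T hT) hw
      (fun _ => (Real.exp_pos _).le) hw1
    have e2 := lintegral_weight_rnDeriv_sq_le hM0 hB0 hneg hae hqm hq (hh.memLp T hT) hw
      (fun _ => (Real.exp_pos _).le) hw1
    simp only [neg_sq] at e2
    have hE := integral_exp_weight_le hα hT.le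
    have hX : ∫ z in strip T, hdot z ^ 2 ≤ ∫ z in Q, hdot z ^ 2 :=
      setIntegral_mono_set hQ.integrable_sq (Filter.Eventually.of_forall fun _ => sq_nonneg _)
        (Filter.Eventually.of_forall fun _ hz => ⟨hz.1, hz.2.1⟩)
    set X := ∫ z in Q, hdot z ^ 2 with hXdef
    set I₁ := ∫ x in Icc (0 : ℝ) 1, κ₁ x ^ 2 with hI₁def
    set I₂ := ∫ x in Icc (0 : ℝ) 1, κ₂ x ^ 2 with hI₂def
    have hX0 : 0 ≤ X := integral_nonneg fun _ => sq_nonneg _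
    have hα' : 0 ≤ 1 / α := by positivity
    have key : ∀ I, I ≤ I₁ + I₂ → 0 ≤ I →
        3 * ((I + (M + |α| * B) ^ 2) * (∫ t in Icc 0 T, Real.exp (-α * (T - t))) +
          M ^ 2 * ∫ z in strip T, hdot z ^ 2) ≤
        3 * ((I₁ + I₂ + (M + |α| * B) ^ 2) * (1 / α) + M ^ 2) * (1 + X) := by
      intro I hI hI0
      have c1 : (I + (M + |α| * B) ^ 2) * (∫ t in Icc 0 T, Real.exp (-α * (T - t))) ≤
          (I₁ + I₂ + (M + |α| * B) ^ 2) * (1 / α) :=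
        (mul_le_mul_of_nonneg_left hE (by positivity)).trans
          (mul_le_mul_of_nonneg_right (by linarith) hα')
      have c2 : M ^ 2 * ∫ z in strip T, hdot z ^ 2 ≤ M ^ 2 * X :=
        mul_le_mul_of_nonneg_left hX (sq_nonneg _)
      have c3 : 0 ≤ (I₁ + I₂ + (M + |α| * B) ^ 2) * (1 / α) * X := by positivity
      have c4 : 0 ≤ M ^ 2 := sq_nonneg _
      linarith
    exact ⟨e1.trans (ENNReal.ofReal_le_ofReal (key _ (by linarith) hI₁)),
      e2.trans (ENNReal.ofReal_le_ofReal (key _ (by linarith) hI₂))⟩
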